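/- Let $k$ be a field and $U$ a quasitriangular Hopf algebra over $k$ with universal $R$-matrix $\mathcal R=\mathcal R^{(1)}\otimes\mathcal R^{(2)}\in U\otimes U$ (invertible, $\Delta'(x)=\mathcal R\Delta(x)\mathcal R^{-1}$, $(\Delta\otimes\mathrm{id})\mathcal R=\mathcal R^{13}\mathcal R^{23}$, $(\mathrm{id}\otimes\Delta)\mathcal R=\mathcal R^{13}\mathcal R^{12}$). Left $U$-modules are braided by $\Psi(v\otimes w)=\mathcal R^{(2)}\triangleright w\otimes\mathcal R^{(1)}\triangleright v$. Let $\mathcal X$ and $\mathcal D$ be finite-dimensional Hopf algebras in the braided category of left $U$-modules (all structure maps are $U$-linear, and coproducts are multiplicative for the braided tensor product algebra structure), with antipodes denoted $S$. Let $\langle\cdot,\cdot\rangle:\mathcal D\otimes\mathcal X\to k$ be a nondegenerate $U$-invariant pairing with $\langle\sigma\tau,\xi\rangle=\langle\tau,\xi_{(1)}\rangle\langle\sigma,\xi_{(2)}\rangle$, $\langle\sigma,\xi\eta\rangle=\langle\sigma_{(1)},\eta\rangle\langle\sigma_{(2)},\xi\rangle$, $\langle1,\xi\rangle=\epsilon(\xi)$,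 $\langle\sigma,1\rangle=\epsilon(\sigma)$. Let $\{\phi^i\}\subset\mathcal X$ and $\{\epsilon_i\}\subset\mathcal D$ be dual bases, $\langle\epsilon_i,\phi^j\rangle=\delta_i^j$, and write $\Psi^{-1}(\phi^i\otimes\epsilon_i)=\epsilon'\otimes\phi'\in\mathcal D\otimes\mathcal X$ (sums understood). Define the braided trace integrals $$\langle\xi\rangle_{tr}=\langle S^{-2}(\epsilon'),\,\phi'\xi\rangle\quad(\xi\in\mathcal X),\qquad \langle\sigma\rangle_{tr}=\langle\cdot,\cdot\rangle\circ(\mathrm{id}\otimes S^{-2})\circ\Psi^{-1}(\phi^i\otimes\epsilon_i\sigma)\quad(\sigma\in\mathcal D),$$ and put $\underline\sigma=\langle1_{\mathcal X}\rangle_{tr}$. Then: 1. For all $\sigma\in\mathcal D$ and $\xi\in\mathcal X$, $$\langle\sigma\rangle_{tr}\,\langle\xi\rangle_{tr}=\underline\sigma\;\langle\sigma\,S^{-2}(\epsilon'),\,\phi'\xi\rangle .$$ 2. If $\underline\sigma\neq0$, then $\langle\cdot\rangle_{tr}$ is a nontrivial invariant integral on $\mathcal X$ (that is, it is not identically zero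 and $\xi_{(1)}\langle\xi_{(2)}\rangle_{tr}=\langle\xi\rangle_{tr}1_{\mathcal X}$ for all $\xi$), and $\langle\cdot\rangle_{tr}$ is not identically zero on $\mathcal D$. 3. If $\underline\sigma=0$, then $\langle\cdot\rangle_{tr}$ is identically zero on $\mathcal X$ or on $\mathcal D$ (or both). 4. If $k$ has characteristic zero (for instance $k=\mathbb C$), then $\langle\cdot\rangle_{tr}$ is identically zero on $\mathcal X$ if and only if $\underline\sigma=0$. -/

import Mathlib

open TensorProduct

/-! ### Quasitriangular Hopf algebras -/

section Quasitriangular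

variable {k U : Type*} [Field k] [Ring U] [HopfAlgebra k U]

/-- `R` is a universal R-matrix of the Hopf algebra `U`: it is an invertible element of `U ⊗ U`
such that `Δ'(x) = R Δ(x) R⁻¹`, `(Δ ⊗ id) R = R₁₃ R₂₃` and `(id ⊗ Δ) R = R₁₃ R₁₂`. -/
structure IsUniversalRMatrix (R : (U ⊗[k] U)ˣ) : Prop where
  /-- `Δ'(x) = R Δ(x) R⁻¹`, where `Δ'` is the opposite coproduct -/
  comul_op : ∀ x : U,
    TensorProduct.comm k U U (Coalgebra.comul x) =
      (R : U ⊗[k] U) * Coalgebra.comul x * ((R⁻¹ : (U ⊗[k] U)ˣ) : U ⊗[k] U)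
  /-- `(Δ ⊗ id) R = R₁₃ R₂₃` in `(U ⊗ U) ⊗ U` -/
  comul_left :
    Algebra.TensorProduct.map (Bialgebra.comulAlgHom k U) (AlgHom.id k U) (R : U ⊗[k] U) =
      Algebra.TensorProduct.map (Algebra.TensorProduct.includeLeft : U →ₐ[k] U ⊗[k] U)
          (AlgHom.id k U) (R : U ⊗[k] U) *
        Algebra.TensorProduct.map (Algebra.TensorProduct.includeRight : U →ₐ[k] U ⊗[k] U)
          (AlgHom.id k U) (R : U ⊗[k] U)
  /-- `(id ⊗ Δ) R = R₁₃ R₁₂` in `U ⊗ (U ⊗ U)` -/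
  comul_right :
    Algebra.TensorProduct.map (AlgHom.id k U) (Bialgebra.comulAlgHom k U) (R : U ⊗[k] U) =
      Algebra.TensorProduct.map (AlgHom.id k U)
          (Algebra.TensorProduct.includeRight : U →ₐ[k] U ⊗[k] U) (R : U ⊗[k] U) *
        Algebra.TensorProduct.map (AlgHom.id k U)
          (Algebra.TensorProduct.includeLeft : U →ₐ[k] U ⊗[k] U) (R : U ⊗[k] U)

end Quasitriangular

/-! ### The braiding of `U`-modules -/

section Braiding

variable {k U : Type*} [Field k] [Ring U] [HopfAlgebra k U]

/-- The componentwise action of `U ⊗ U` on `V ⊗ W`: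
`(x ⊗ y) (v ⊗ w) = (x ▷ v) ⊗ (y ▷ w)`. -/
noncomputable def tensorAction (V W : Type*) [AddCommGroup V] [Module k V] [Module U V]
    [IsScalarTower k U V] [AddCommGroup W] [Module k W] [Module U W] [IsScalarTower k U W] :
    U ⊗[k] U →ₗ[k] (V ⊗[k] W →ₗ[k] V ⊗[k] W) :=
  TensorProduct.homTensorHomMap (RingHom.id k) V W V W ∘ₗ
    TensorProduct.map (Algebra.lsmul k k V : U →ₐ[k] Module.End k V).toLinearMap
      (Algebra.lsmul k k W : U →ₐ[k] Module.End k W).toLinearMap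

/-- The braided transposition `Ψ : V ⊗ W → W ⊗ V`, `Ψ = τ ∘ (R⁽¹⁾ ▷ _ ⊗ R⁽²⁾ ▷ _)`. -/
noncomputable def braiding (R : (U ⊗[k] U)ˣ) (V W : Type*) [AddCommGroup V] [Module k V]
    [Module U V] [IsScalarTower k U V] [AddCommGroup W] [Module k W] [Module U W]
    [IsScalarTower k U W] : V ⊗[k] W →ₗ[k] W ⊗[k] V :=
  (TensorProduct.comm k V W).toLinearMap ∘ₗ tensorAction V W (R : U ⊗[k] U)

/-- The inverse braided transposition `Ψ⁻¹ : W ⊗ V → V ⊗ W`. -/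
noncomputable def braidingInv (R : (U ⊗[k] U)ˣ) (V W : Type*) [AddCommGroup V] [Module k V]
    [Module U V] [IsScalarTower k U V] [AddCommGroup W] [Module k W] [Module U W]
    [IsScalarTower k U W] : W ⊗[k] V →ₗ[k] V ⊗[k] W :=
  tensorAction V W ((R⁻¹ : (U ⊗[k] U)ˣ) : U ⊗[k] U) ∘ₗ (TensorProduct.comm k W V).toLinearMap

/-- The product of the braided tensor product algebra `X ⊗ X`, as the linear map
`(a ⊗ b) ⊗ (c ⊗ d) ↦ a Ψ(b ⊗ c) d`. -/
noncomputable def braidedTensorMul (R : (U ⊗[k] U)ˣ) (X : Type*) [Ring X] [Algebra k X]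
    [Module U X] [IsScalarTower k U X] :
    (X ⊗[k] X) ⊗[k] (X ⊗[k] X) →ₗ[k] X ⊗[k] X :=
  TensorProduct.map (LinearMap.mul' k X) (LinearMap.mul' k X) ∘ₗ
    (TensorProduct.assoc k X X (X ⊗[k] X)).symm.toLinearMap ∘ₗ
    LinearMap.lTensor X
      ((TensorProduct.assoc k X X X).toLinearMap ∘ₗ
        LinearMap.rTensor X (braiding R X X) ∘ₗ
        (TensorProduct.assoc k X X X).symm.toLinearMap) ∘ₗ
    (TensorProduct.assoc k X X (X ⊗[k] X)).toLinearMap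

end Braiding

/-! ### Braided Hopf algebras and their dual pairings -/

section BraidedHopf

variable {k U : Type*} [Field k] [Ring U] [HopfAlgebra k U]

/-- `X` (an algebra and a coalgebra with a left action of `U`) is, with antipode `S`, a Hopf
algebra in the category of left `U`-modules, braided by the universal R-matrix `R`. -/
structure IsBraidedHopfAlgebra (R : (U ⊗[k] U)ˣ) {X : Type*} [Ring X] [Algebra k X]
    [Coalgebra k X] [Module U X] [IsScalarTower k U X] (S : X →ₗ[k] X) : Prop where
  /-- the product is `U`-linear: `h ▷ (a b) = (h₁ ▷ a) (h₂ ▷ b)` -/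
  smul_mul : ∀ (h : U) (a b : X),
    h • (a * b) = LinearMap.mul' k X (tensorAction X X (Coalgebra.comul h) (a ⊗ₜ[k] b))
  /-- the unit is `U`-linear -/
  smul_one : ∀ h : U, h • (1 : X) = Coalgebra.counit (R := k) h • (1 : X)
  /-- the coproduct is `U`-linear -/
  comul_smul : ∀ (h : U) (a : X),
    Coalgebra.comul (R := k) (h • a) =
      tensorAction X X (Coalgebra.comul h) (Coalgebra.comul a)
  /-- the counit is `U`-linear -/
  counit_smul : ∀ (h : U) (a : X),
    Coalgebra.counit (R := k) (h • a) =
      Coalgebra.counit (R := k) h * Coalgebra.counit (R := k) a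
  /-- the antipode is `U`-linear -/
  antipode_smul : ∀ (h : U) (a : X), S (h • a) = h • S a
  /-- the coproduct is braided multiplicative -/
  comul_mul : ∀ a b : X,
    Coalgebra.comul (R := k) (a * b) =
      braidedTensorMul R X (Coalgebra.comul a ⊗ₜ[k] Coalgebra.comul b)
  comul_one : Coalgebra.comul (R := k) (1 : X) = 1 ⊗ₜ[k] 1
  counit_mul : ∀ a b : X,
    Coalgebra.counit (R := k) (a * b) =
      Coalgebra.counit (R := k) a * Coalgebra.counit (R := k) b
  counit_one : Coalgebra.counit (R := k) (1 : X) = 1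
  /-- `S(a₁) a₂ = ε(a) 1` -/
  antipode_left : ∀ a : X,
    LinearMap.mul' k X (LinearMap.rTensor X S (Coalgebra.comul a)) =
      Coalgebra.counit (R := k) a • (1 : X)
  /-- `a₁ S(a₂) = ε(a) 1` -/
  antipode_right : ∀ a : X,
    LinearMap.mul' k X (LinearMap.lTensor X S (Coalgebra.comul a)) =
      Coalgebra.counit (R := k) a • (1 : X)

/-- The bilinear form `⟨·,·⟩ : D × X → k` is a `U`-invariant pairing which relates products and
coproducts in the nested way appropriate to a braided category. -/
structure IsBraidedDualPairing (U : Type*) [Ring U] [HopfAlgebra k U] {X D : Type*}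
    [Ring X] [Algebra k X] [Coalgebra k X] [Module U X] [IsScalarTower k U X]
    [Ring D] [Algebra k D] [Coalgebra k D] [Module U D] [IsScalarTower k U D]
    (p : D →ₗ[k] X →ₗ[k] k) : Prop where
  /-- `⟨h₁ ▷ σ, h₂ ▷ ξ⟩ = ε(h) ⟨σ, ξ⟩` -/
  invariant : ∀ (h : U) (σ : D) (ξ : X),
    TensorProduct.lift p (tensorAction D X (Coalgebra.comul h) (σ ⊗ₜ[k] ξ)) =
      Coalgebra.counit (R := k) h * p σ ξ
  /-- `⟨σ τ, ξ⟩ = ⟨τ, ξ₁⟩ ⟨σ, ξ₂⟩` -/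
  mul_left : ∀ (σ τ : D) (ξ : X),
    p (σ * τ) ξ =
      LinearMap.mul' k k (TensorProduct.map (p τ) (p σ) (Coalgebra.comul ξ))
  /-- `⟨σ, ξ η⟩ = ⟨σ₁, η⟩ ⟨σ₂, ξ⟩` -/
  mul_right : ∀ (σ : D) (ξ η : X),
    p σ (ξ * η) =
      LinearMap.mul' k k (TensorProduct.map (p.flip η) (p.flip ξ) (Coalgebra.comul σ))
  /-- `⟨1, ξ⟩ = ε(ξ)` -/
  one_left : ∀ ξ : X, p 1 ξ = Coalgebra.counit (R := k) ξ
  /-- `⟨σ, 1⟩ = ε(σ)` -/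
  one_right : ∀ σ : D, p σ 1 = Coalgebra.counit (R := k) σ

end BraidedHopf

/-! ### Integrals and the braided trace formula -/

section Integrals

variable {k : Type*} [Field k]

/-- `I` is an invariant integral on `X`: `ξ₁ ⟨ξ₂⟩ = ⟨ξ⟩ 1` for all `ξ`. -/
def IsInvariantIntegral {X : Type*} [Ring X] [Algebra k X] [Coalgebra k X]
    (I : X →ₗ[k] k) : Prop :=
  ∀ ξ : X, TensorProduct.rid k X (LinearMap.lTensor X I (Coalgebra.comul ξ)) = I ξ • (1 : X)

/-- The map `S⁻²`. The antipode of a finite-dimensional braided Hopf algebra is always bijective,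
so that `Ring.inverse S` is its inverse map. -/
noncomputable def antipodeInvSq {V : Type*} [AddCommGroup V] [Module k V] (S : V →ₗ[k] V) :
    V →ₗ[k] V :=
  Ring.inverse (S : Module.End k V) ∘ₗ Ring.inverse (S : Module.End k V)

variable {U : Type*} [Ring U] [HopfAlgebra k U] {X D : Type*}
  [Ring X] [Algebra k X] [Module U X] [IsScalarTower k U X]
  [Ring D] [Algebra k D] [Module U D] [IsScalarTower k U D]

/-- The braided trace formula on `X`. If `c = φⁱ ⊗ εᵢ ∈ X ⊗ D` is the canonical element,
`Ψ⁻¹(c) = ε' ⊗ φ'` (summation understood) and `S` is the antipode of `D`, then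
`⟨ξ⟩ = ⟨S⁻²(ε'), φ' ξ⟩`. -/
noncomputable def braidedTrace (R : (U ⊗[k] U)ˣ) (p : D →ₗ[k] X →ₗ[k] k) (c : X ⊗[k] D)
    (S : D →ₗ[k] D) : X →ₗ[k] k :=
  TensorProduct.lift p ∘ₗ
    TensorProduct.map (antipodeInvSq S) (LinearMap.mul' k X) ∘ₗ
    (TensorProduct.assoc k D X X).toLinearMap ∘ₗ
    TensorProduct.mk k (D ⊗[k] X) X (braidingInv R D X c)

/-- The braided trace formula on `D`. If `c = φⁱ ⊗ εᵢ ∈ X ⊗ D` is the canonical element and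
`S` is the antipode of `X`, then `⟨σ⟩` is the value of the pairing on
`(id ⊗ S⁻²) Ψ⁻¹(φⁱ ⊗ εᵢ σ)`. -/
noncomputable def braidedTraceDual (R : (U ⊗[k] U)ˣ) (p : D →ₗ[k] X →ₗ[k] k) (c : X ⊗[k] D)
    (S : X →ₗ[k] X) : D →ₗ[k] k :=
  TensorProduct.lift p ∘ₗ
    LinearMap.lTensor D (antipodeInvSq S) ∘ₗ
    braidingInv R D X ∘ₗ
    LinearMap.lTensor X (LinearMap.mul' k D) ∘ₗ
    (TensorProduct.assoc k X D D).toLinearMap ∘ₗ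
    TensorProduct.mk k (X ⊗[k] D) D c

/-- If `c = φⁱ ⊗ εᵢ ∈ X ⊗ D` is the canonical element, `Ψ⁻¹(c) = ε' ⊗ φ'` (summation
understood) and `S` is the antipode of `D`, this is `⟨σ S⁻²(ε'), φ' ξ⟩`. -/
noncomputable def braidedLoop (R : (U ⊗[k] U)ˣ) (p : D →ₗ[k] X →ₗ[k] k) (c : X ⊗[k] D)
    (S : D →ₗ[k] D) (σ : D) (ξ : X) : k :=
  TensorProduct.lift p
    (TensorProduct.map (LinearMap.mulLeft k σ ∘ₗ antipodeInvSq S) (LinearMap.mulRight k ξ)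
      (braidingInv R D X c))

end Integrals

/-! With `q = R⁽²⁾ S²(R⁽¹⁾)` the inverse Drinfeld element, `θ = q · S⁻²` is an automorphism of the
braided Hopf algebra `X`, and the trace integral of `ξ` is the trace of `x ↦ θ(x) ξ`. That such a
twisted trace is an invariant integral comes from expanding it in a basis and cancelling an
antipode against `S⁻²`; the product formula is the uniqueness of integrals, seen through the
pairing.

In characteristic zero, suppose that the twisted trace is nonzero but vanishes at `1`. Being a
nonzero integral, it defines a nondegenerate form, so the algebra is semisimple; by a braided form
of Radford's formula for `S⁴`, in which group-like elements have finite order, `θ` has finite order.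
Over an algebraically closed field, `θ` then preserves every matrix block and is conjugation by some
`uᵢ` on it, so that the trace of `θ` is `∑ᵢ tr(uᵢ) tr(uᵢ⁻¹)`. As `uᵢ` has finite order up to a
scalar, this is a sum of squared absolute values of sums of roots of unity; hence all `tr(uᵢ)`
vanish, and the form is zero. -/

section LinearFunctions

variable {k V W M N : Type*} [CommSemiring k] [AddCommMonoid V] [Module k V] [AddCommMonoid W]
  [Module k W] [AddCommMonoid M] [Module k M] [AddCommMonoid N] [Module k N]

-- Sweedler calculations only ever apply identities to functions that are linear in each variable;
-- with this attribute `fun_prop` discharges every such side condition.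
attribute [fun_prop] IsLinearMap

@[fun_prop]
theorem isLinearMap_fun_id : IsLinearMap k fun x : V => x := LinearMap.id.isLinear

@[fun_prop]
theorem isLinearMap_comp {f : W → M} {g : V → W} (hf : IsLinearMap k f) (hg : IsLinearMap k g) :
    IsLinearMap k fun x => f (g x) :=
  ((hf.mk' f) ∘ₗ (hg.mk' g)).isLinear

@[fun_prop]
theorem isLinearMap_coe_apply (f : W →ₗ[k] M) {g : V → W} (hg : IsLinearMap k g) :
    IsLinearMap k fun x => f (g x) :=
  isLinearMap_comp f.isLinear hg

@[fun_prop]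
theorem isLinearMap_sum {ι : Type*} {s : Finset ι} {f : ι → V → W}
    (hf : ∀ i, IsLinearMap k fun x => f i x) : IsLinearMap k fun x => ∑ i ∈ s, f i x :=
  ⟨fun x y => by simp_rw [(hf _).map_add, Finset.sum_add_distrib],
   fun c x => by simp_rw [(hf _).map_smul, Finset.smul_sum]⟩

@[fun_prop]
theorem isLinearMap_tmul_left {f : V → W} (hf : IsLinearMap k f) (m : M) :
    IsLinearMap k fun x => f x ⊗ₜ[k] m :=
  isLinearMap_coe_apply ((TensorProduct.mk k W M).flip m) hf

@[fun_prop]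
theorem isLinearMap_tmul_right {f : V → W} (hf : IsLinearMap k f) (m : M) :
    IsLinearMap k fun x => m ⊗ₜ[k] f x :=
  isLinearMap_coe_apply (TensorProduct.mk k M W m) hf

@[fun_prop]
theorem isLinearMap_pairing_left (p : W →ₗ[k] M →ₗ[k] N) {f : V → W} (hf : IsLinearMap k f)
    (m : M) : IsLinearMap k fun x => p (f x) m :=
  isLinearMap_coe_apply (p.flip m) hf

section Algebra

variable {A : Type*} [Semiring A] [Algebra k A]

@[fun_prop]
theorem isLinearMap_mul_left {f : V → A} (hf : IsLinearMap k f) (a : A) :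
    IsLinearMap k fun x => f x * a :=
  isLinearMap_coe_apply (LinearMap.mulRight k a) hf

@[fun_prop]
theorem isLinearMap_mul_right {f : V → A} (hf : IsLinearMap k f) (a : A) :
    IsLinearMap k fun x => a * f x :=
  isLinearMap_coe_apply (LinearMap.mulLeft k a) hf

variable [Module A W] [IsScalarTower k A W]

@[fun_prop]
theorem isLinearMap_act_left {f : V → A} (hf : IsLinearMap k f) (w : W) :
    IsLinearMap k fun x => f x • w :=
  ⟨fun x y => by rw [hf.map_add, add_smul], fun c x => by rw [hf.map_smul, smul_assoc]⟩

@[fun_prop]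
theorem isLinearMap_act_right {f : V → W} (hf : IsLinearMap k f) (a : A) :
    IsLinearMap k fun x => a • f x :=
  isLinearMap_coe_apply (Algebra.lsmul k k W a) hf

end Algebra

theorem map_sum_of_isLinearMap {ι : Type*} (s : Finset ι) (g : ι → V) {f : V → W}
    (hf : IsLinearMap k f := by fun_prop) : f (∑ i ∈ s, g i) = ∑ i ∈ s, f (g i) :=
  map_sum (hf.mk' f) g s

end LinearFunctions

section MultilinearExtension

variable {k V W Z M : Type*} [CommSemiring k] [AddCommMonoid V] [Module k V] [AddCommMonoid W]
  [Module k W] [AddCommMonoid Z] [Module k Z] [AddCommMonoid M] [Module k M]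

/-- The linear map on `V ⊗ W` induced by a function that is linear in each argument. The linearity
proofs default to `fun_prop`, so that a bilinear expression can be extended by writing it down. -/
noncomputable def bilinearLift (E : V → W → M)
    (h₁ : ∀ w, IsLinearMap k fun v => E v w := by fun_prop)
    (h₂ : ∀ v, IsLinearMap k fun w => E v w := by fun_prop) : V ⊗[k] W →ₗ[k] M :=
  TensorProduct.lift (LinearMap.mk₂ k E (fun _ _ w => (h₁ w).map_add _ _)
    (fun _ _ w => (h₁ w).map_smul _ _) (fun v _ _ => (h₂ v).map_add _ _)
    (fun _ v _ => (h₂ v).map_smul _ _))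

@[simp]
theorem bilinearLift_tmul (E : V → W → M) (h₁ : ∀ w, IsLinearMap k fun v => E v w)
    (h₂ : ∀ v, IsLinearMap k fun w => E v w) (v : V) (w : W) :
    bilinearLift E h₁ h₂ (v ⊗ₜ w) = E v w :=
  rfl

/-- The linear map on `(V ⊗ W) ⊗ Z` induced by a function that is linear in each argument, the
ternary companion of `bilinearLift`. -/
noncomputable def trilinearLift (E : V → W → Z → M)
    (h₁ : ∀ w z, IsLinearMap k fun v => E v w z := by fun_prop)
    (h₂ : ∀ v z, IsLinearMap k fun w => E v w z := by fun_prop)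
    (h₃ : ∀ v w, IsLinearMap k fun z => E v w z := by fun_prop) : (V ⊗[k] W) ⊗[k] Z →ₗ[k] M :=
  TensorProduct.lift (bilinearLift (fun v w => (h₃ v w).mk' (E v w))
    (fun w => ⟨fun _ _ => LinearMap.ext fun z => (h₁ w z).map_add _ _,
      fun _ _ => LinearMap.ext fun z => (h₁ w z).map_smul _ _⟩)
    (fun v => ⟨fun _ _ => LinearMap.ext fun z => (h₂ v z).map_add _ _,
      fun _ _ => LinearMap.ext fun z => (h₂ v z).map_smul _ _⟩))

@[simp]
theorem trilinearLift_tmul (E : V → W → Z → M)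
    (h₁ : ∀ w z, IsLinearMap k fun v => E v w z) (h₂ : ∀ v z, IsLinearMap k fun w => E v w z)
    (h₃ : ∀ v w, IsLinearMap k fun z => E v w z) (v : V) (w : W) (z : Z) :
    trilinearLift E h₁ h₂ h₃ ((v ⊗ₜ w) ⊗ₜ z) = E v w z :=
  rfl

end MultilinearExtension

section Sweedler

open Coalgebra

variable {k C V M N : Type*} [CommSemiring k] [AddCommMonoid C] [Module k C] [Coalgebra k C]
  [AddCommMonoid M] [Module k M] [AddCommMonoid N] [Module k N] [AddCommMonoid V] [Module k V]

/-- The Sweedler sum `E x₁ x₂` over `Δ x = x₁ ⊗ x₂`. It is computed from an arbitrary representation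
of `Δ x` as a sum of pure tensors, so it only has a meaning for `E` linear in each argument. -/
noncomputable def sweedler (k : Type*) {C M : Type*} [CommSemiring k] [AddCommMonoid C] [Module k C]
    [Coalgebra k C] [AddCommMonoid M] (x : C) (E : C → C → M) : M :=
  ∑ r ∈ (ℛ k x).index, E ((ℛ k x).left r) ((ℛ k x).right r)

theorem sweedler_eq_bilinearLift (x : C) (E : C → C → M)
    (h₁ : ∀ b, IsLinearMap k fun a => E a b := by fun_prop)
    (h₂ : ∀ a, IsLinearMap k fun b => E a b := by fun_prop) :
    sweedler k x E = bilinearLift E h₁ h₂ (comul x) := by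
  rw [← (ℛ k x).eq, map_sum]
  rfl

theorem comul_eq_sweedler (x : C) : comul (R := k) x = sweedler k x fun a b => a ⊗ₜ[k] b :=
  (ℛ k x).eq.symm

omit [Module k M] in
theorem sweedler_sum {I : Type*} (s : Finset I) (x : C) (E : I → C → C → M) :
    (sweedler k x fun a b => ∑ i ∈ s, E i a b) = ∑ i ∈ s, sweedler k x (E i) :=
  Finset.sum_comm

theorem smul_sweedler (c : k) (x : C) (E : C → C → M) :
    c • sweedler k x E = sweedler k x fun a b => c • E a b :=
  Finset.smul_sum

omit [Module k M] in
theorem sweedler_comm {C' : Type*} [AddCommMonoid C'] [Module k C'] [Coalgebra k C'] (x : C)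
    (y : C') (E : C → C → C' → C' → M) :
    (sweedler k x fun a b => sweedler k y fun c d => E a b c d) =
      sweedler k y fun c d => sweedler k x fun a b => E a b c d :=
  Finset.sum_comm

theorem apply_sweedler {f : M → N} (x : C) (E : C → C → M)
    (hf : IsLinearMap k f := by fun_prop) :
    f (sweedler k x E) = sweedler k x fun a b => f (E a b) :=
  map_sum_of_isLinearMap _ _ hf

@[fun_prop]
theorem isLinearMap_sweedler_left {f : V → C} (hf : IsLinearMap k f) {E : C → C → M}
    (h₁ : ∀ b, IsLinearMap k fun a => E a b) (h₂ : ∀ a, IsLinearMap k fun b => E a b) :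
    IsLinearMap k fun v => sweedler k (f v) E := by
  simp_rw [sweedler_eq_bilinearLift _ E h₁ h₂]
  exact isLinearMap_coe_apply _ (isLinearMap_coe_apply _ hf)

@[fun_prop]
theorem isLinearMap_sweedler_right (x : C) {E : V → C → C → M}
    (h : ∀ a b, IsLinearMap k fun v => E v a b) :
    IsLinearMap k fun v => sweedler k x fun a b => E v a b :=
  isLinearMap_sum fun _ => h _ _

theorem sweedler_coassoc (x : C) (E : C → C → C → M)
    (h₁ : ∀ b c, IsLinearMap k fun a => E a b c := by fun_prop)
    (h₂ : ∀ a c, IsLinearMap k fun b => E a b c := by fun_prop)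
    (h₃ : ∀ a b, IsLinearMap k fun c => E a b c := by fun_prop) :
    (sweedler k x fun a c => sweedler k a fun a b => E a b c) =
      sweedler k x fun a b => sweedler k b fun b c => E a b c := by
  have h := congrArg (trilinearLift E h₁ h₂ h₃) (coassoc_symm_apply (R := k) x)
  rw [comul_eq_sweedler x] at h
  simp only [sweedler, map_sum, LinearMap.lTensor_tmul, LinearMap.rTensor_tmul] at h
  simp only [comul_eq_sweedler, sweedler, map_sum, tmul_sum, sum_tmul,
    TensorProduct.assoc_symm_tmul, trilinearLift_tmul] at h
  exact h.symm

theorem sweedler_counit_left (x : C) {f : C → M} (hf : IsLinearMap k f := by fun_prop) :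
    (sweedler k x fun a b => counit (R := k) a • f b) = f x := by
  conv_rhs => rw [← one_smul k x, ← sum_counit_smul (ℛ k x), one_smul,
    map_sum_of_isLinearMap _ _ hf]
  simp_rw [hf.map_smul]
  rfl

theorem sweedler_counit_right (x : C) {f : C → M} (hf : IsLinearMap k f := by fun_prop) :
    (sweedler k x fun a b => counit (R := k) b • f a) = f x := by
  simpa only [sweedler, map_sum, TensorProduct.rid_tmul, map_smul, one_smul,
    IsLinearMap.mk'_apply] using
    congrArg (fun t => hf.mk' f (TensorProduct.rid k C t)) (sum_tmul_counit_eq (ℛ k x))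

theorem eq_of_sweedler_mul_eq_counit {C' : Type*} [AddCommMonoid C'] [Module k C'] [Coalgebra k C']
    {f g h : C → C' → k}
    (hfh : ∀ x y, (sweedler k x fun x₁ x₂ => sweedler k y fun y₁ y₂ => f x₁ y₂ * h x₂ y₁) =
      counit (R := k) x * counit (R := k) y)
    (hgf : ∀ x y, (sweedler k x fun x₁ x₂ => sweedler k y fun y₁ y₂ => g x₁ y₂ * f x₂ y₁) =
      counit (R := k) x * counit (R := k) y)
    (hf₁ : ∀ y, IsLinearMap k fun x => f x y := by fun_prop)
    (hf₂ : ∀ x, IsLinearMap k fun y => f x y := by fun_prop)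
    (hg₁ : ∀ y, IsLinearMap k fun x => g x y := by fun_prop)
    (hg₂ : ∀ x, IsLinearMap k fun y => g x y := by fun_prop)
    (hh₁ : ∀ y, IsLinearMap k fun x => h x y := by fun_prop)
    (hh₂ : ∀ x, IsLinearMap k fun y => h x y := by fun_prop) (x : C) (y : C') :
    h x y = g x y := by
  calc h x y
      = sweedler k x fun c x₃ => sweedler k y fun y₁ d =>
          h x₃ y₁ * (counit (R := k) c * counit (R := k) d) := by
        rw [← sweedler_counit_left (k := k) x (f := fun x => h x y)]
        congr! 3 with c x₃
        rw [← sweedler_counit_right (k := k) y (f := fun y => h x₃ y), smul_sweedler]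
        simp only [smul_eq_mul, mul_comm, mul_left_comm]
    _ = sweedler k x fun c x₃ => sweedler k c fun x₁ x₂ => sweedler k y fun y₁ d =>
          sweedler k d fun y₂ y₃ => g x₁ y₃ * (f x₂ y₂ * h x₃ y₁) := by
        congr! 3 with c x₃
        rw [sweedler_comm]
        congr! 3 with y₁ d
        simp only [← hgf, ← smul_eq_mul, smul_sweedler]
        simp only [smul_eq_mul, mul_comm, mul_left_comm]
    _ = sweedler k x fun x₁ c => sweedler k c fun x₂ x₃ => sweedler k y fun d y₃ =>
          sweedler k d fun y₁ y₂ => g x₁ y₃ * (f x₂ y₂ * h x₃ y₁) := by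
        rw [sweedler_coassoc x (fun x₁ x₂ x₃ => sweedler k y fun y₁ d =>
          sweedler k d fun y₂ y₃ => g x₁ y₃ * (f x₂ y₂ * h x₃ y₁))]
        congr! 6 with x₁ c x₂ x₃
        exact (sweedler_coassoc y (fun y₁ y₂ y₃ => g x₁ y₃ * (f x₂ y₂ * h x₃ y₁))).symm
    _ = sweedler k x fun x₁ c => sweedler k y fun d y₃ =>
          g x₁ y₃ * (counit (R := k) c * counit (R := k) d) := by
        congr! 3 with x₁ c
        rw [sweedler_comm]
        congr! 3 with d y₃
        simp only [← hfh, ← smul_eq_mul, smul_sweedler]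
    _ = g x y := by
        rw [← sweedler_counit_right (k := k) x (f := fun x => g x y)]
        congr! 3 with x₁ c
        rw [← sweedler_counit_left (k := k) y (f := fun y => g x₁ y), smul_sweedler]
        simp only [smul_eq_mul, mul_comm, mul_left_comm]

end Sweedler

section HopfSweedler

open Coalgebra HopfAlgebra

variable {k U M : Type*} [CommSemiring k] [Semiring U] [HopfAlgebra k U] [AddCommMonoid M]
  [Module k M]

theorem sweedler_antipode_left (x : U) {f : U → M} (hf : IsLinearMap k f := by fun_prop) :
    (sweedler k x fun a b => f (antipode k a * b)) = counit (R := k) x • f 1 := by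
  rw [← hf.map_smul, ← sum_antipode_mul_eq_smul (ℛ k x), map_sum_of_isLinearMap _ _ hf]
  rfl

theorem sweedler_antipode_right (x : U) {f : U → M} (hf : IsLinearMap k f := by fun_prop) :
    (sweedler k x fun a b => f (a * antipode k b)) = counit (R := k) x • f 1 := by
  rw [← hf.map_smul, ← sum_mul_antipode_eq_smul (ℛ k x), map_sum_of_isLinearMap _ _ hf]
  rfl

theorem sweedler_mul (x y : U) (E : U → U → M)
    (h₁ : ∀ b, IsLinearMap k fun a => E a b := by fun_prop)
    (h₂ : ∀ a, IsLinearMap k fun b => E a b := by fun_prop) :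
    sweedler k (x * y) E =
      sweedler k x fun a b => sweedler k y fun c d => E (a * c) (b * d) := by
  rw [sweedler_eq_bilinearLift _ E h₁ h₂, Bialgebra.comul_mul, comul_eq_sweedler x,
    comul_eq_sweedler y]
  simp only [sweedler, Finset.sum_mul_sum, map_sum, Algebra.TensorProduct.tmul_mul_tmul,
    bilinearLift_tmul]

theorem sweedler_antipode_tmul_mul_comul (y : U) :
    (sweedler k y fun a b => (sweedler k a fun a₁ a₂ => antipode k a₂ ⊗ₜ[k] antipode k a₁) *
      comul (R := k) b) = counit (R := k) y • (1 : U ⊗[k] U) := by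
  calc _ = sweedler k y fun a b => sweedler k a fun a₁ a₂ => sweedler k b fun b₁ b₂ =>
          (antipode k a₂ * b₁) ⊗ₜ[k] (antipode k a₁ * b₂) := by
        simp only [comul_eq_sweedler, sweedler, Finset.sum_mul_sum,
          Algebra.TensorProduct.tmul_mul_tmul]
    _ = sweedler k y fun a₁ b => sweedler k b fun a₂ b => sweedler k b fun b₁ b₂ =>
          (antipode k a₂ * b₁) ⊗ₜ[k] (antipode k a₁ * b₂) :=
        sweedler_coassoc y fun a₁ a₂ b => sweedler k b fun b₁ b₂ =>
          (antipode k a₂ * b₁) ⊗ₜ[k] (antipode k a₁ * b₂)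
    _ = sweedler k y fun a₁ b => sweedler k b fun c b₂ => sweedler k c fun a₂ b₁ =>
          (antipode k a₂ * b₁) ⊗ₜ[k] (antipode k a₁ * b₂) := by
        congr! 3 with a₁ b
        exact (sweedler_coassoc b fun a₂ b₁ b₂ =>
          (antipode k a₂ * b₁) ⊗ₜ[k] (antipode k a₁ * b₂)).symm
    _ = sweedler k y fun a₁ b => (1 : U) ⊗ₜ[k] (antipode k a₁ * b) := by
        congr! 3 with a₁ b
        rw [← sweedler_counit_left b (f := fun b => (1 : U) ⊗ₜ[k] (antipode k a₁ * b))]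
        congr! 3 with c b₂
        exact sweedler_antipode_left c (f := fun z => z ⊗ₜ[k] (antipode k a₁ * b₂))
    _ = counit (R := k) y • (1 : U ⊗[k] U) :=
        sweedler_antipode_left y (f := fun z => (1 : U) ⊗ₜ[k] z)

-- The right-hand side and `Δ ∘ S` are a left and a right convolution inverse of `Δ`.
open WithConv in
theorem comul_antipode (x : U) :
    comul (R := k) (antipode k x) = sweedler k x fun a b => antipode k b ⊗ₜ[k] antipode k a := by
  let G : U →ₗ[k] U ⊗[k] U := IsLinearMap.mk'
    (fun y => sweedler k y fun a b => antipode k b ⊗ₜ[k] antipode k a) (by fun_prop)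
  have left_inv : toConv G * toConv (comul (R := k) (A := U)) = 1 := by
    ext y
    rw [(ℛ k y).convMul_apply]
    refine (sweedler_antipode_tmul_mul_comul y).trans ?_
    simp [Algebra.algebraMap_eq_smul_one]
  have inv_unique := left_inv_eq_right_inv left_inv LinearMap.comul_right_inv
  exact (LinearMap.congr_fun (WithConv.toConv_injective inv_unique) x).symm

theorem sweedler_antipode (x : U) (E : U → U → M)
    (h₁ : ∀ b, IsLinearMap k fun a => E a b := by fun_prop)
    (h₂ : ∀ a, IsLinearMap k fun b => E a b := by fun_prop) :
    sweedler k (antipode k x) E = sweedler k x fun a b => E (antipode k b) (antipode k a) := by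
  rw [sweedler_eq_bilinearLift _ E h₁ h₂, comul_antipode]
  simp only [sweedler, map_sum, bilinearLift_tmul]

end HopfSweedler

theorem sum_sum_sum_rotate {I J K M : Type*} {s : Finset I} {t : Finset J} {r : Finset K}
    [AddCommMonoid M] (f : I → J → K → M) :
    ∑ i ∈ s, ∑ j ∈ t, ∑ l ∈ r, f i j l = ∑ l ∈ r, ∑ i ∈ s, ∑ j ∈ t, f i j l :=
  (Finset.sum_congr rfl fun _ _ => Finset.sum_comm).trans Finset.sum_comm

section RMatrix

open Coalgebra HopfAlgebra

variable {k U M : Type*} [Field k] [Ring U] [HopfAlgebra k U] [AddCommMonoid M] [Module k M]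

namespace IsUniversalRMatrix

variable {R : (U ⊗[k] U)ˣ} (hR : IsUniversalRMatrix R) {I : Type*} [Fintype I] {A B : I → U}
  (hAB : (R : U ⊗[k] U) = ∑ i, A i ⊗ₜ[k] B i)

include hR hAB

theorem hexagon_left (E : U → U → U → M)
    (h₁ : ∀ b c, IsLinearMap k fun a => E a b c := by fun_prop)
    (h₂ : ∀ a c, IsLinearMap k fun b => E a b c := by fun_prop)
    (h₃ : ∀ a b, IsLinearMap k fun c => E a b c := by fun_prop) :
    ∑ i, sweedler k (A i) (fun s t => E s t (B i)) = ∑ i, ∑ j, E (A i) (A j) (B i * B j) := by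
  have h := congrArg (trilinearLift E h₁ h₂ h₃) hR.comul_left
  rw [hAB] at h
  simpa [sweedler, map_sum, Finset.sum_mul_sum, comul_eq_sweedler, sum_tmul] using h

theorem hexagon_right (E : U → U → U → M)
    (h₁ : ∀ b c, IsLinearMap k fun a => E a b c := by fun_prop)
    (h₂ : ∀ a c, IsLinearMap k fun b => E a b c := by fun_prop)
    (h₃ : ∀ a b, IsLinearMap k fun c => E a b c := by fun_prop) :
    ∑ i, sweedler k (B i) (fun s t => E (A i) s t) = ∑ i, ∑ j, E (A i * A j) (B j) (B i) := by
  have h := congrArg (fun t => trilinearLift E h₁ h₂ h₃ ((TensorProduct.assoc k U U U).symm t))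
    hR.comul_right
  rw [hAB] at h
  simpa [sweedler, map_sum, Finset.sum_mul_sum, comul_eq_sweedler, tmul_sum] using h

theorem quasi_cocomm (x : U) (E : U → U → M)
    (h₁ : ∀ b, IsLinearMap k fun a => E a b := by fun_prop)
    (h₂ : ∀ a, IsLinearMap k fun b => E a b := by fun_prop) :
    ∑ i, sweedler k x (fun a b => E (b * A i) (a * B i)) =
      ∑ i, sweedler k x (fun a b => E (A i * a) (B i * b)) := by
  have h := congrArg (fun t => bilinearLift E h₁ h₂ (t * R)) (hR.comul_op x)
  simp only [Units.inv_mul_cancel_right] at h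
  rw [hAB, comul_eq_sweedler] at h
  simp only [sweedler, map_sum, Finset.sum_mul_sum, TensorProduct.comm_tmul,
    Algebra.TensorProduct.tmul_mul_tmul, bilinearLift_tmul] at h
  simp only [sweedler]
  rw [Finset.sum_comm, h]

theorem counit_left : ∑ i, counit (R := k) (A i) • B i = 1 := by
  have contract (i : I) :
      (sweedler k (A i) fun s t => counit (R := k) s • t ⊗ₜ[k] B i) = A i ⊗ₜ B i :=
    sweedler_counit_left (A i) (f := fun t => t ⊗ₜ[k] B i)
  have h := hexagon_left hR hAB fun a b c => counit (R := k) a • b ⊗ₜ[k] c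
  simp only [contract] at h
  have mul_R : (1 ⊗ₜ (∑ i, counit (R := k) (A i) • B i)) * (R : U ⊗[k] U) =
      1 * (R : U ⊗[k] U) := by
    rw [one_mul]
    nth_rw 2 [hAB]
    rw [h, hAB, tmul_sum, Finset.sum_mul_sum]
    simp
  have apply_counit := congrArg (fun t => TensorProduct.lid k U
    (TensorProduct.map (counit (R := k) (A := U)) LinearMap.id t)) (R.isUnit.mul_right_cancel mul_R)
  simpa [Algebra.TensorProduct.one_def] using apply_counit

theorem counit_right : ∑ i, counit (R := k) (B i) • A i = 1 := by
  have contract (i : I) :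
      (sweedler k (B i) fun s t => counit (R := k) s • A i ⊗ₜ[k] t) = A i ⊗ₜ B i :=
    sweedler_counit_left (B i) (f := fun t => A i ⊗ₜ[k] t)
  have h := hexagon_right hR hAB fun a b c => counit (R := k) b • a ⊗ₜ[k] c
  simp only [contract] at h
  have R_mul : (R : U ⊗[k] U) * ((∑ i, counit (R := k) (B i) • A i) ⊗ₜ 1) =
      (R : U ⊗[k] U) * 1 := by
    rw [mul_one]
    nth_rw 2 [hAB]
    rw [h, hAB, sum_tmul, Finset.sum_mul_sum]
    simp [smul_tmul']
  have apply_counit := congrArg (fun t => TensorProduct.rid k U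
    (TensorProduct.map LinearMap.id (counit (R := k) (A := U)) t)) (R.isUnit.mul_left_cancel R_mul)
  simpa [Algebra.TensorProduct.one_def] using apply_counit

theorem antipode_mul_self :
    ∑ i, ∑ j, (antipode k (A i) * A j) ⊗ₜ[k] (B i * B j) = 1 := by
  rw [← hexagon_left hR hAB (fun a b c => (antipode k a * b) ⊗ₜ[k] c)]
  have contract (i : I) := sweedler_antipode_left (A i) (f := fun z => z ⊗ₜ[k] B i)
  simp only [contract, ← tmul_smul, ← tmul_sum, counit_left hR hAB, Algebra.TensorProduct.one_def]

theorem self_mul_antipode :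
    ∑ i, ∑ j, (A i * antipode k (A j)) ⊗ₜ[k] (B i * B j) = 1 := by
  rw [← hexagon_left hR hAB (fun a b c => (a * antipode k b) ⊗ₜ[k] c)]
  have contract (i : I) := sweedler_antipode_right (A i) (f := fun z => z ⊗ₜ[k] B i)
  simp only [contract, ← tmul_smul, ← tmul_sum, counit_left hR hAB, Algebra.TensorProduct.one_def]

theorem self_mul_op_antipode :
    ∑ i, ∑ j, (A i * A j) ⊗ₜ[k] (antipode k (B j) * B i) = 1 := by
  rw [← hexagon_right hR hAB (fun a b c => a ⊗ₜ[k] (antipode k b * c))]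
  have contract (i : I) := sweedler_antipode_left (B i) (f := fun z => A i ⊗ₜ[k] z)
  simp only [contract, smul_tmul', ← sum_tmul, counit_right hR hAB, Algebra.TensorProduct.one_def]

theorem antipode_mul_op_self :
    ∑ i, ∑ j, (A i * A j) ⊗ₜ[k] (B j * antipode k (B i)) = 1 := by
  rw [← hexagon_right hR hAB (fun a b c => a ⊗ₜ[k] (b * antipode k c))]
  have contract (i : I) := sweedler_antipode_right (B i) (f := fun z => A i ⊗ₜ[k] z)
  simp only [contract, smul_tmul', ← sum_tmul, counit_right hR hAB, Algebra.TensorProduct.one_def]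

theorem inv_eq : ((R⁻¹ : (U ⊗[k] U)ˣ) : U ⊗[k] U) = ∑ i, antipode k (A i) ⊗ₜ[k] B i := by
  refine (left_inv_eq_right_inv (a := (R : U ⊗[k] U)) ?_ R.mul_inv).symm
  rw [hAB, Finset.sum_mul_sum, ← antipode_mul_self hR hAB]
  simp

theorem antipode_tmul_antipode :
    ∑ i, antipode k (A i) ⊗ₜ[k] antipode k (B i) = ∑ i, A i ⊗ₜ[k] B i := by
  have h := congrArg (TensorProduct.map (antipode k) LinearMap.id) (self_mul_op_antipode hR hAB)
  simp only [map_sum, TensorProduct.map_tmul, antipode_mul_antidistrib, LinearMap.id_apply,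
    Algebra.TensorProduct.one_def, antipode_one] at h
  have h' : (∑ i, antipode k (A i) ⊗ₜ[k] antipode k (B i)) *
      ((R⁻¹ : (U ⊗[k] U)ˣ) : U ⊗[k] U) = 1 := by
    rw [inv_eq hR hAB, Finset.sum_mul_sum, Finset.sum_comm, Algebra.TensorProduct.one_def, ← h]
    simp
  rw [← hAB]
  exact (Units.mul_inv_eq_one.1 h')

theorem sum_antipode_antipode (E : U → U → M)
    (h₁ : ∀ b, IsLinearMap k fun a => E a b := by fun_prop)
    (h₂ : ∀ a, IsLinearMap k fun b => E a b := by fun_prop) :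
    ∑ i, E (antipode k (A i)) (antipode k (B i)) = ∑ i, E (A i) (B i) := by
  simpa [map_sum] using congrArg (bilinearLift E h₁ h₂) (antipode_tmul_antipode hR hAB)

theorem sum_antipode_mul_self (E : U → U → M)
    (h₁ : ∀ b, IsLinearMap k fun a => E a b := by fun_prop)
    (h₂ : ∀ a, IsLinearMap k fun b => E a b := by fun_prop) :
    ∑ i, ∑ j, E (antipode k (A i) * A j) (B i * B j) = E 1 1 := by
  simpa [map_sum, Algebra.TensorProduct.one_def] using
    congrArg (bilinearLift E h₁ h₂) (antipode_mul_self hR hAB)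

theorem sum_self_mul_antipode (E : U → U → M)
    (h₁ : ∀ b, IsLinearMap k fun a => E a b := by fun_prop)
    (h₂ : ∀ a, IsLinearMap k fun b => E a b := by fun_prop) :
    ∑ i, ∑ j, E (A i * antipode k (A j)) (B i * B j) = E 1 1 := by
  simpa [map_sum, Algebra.TensorProduct.one_def] using
    congrArg (bilinearLift E h₁ h₂) (self_mul_antipode hR hAB)

theorem sum_self_mul_op_antipode (E : U → U → M)
    (h₁ : ∀ b, IsLinearMap k fun a => E a b := by fun_prop)
    (h₂ : ∀ a, IsLinearMap k fun b => E a b := by fun_prop) :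
    ∑ i, ∑ j, E (A i * A j) (antipode k (B j) * B i) = E 1 1 := by
  simpa [map_sum, Algebra.TensorProduct.one_def] using
    congrArg (bilinearLift E h₁ h₂) (self_mul_op_antipode hR hAB)

-- `R₂₁ R` and its inverse, multiplied out.
theorem sum_monodromyInv_mul_monodromy (E : U → U → M)
    (h₁ : ∀ b, IsLinearMap k fun a => E a b := by fun_prop)
    (h₂ : ∀ a, IsLinearMap k fun b => E a b := by fun_prop) :
    ∑ m, ∑ i, ∑ j, ∑ l, E (antipode k (A j) * B l * (B m * A i))
      (B j * antipode k (A l) * (A m * B i)) = E 1 1 := by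
  have cancel_inner (i j : I) : ∑ m, ∑ l, E (antipode k (A j) * B l * (B m * A i))
      (B j * antipode k (A l) * (A m * B i)) = E (antipode k (A j) * A i) (B j * B i) := by
    have h := sum_antipode_mul_self hR hAB fun s t =>
      E (antipode k (A j) * t * A i) (B j * s * B i)
    rw [Finset.sum_comm] at h
    simpa only [mul_one, mul_assoc] using h
  rw [← sum_antipode_mul_self hR hAB E, Finset.sum_comm,
    Finset.sum_comm (f := fun j i => E (antipode k (A j) * A i) (B j * B i))]
  refine Finset.sum_congr rfl fun i _ => ?_
  rw [Finset.sum_comm]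
  exact Finset.sum_congr rfl fun j _ => cancel_inner i j

theorem yang_baxter (E : U → U → U → M)
    (h₁ : ∀ b c, IsLinearMap k fun a => E a b c := by fun_prop)
    (h₂ : ∀ a c, IsLinearMap k fun b => E a b c := by fun_prop)
    (h₃ : ∀ a b, IsLinearMap k fun c => E a b c := by fun_prop) :
    ∑ i, ∑ l, ∑ m, E (A i * A l) (B l * B m) (B i * A m) =
      ∑ i, ∑ l, ∑ m, E (A l * A i) (B m * B l) (A m * B i) := by
  calc ∑ i, ∑ l, ∑ m, E (A i * A l) (B l * B m) (B i * A m)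
      = ∑ m, ∑ i, ∑ l, E (A i * A l) (B l * B m) (B i * A m) := sum_sum_sum_rotate _
    _ = ∑ m, ∑ i, sweedler k (B i) fun s t => E (A i) (s * B m) (t * A m) :=
        Finset.sum_congr rfl fun m _ => (hexagon_right hR hAB
          (fun a s t => E a (s * B m) (t * A m))).symm
    _ = ∑ i, ∑ m, sweedler k (B i) fun s t => E (A i) (s * B m) (t * A m) := Finset.sum_comm
    _ = ∑ i, ∑ m, sweedler k (B i) fun s t => E (A i) (B m * t) (A m * s) :=
        Finset.sum_congr rfl fun i _ =>
          quasi_cocomm hR hAB (B i) (fun t s => E (A i) s t)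
    _ = ∑ m, ∑ i, sweedler k (B i) fun s t => E (A i) (B m * t) (A m * s) := Finset.sum_comm
    _ = ∑ m, ∑ i, ∑ l, E (A i * A l) (B m * B i) (A m * B l) :=
        Finset.sum_congr rfl fun m _ => by
          rw [hexagon_right hR hAB (fun a s t => E a (B m * t) (A m * s))]
    _ = ∑ m, ∑ i, ∑ l, E (A l * A i) (B m * B l) (A m * B i) :=
        Finset.sum_congr rfl fun m _ => Finset.sum_comm
    _ = _ := (sum_sum_sum_rotate _).symm

/-- Drinfeld's element `u = S(R⁽²⁾) R⁽¹⁾` of the R-matrix `R = ∑ A i ⊗ B i`, which implements the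
square of the antipode. -/
noncomputable def drinfeld (k : Type*) {U I : Type*} [Field k] [Ring U] [HopfAlgebra k U]
    [Fintype I] (A B : I → U) : U :=
  ∑ i, antipode k (B i) * A i

/-- The inverse `R⁽²⁾ S²(R⁽¹⁾)` of Drinfeld's element. -/
noncomputable def drinfeldInv (k : Type*) {U I : Type*} [Field k] [Ring U] [HopfAlgebra k U]
    [Fintype I] (A B : I → U) : U :=
  ∑ i, B i * antipode k (antipode k (A i))

theorem counit_drinfeldInv : counit (R := k) (drinfeldInv k A B) = 1 := by
  have counit_eq_one := congrArg (counit (R := k)) (counit_left hR hAB)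
  simp only [map_sum, map_smul, Bialgebra.counit_one, smul_eq_mul] at counit_eq_one
  rw [← counit_eq_one]
  simp [drinfeldInv, mul_comm]

theorem antipode_drinfeld_mul (x : U) :
    (sweedler k x fun a b => antipode k b * drinfeld k A B * a) =
      counit (R := k) x • drinfeld k A B := by
  have h := quasi_cocomm hR hAB x (fun p q => antipode k q * p)
  simp only [antipode_mul_antidistrib] at h
  calc _ = ∑ i, sweedler k x (fun a b => antipode k b * antipode k (B i) * (A i * a)) := by
        rw [← sweedler_sum]
        simp only [drinfeld, Finset.mul_sum, Finset.sum_mul, mul_assoc]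
    _ = ∑ i, counit (R := k) x • (antipode k (B i) * (1 * A i)) := by
        rw [← h]
        refine Finset.sum_congr rfl fun i _ => ?_
        rw [← sweedler_antipode_left x (f := fun z => antipode k (B i) * (z * A i))]
        simp only [mul_assoc]
    _ = _ := by simp [drinfeld, Finset.smul_sum]

theorem antipode_antipode_mul_drinfeld (x : U) :
    antipode k (antipode k x) * drinfeld k A B = drinfeld k A B * x := by
  have contract_left : (sweedler k x fun c d => sweedler k c fun a b =>
      antipode k (antipode k d) * (antipode k b * drinfeld k A B * a)) =
      antipode k (antipode k x) * drinfeld k A B := by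
    rw [← sweedler_counit_left (k := k) x
      (f := fun x => antipode k (antipode k x) * drinfeld k A B)]
    congr! 3 with c d
    rw [← apply_sweedler (k := k) (f := fun z => antipode k (antipode k d) * z),
      antipode_drinfeld_mul hR hAB, mul_smul_comm]
  rw [← contract_left, sweedler_coassoc x (fun a b d =>
    antipode k (antipode k d) * (antipode k b * drinfeld k A B * a)),
    ← sweedler_counit_right (k := k) x (f := fun x => drinfeld k A B * x)]
  congr! 3 with a d
  have contract_right := sweedler_antipode_right (k := k) d
    (f := fun z => antipode k z * (drinfeld k A B * a))
  simpa [antipode_mul_antidistrib, mul_assoc] using contract_right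

theorem sum_sum_mul_antipode_mul : ∑ i, ∑ j, B j * antipode k (B i) * (A i * A j) = 1 := by
  simpa [Algebra.TensorProduct.one_def] using
    congrArg (LinearMap.mul' k U ∘ₗ (TensorProduct.comm k U U).toLinearMap)
      (antipode_mul_op_self hR hAB)

theorem drinfeld_mul_drinfeldInv : drinfeld k A B * drinfeldInv k A B = 1 := by
  have move_drinfeld (i : I) : drinfeld k A B * (B i * antipode k (antipode k (A i))) =
      antipode k (antipode k (B i)) * drinfeld k A B * antipode k (antipode k (A i)) := by
    rw [← mul_assoc, ← antipode_antipode_mul_drinfeld hR hAB]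
  rw [← sum_sum_mul_antipode_mul hR hAB, drinfeldInv, Finset.mul_sum, Finset.sum_comm]
  simp only [move_drinfeld]
  rw [sum_antipode_antipode hR hAB (fun a b => antipode k b * drinfeld k A B * antipode k a),
    sum_antipode_antipode hR hAB (fun a b => b * drinfeld k A B * a)]
  simp only [drinfeld, Finset.mul_sum, Finset.sum_mul, mul_assoc]

theorem drinfeldInv_mul_drinfeld : drinfeldInv k A B * drinfeld k A B = 1 := by
  rw [← sum_sum_mul_antipode_mul hR hAB, drinfeldInv, Finset.sum_mul, Finset.sum_comm]
  simp only [mul_assoc, antipode_antipode_mul_drinfeld hR hAB]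
  simp only [drinfeld, Finset.mul_sum, Finset.sum_mul, mul_assoc]

theorem drinfeldInv_mul_antipode_antipode (x : U) :
    drinfeldInv k A B * antipode k (antipode k x) = x * drinfeldInv k A B := by
  have h := congrArg (fun z => drinfeldInv k A B * z * drinfeldInv k A B)
    (antipode_antipode_mul_drinfeld hR hAB x)
  simpa only [mul_assoc, drinfeld_mul_drinfeldInv hR hAB, mul_one,
    ← mul_assoc _ (drinfeld k A B), drinfeldInv_mul_drinfeld hR hAB, one_mul] using h

theorem exists_antipode_antipode_eq (x : U) : ∃ y : U, antipode k (antipode k y) = x := by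
  refine ⟨drinfeldInv k A B * x * drinfeld k A B, ?_⟩
  rw [← mul_one (antipode k _), ← drinfeld_mul_drinfeldInv hR hAB, ← mul_assoc,
    antipode_antipode_mul_drinfeld hR hAB, ← mul_assoc, ← mul_assoc,
    drinfeld_mul_drinfeldInv hR hAB, one_mul, mul_assoc, drinfeld_mul_drinfeldInv hR hAB, mul_one]

theorem sum_mul_drinfeldInv_mul_antipode :
    ∑ i, B i * drinfeldInv k A B * antipode k (A i) = 1 := by
  rw [← sum_antipode_antipode hR hAB (fun a b => b * drinfeldInv k A B * antipode k a)]
  simp only [mul_assoc, drinfeldInv_mul_antipode_antipode hR hAB]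
  rw [← drinfeld_mul_drinfeldInv hR hAB]
  simp only [drinfeld, Finset.sum_mul, mul_assoc]

theorem sum_mul_antipode_antipode_mul (c : U) (i : I) :
    ∑ l, c * B l * antipode k (antipode k (A l * A i)) = c * A i * drinfeldInv k A B := by
  rw [mul_assoc c, ← drinfeldInv_mul_antipode_antipode hR hAB]
  simp only [drinfeldInv, Finset.mul_sum, Finset.sum_mul, antipode_mul_antidistrib, mul_assoc]

theorem sweedler_drinfeldInv_eq_sum_sum_sum_sum (E : U → U → M)
    (h₁ : ∀ b, IsLinearMap k fun a => E a b := by fun_prop)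
    (h₂ : ∀ a, IsLinearMap k fun b => E a b := by fun_prop) :
    sweedler k (drinfeldInv k A B) E = ∑ i, ∑ l, ∑ j, ∑ m,
      E (B l * B m * antipode k (antipode k (A i * A l)))
        (B i * B j * antipode k (antipode k (A j * A m))) := by
  let σ : U →ₗ[k] U := antipode k ∘ₗ antipode k
  have hsum : sweedler k (drinfeldInv k A B) E = ∑ i, sweedler k (B i * σ (A i)) E :=
    map_sum_of_isLinearMap (f := fun x : U => sweedler k x E) _ _
  calc sweedler k (drinfeldInv k A B) E
      = ∑ i, sweedler k (A i) fun a₁ a₂ => sweedler k (B i) fun b₁ b₂ =>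
          E (b₁ * σ a₁) (b₂ * σ a₂) := by
        rw [hsum]
        refine Finset.sum_congr rfl fun i _ => ?_
        rw [sweedler_mul _ _ _ h₁ h₂, sweedler_comm, LinearMap.comp_apply, sweedler_antipode _ _,
          sweedler_antipode _ _]
        rfl
    _ = ∑ i, ∑ j, sweedler k (B i * B j) fun b₁ b₂ => E (b₁ * σ (A i)) (b₂ * σ (A j)) :=
        hexagon_left hR hAB fun a₁ a₂ z => sweedler k z fun b₁ b₂ => E (b₁ * σ a₁) (b₂ * σ a₂)
    _ = ∑ i, ∑ j, sweedler k (B i) fun b₁ b₂ => sweedler k (B j) fun c₁ c₂ =>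
          E (b₁ * c₁ * σ (A i)) (b₂ * c₂ * σ (A j)) :=
        Finset.sum_congr rfl fun i _ => Finset.sum_congr rfl fun j _ => sweedler_mul _ _ _
    _ = ∑ j, ∑ i, sweedler k (B i) fun b₁ b₂ => sweedler k (B j) fun c₁ c₂ =>
          E (b₁ * c₁ * σ (A i)) (b₂ * c₂ * σ (A j)) := Finset.sum_comm
    _ = ∑ j, ∑ i, ∑ l, sweedler k (B j) fun c₁ c₂ =>
          E (B l * c₁ * σ (A i * A l)) (B i * c₂ * σ (A j)) :=
        Finset.sum_congr rfl fun j _ => hexagon_right hR hAB fun a b₁ b₂ => sweedler k (B j)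
          fun c₁ c₂ => E (b₁ * c₁ * σ a) (b₂ * c₂ * σ (A j))
    _ = ∑ i, ∑ l, ∑ j, sweedler k (B j) fun c₁ c₂ =>
          E (B l * c₁ * σ (A i * A l)) (B i * c₂ * σ (A j)) := (sum_sum_sum_rotate _).symm
    _ = _ :=
        Finset.sum_congr rfl fun i _ => Finset.sum_congr rfl fun l _ =>
          hexagon_right hR hAB fun a c₁ c₂ => E (B l * c₁ * σ (A i * A l)) (B i * c₂ * σ a)

theorem sweedler_drinfeldInv (E : U → U → M)
    (h₁ : ∀ b, IsLinearMap k fun a => E a b := by fun_prop)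
    (h₂ : ∀ a, IsLinearMap k fun b => E a b := by fun_prop) :
    sweedler k (drinfeldInv k A B) E =
      ∑ m, ∑ i, E (B m * A i * drinfeldInv k A B) (A m * B i * drinfeldInv k A B) := by
  set q := drinfeldInv k A B
  let σ : U →ₗ[k] U := antipode k ∘ₗ antipode k
  have sum_eq (c : U) (i : I) : ∑ l, c * B l * σ (A l * A i) = c * A i * q :=
    sum_mul_antipode_antipode_mul hR hAB c i
  calc sweedler k q E
      = ∑ i, ∑ l, ∑ j, ∑ m, E (B l * B m * σ (A i * A l)) (B i * B j * σ (A j * A m)) :=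
        sweedler_drinfeldInv_eq_sum_sum_sum_sum hR hAB E
    _ = ∑ i, ∑ l, ∑ m, E (B l * B m * σ (A i * A l)) (B i * A m * q) := by
        refine Finset.sum_congr rfl fun i _ => Finset.sum_congr rfl fun l _ => ?_
        rw [Finset.sum_comm]
        refine Finset.sum_congr rfl fun m _ => ?_
        rw [← sum_eq, map_sum_of_isLinearMap _ _ (h₂ _)]
    _ = ∑ i, ∑ l, ∑ m, E (B m * B l * σ (A l * A i)) (A m * B i * q) :=
        yang_baxter hR hAB fun a b c => E (b * σ a) (c * q)
    _ = ∑ m, ∑ i, ∑ l, E (B m * B l * σ (A l * A i)) (A m * B i * q) := sum_sum_sum_rotate _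
    _ = _ := by
        refine Finset.sum_congr rfl fun m _ => Finset.sum_congr rfl fun i _ => ?_
        rw [← sum_eq, map_sum_of_isLinearMap _ _ (h₁ _)]

end IsUniversalRMatrix
end RMatrix

section BraidedHopf

open Coalgebra HopfAlgebra

variable {k U M : Type*} [Field k] [Ring U] [HopfAlgebra k U] [AddCommMonoid M] [Module k M]

@[simp]
theorem tensorAction_tmul {V W : Type*} [AddCommGroup V] [Module k V] [Module U V]
    [IsScalarTower k U V] [AddCommGroup W] [Module k W] [Module U W] [IsScalarTower k U W]
    (x y : U) (v : V) (w : W) : tensorAction V W (x ⊗ₜ[k] y) (v ⊗ₜ[k] w) = (x • v) ⊗ₜ (y • w) := by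
  simp [tensorAction]

namespace IsBraidedHopfAlgebra

variable {R : (U ⊗[k] U)ˣ} {Y : Type*} [Ring Y] [Algebra k Y] [Coalgebra k Y] [Module U Y]
  [IsScalarTower k U Y] {S : Y →ₗ[k] Y} (hY : IsBraidedHopfAlgebra R S)

include hY

theorem act_mul (h : U) (a b : Y) :
    h • (a * b) = sweedler k h fun s t => (s • a) * (t • b) := by
  rw [hY.smul_mul, comul_eq_sweedler h]
  simp [sweedler, map_sum]

theorem sweedler_act (h : U) (x : Y) (E : Y → Y → M)
    (h₁ : ∀ b, IsLinearMap k fun a => E a b := by fun_prop)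
    (h₂ : ∀ a, IsLinearMap k fun b => E a b := by fun_prop) :
    sweedler k (h • x) E = sweedler k h fun s t => sweedler k x fun a b => E (s • a) (t • b) := by
  rw [sweedler_eq_bilinearLift _ E h₁ h₂, hY.comul_smul, comul_eq_sweedler h, comul_eq_sweedler x]
  simp only [sweedler, map_sum, LinearMap.sum_apply, tensorAction_tmul, bilinearLift_tmul]
  exact Finset.sum_comm

theorem sweedler_one (E : Y → Y → M) (h₁ : ∀ b, IsLinearMap k fun a => E a b := by fun_prop)
    (h₂ : ∀ a, IsLinearMap k fun b => E a b := by fun_prop) : sweedler k (1 : Y) E = E 1 1 := by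
  rw [sweedler_eq_bilinearLift _ E h₁ h₂, hY.comul_one, bilinearLift_tmul]

theorem sweedler_antipode_left (x : Y) {f : Y → M} (hf : IsLinearMap k f := by fun_prop) :
    (sweedler k x fun a b => f (S a * b)) = counit (R := k) x • f 1 := by
  rw [← hf.map_smul, ← hY.antipode_left, ← apply_sweedler _ _ hf, comul_eq_sweedler x]
  simp [sweedler, map_sum]

theorem sweedler_antipode_right (x : Y) {f : Y → M} (hf : IsLinearMap k f := by fun_prop) :
    (sweedler k x fun a b => f (a * S b)) = counit (R := k) x • f 1 := by
  rw [← hf.map_smul, ← hY.antipode_right, ← apply_sweedler _ _ hf, comul_eq_sweedler x]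
  simp [sweedler, map_sum]

theorem antipode_one : S 1 = 1 := by
  have h := hY.sweedler_antipode_left 1 (f := fun x => x)
  rwa [hY.sweedler_one _, mul_one, hY.counit_one, one_smul] at h

theorem counit_antipode (x : Y) : counit (R := k) (S x) = counit (R := k) x := by
  have h := hY.sweedler_antipode_left x (f := fun x => counit (R := k) x)
  simp only [hY.counit_mul, hY.counit_one, smul_eq_mul, mul_one] at h
  rw [← h, ← sweedler_counit_right (k := k) x (f := fun a => counit (R := k) (S a))]
  simp only [smul_eq_mul, mul_comm]

variable (hR : IsUniversalRMatrix R) {I : Type*} [Fintype I] {A B : I → U}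
  (hAB : (R : U ⊗[k] U) = ∑ i, A i ⊗ₜ[k] B i)

include hAB

theorem sweedler_mul (x y : Y) (E : Y → Y → M)
    (h₁ : ∀ b, IsLinearMap k fun a => E a b := by fun_prop)
    (h₂ : ∀ a, IsLinearMap k fun b => E a b := by fun_prop) :
    sweedler k (x * y) E = ∑ i, sweedler k x fun a b => sweedler k y fun c d =>
      E (a * (B i • c)) ((A i • b) * d) := by
  rw [sweedler_eq_bilinearLift _ E h₁ h₂, hY.comul_mul, comul_eq_sweedler x, comul_eq_sweedler y]
  simp only [sweedler, tmul_sum, sum_tmul, map_sum, braidedTensorMul, LinearMap.comp_apply,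
    LinearEquiv.coe_coe, TensorProduct.assoc_tmul, TensorProduct.assoc_symm_tmul, braiding,
    LinearMap.lTensor_tmul, LinearMap.rTensor_tmul, hAB, LinearMap.sum_apply, tensorAction_tmul,
    TensorProduct.comm_tmul, TensorProduct.map_tmul, LinearMap.mul'_apply, bilinearLift_tmul]
  rw [Finset.sum_comm]
  exact sum_sum_sum_rotate _

include hR

theorem sum_left_act_mul (a b : Y) (E : Y → U → M)
    (h₁ : ∀ b, IsLinearMap k fun a => E a b := by fun_prop)
    (h₂ : ∀ a, IsLinearMap k fun b => E a b := by fun_prop) :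
    ∑ i, E (A i • (a * b)) (B i) = ∑ i, ∑ j, E ((A i • a) * (A j • b)) (B i * B j) := by
  rw [← hR.hexagon_left hAB (fun s t z => E ((s • a) * (t • b)) z)]
  refine Finset.sum_congr rfl fun i _ => ?_
  rw [hY.act_mul, apply_sweedler _ _ (h₁ _)]

theorem sum_right_act_mul (a b : Y) (E : U → Y → M)
    (h₁ : ∀ b, IsLinearMap k fun a => E a b := by fun_prop)
    (h₂ : ∀ a, IsLinearMap k fun b => E a b := by fun_prop) :
    ∑ i, E (A i) (B i • (a * b)) = ∑ i, ∑ j, E (A i * A j) ((B j • a) * (B i • b)) := by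
  rw [← hR.hexagon_right hAB (fun z s t => E z ((s • a) * (t • b)))]
  refine Finset.sum_congr rfl fun i _ => ?_
  rw [hY.act_mul, apply_sweedler _ _ (h₂ _)]

theorem sum_left_sweedler_act (x : Y) (E : Y → Y → U → M)
    (h₁ : ∀ b c, IsLinearMap k fun a => E a b c := by fun_prop)
    (h₂ : ∀ a c, IsLinearMap k fun b => E a b c := by fun_prop)
    (h₃ : ∀ a b, IsLinearMap k fun c => E a b c := by fun_prop) :
    ∑ i, sweedler k (A i • x) (fun a b => E a b (B i)) =
      ∑ i, ∑ j, sweedler k x fun a b => E (A i • a) (A j • b) (B i * B j) := by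
  rw [← hR.hexagon_left hAB (fun s t z => sweedler k x fun a b => E (s • a) (t • b) z)]
  exact Finset.sum_congr rfl fun i _ => hY.sweedler_act _ _ _

omit hR in
theorem sweedler_sweedler_mul_antipode (x y : Y) (E : Y → Y → M)
    (h₁ : ∀ b, IsLinearMap k fun a => E a b := by fun_prop)
    (h₂ : ∀ a, IsLinearMap k fun b => E a b := by fun_prop) :
    (sweedler k y fun y₁ y₂ => sweedler k (x * y₁) fun z₁ z₂ => E z₁ (z₂ * S y₂)) =
      ∑ i, sweedler k x fun x₁ x₂ => E (x₁ * (B i • y)) (A i • x₂) := by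
  calc (sweedler k y fun y₁ y₂ => sweedler k (x * y₁) fun z₁ z₂ => E z₁ (z₂ * S y₂))
      = ∑ i, sweedler k y fun y₁ y₂ => sweedler k y₁ fun c d => sweedler k x fun x₁ x₂ =>
          E (x₁ * (B i • c)) ((A i • x₂) * (d * S y₂)) := by
        rw [← sweedler_sum]
        congr! 3 with y₁ y₂
        rw [hY.sweedler_mul hAB _ _ _]
        refine Finset.sum_congr rfl fun i _ => ?_
        rw [sweedler_comm]
        simp only [mul_assoc]
    _ = _ := by
        refine Finset.sum_congr rfl fun i _ => ?_
        rw [sweedler_coassoc y (fun c d y₂ => sweedler k x fun x₁ x₂ =>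
          E (x₁ * (B i • c)) ((A i • x₂) * (d * S y₂))),
          ← sweedler_counit_right (k := k) y (f := fun y => sweedler k x fun x₁ x₂ =>
            E (x₁ * (B i • y)) (A i • x₂))]
        congr! 3 with c d
        rw [hY.sweedler_antipode_right d (f := fun z => sweedler k x fun x₁ x₂ =>
            E (x₁ * (B i • c)) ((A i • x₂) * z))]
        simp only [mul_one]

omit hR in
theorem sweedler_antipode_sweedler_mul (a y : Y) (E : Y → Y → M)
    (h₁ : ∀ b, IsLinearMap k fun a => E a b := by fun_prop)
    (h₂ : ∀ a, IsLinearMap k fun b => E a b := by fun_prop) :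
    (sweedler k a fun a₁ a₂ => sweedler k (a₂ * y) fun z₁ z₂ => E (S a₁ * z₁) z₂) =
      ∑ i, sweedler k y fun y₁ y₂ => E (B i • y₁) ((A i • a) * y₂) := by
  calc (sweedler k a fun a₁ a₂ => sweedler k (a₂ * y) fun z₁ z₂ => E (S a₁ * z₁) z₂)
      = ∑ i, sweedler k a fun a₁ a₂ => sweedler k a₂ fun c d => sweedler k y fun y₁ y₂ =>
          E (S a₁ * c * (B i • y₁)) ((A i • d) * y₂) := by
        rw [← sweedler_sum]
        congr! 3 with a₁ a₂
        rw [hY.sweedler_mul hAB _ _ _]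
        simp only [mul_assoc]
    _ = _ := by
        refine Finset.sum_congr rfl fun i _ => ?_
        rw [← sweedler_coassoc a (fun a₁ c d => sweedler k y fun y₁ y₂ =>
          E (S a₁ * c * (B i • y₁)) ((A i • d) * y₂)),
          ← sweedler_counit_left (k := k) a (f := fun a => sweedler k y fun y₁ y₂ =>
            E (B i • y₁) ((A i • a) * y₂))]
        congr! 3 with c d
        rw [hY.sweedler_antipode_left c (f := fun z => sweedler k y fun y₁ y₂ =>
            E (z * (B i • y₁)) ((A i • d) * y₂))]
        simp only [one_mul]

omit hR in
theorem sum_sweedler_antipode_mul (x y : Y) :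
    (∑ i, sweedler k x fun x₁ x₂ => S (x₁ * (B i • y)) * (A i • x₂)) =
      counit (R := k) x • S y := by
  rw [← hY.sweedler_sweedler_mul_antipode hAB x y (fun p q => S p * q),
    ← sweedler_counit_left (k := k) y (f := fun y => counit (R := k) x • S y)]
  congr! 3 with y₁ y₂
  simp only [← mul_assoc]
  rw [hY.sweedler_antipode_left (x * y₁) (f := fun z => z * S y₂), hY.counit_mul,
    one_mul, mul_smul, smul_comm]

theorem antipode_mul (a b : Y) : S (a * b) = ∑ i, (B i • S b) * (A i • S a) := by
  calc S (a * b)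
      = sweedler k a fun a₁ c => sweedler k c fun a₂ a₃ =>
          ∑ i, S (a₁ * (B i • b)) * (A i • (a₂ * S a₃)) := by
        rw [← sweedler_counit_right (k := k) a (f := fun a => S (a * b))]
        congr! 3 with a₁ c
        rw [hY.sweedler_antipode_right c (f := fun z => ∑ i, S (a₁ * (B i • b)) * (A i • z))]
        nth_rw 1 [← one_smul U b, ← hR.counit_left hAB]
        simp [hY.smul_one, Finset.sum_smul, Finset.mul_sum, map_sum]
    _ = sweedler k a fun a₁ c => sweedler k c fun a₂ a₃ =>
          ∑ j, ∑ i, S (a₁ * (B i • B j • b)) * (A i • a₂) * (A j • S a₃) := by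
        congr! 6 with a₁ c a₂ a₃
        rw [hY.sum_left_act_mul hR hAB a₂ (S a₃) (fun p u => S (a₁ * (u • b)) * p), Finset.sum_comm]
        simp only [mul_assoc, mul_smul]
    _ = sweedler k a fun c a₃ => sweedler k c fun a₁ a₂ =>
          ∑ j, ∑ i, S (a₁ * (B i • B j • b)) * (A i • a₂) * (A j • S a₃) :=
        (sweedler_coassoc a (fun a₁ a₂ a₃ =>
          ∑ j, ∑ i, S (a₁ * (B i • B j • b)) * (A i • a₂) * (A j • S a₃))).symm
    _ = sweedler k a fun c a₃ => counit (R := k) c • ∑ j, (B j • S b) * (A j • S a₃) := by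
        congr! 3 with c a₃
        rw [sweedler_sum, Finset.smul_sum]
        refine Finset.sum_congr rfl fun j _ => ?_
        rw [← hY.antipode_smul (B j) b, ← smul_mul_assoc,
          ← hY.sum_sweedler_antipode_mul hAB c (B j • b), sweedler_sum, Finset.sum_mul]
        refine Finset.sum_congr rfl fun i _ => ?_
        exact (apply_sweedler (k := k) (f := fun z => z * (A j • S a₃)) _ _).symm
    _ = _ := sweedler_counit_left a (f := fun a => ∑ j, (B j • S b) * (A j • S a))

omit hR in
theorem sweedler_sweedler_antipode_mul (a : Y) (E : Y → Y → M)
    (h₁ : ∀ b, IsLinearMap k fun a => E a b := by fun_prop)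
    (h₂ : ∀ a, IsLinearMap k fun b => E a b := by fun_prop) :
    (sweedler k a fun a₁ a₂ => sweedler k (S a₁) fun s₁ s₂ =>
      ∑ i, E (s₁ * (B i • a₂)) (A i • s₂)) = E 1 (S a) := by
  calc (sweedler k a fun a₁ a₂ => sweedler k (S a₁) fun s₁ s₂ =>
        ∑ i, E (s₁ * (B i • a₂)) (A i • s₂))
      = sweedler k a fun a₁ a₂ => sweedler k a₂ fun y₁ y₂ => sweedler k (S a₁ * y₁) fun z₁ z₂ =>
          E z₁ (z₂ * S y₂) := by
        congr! 3 with a₁ a₂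
        rw [hY.sweedler_sweedler_mul_antipode hAB _ _ E h₁ h₂, sweedler_sum]
    _ = sweedler k a fun c y₂ => sweedler k c fun a₁ y₁ => sweedler k (S a₁ * y₁) fun z₁ z₂ =>
          E z₁ (z₂ * S y₂) :=
        (sweedler_coassoc a (fun a₁ y₁ y₂ => sweedler k (S a₁ * y₁) fun z₁ z₂ =>
          E z₁ (z₂ * S y₂))).symm
    _ = sweedler k a fun c y₂ => counit (R := k) c • E 1 (S y₂) := by
        congr! 3 with c y₂
        rw [hY.sweedler_antipode_left c (f := fun z => sweedler k z fun z₁ z₂ =>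
          E z₁ (z₂ * S y₂)), hY.sweedler_one _, one_mul]
    _ = _ := sweedler_counit_left a (f := fun a => E 1 (S a))

theorem sweedler_antipode (a : Y) (E : Y → Y → M)
    (h₁ : ∀ b, IsLinearMap k fun a => E a b := by fun_prop)
    (h₂ : ∀ a, IsLinearMap k fun b => E a b := by fun_prop) :
    sweedler k (S a) E = ∑ i, sweedler k a fun a₁ a₂ => E (B i • S a₂) (A i • S a₁) := by
  calc sweedler k (S a) E
      = sweedler k a fun a₁ c => sweedler k c fun a₂ a₃ => sweedler k (S a₁) fun s₁ s₂ =>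
          ∑ i, E (s₁ * (B i • (a₂ * S a₃))) (A i • s₂) := by
        rw [← sweedler_counit_right (k := k) a (f := fun a => sweedler k (S a) E)]
        congr! 3 with a₁ c
        rw [hY.sweedler_antipode_right c (f := fun z => sweedler k (S a₁) fun s₁ s₂ =>
          ∑ i, E (s₁ * (B i • z)) (A i • s₂))]
        congr! 4 with s₁ s₂
        nth_rw 1 [← one_smul U s₂, ← hR.counit_right hAB]
        simp only [hY.smul_one, Finset.sum_smul, mul_smul_comm, mul_one, smul_assoc]
        rw [map_sum_of_isLinearMap _ _ (h₂ s₁)]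
        exact Finset.sum_congr rfl fun i _ => by rw [(h₁ _).map_smul, (h₂ _).map_smul]
    _ = sweedler k a fun a₁ c => sweedler k c fun a₂ a₃ => sweedler k (S a₁) fun s₁ s₂ =>
          ∑ i, ∑ j, E (s₁ * (B j • a₂) * (B i • S a₃)) (A i • A j • s₂) := by
        congr! 9 with a₁ c a₂ a₃ s₁ s₂
        rw [hY.sum_right_act_mul hR hAB a₂ (S a₃) (fun u p => E (s₁ * p) (u • s₂))]
        simp only [mul_assoc, mul_smul]
    _ = sweedler k a fun c a₃ => sweedler k c fun a₁ a₂ => sweedler k (S a₁) fun s₁ s₂ =>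
          ∑ i, ∑ j, E (s₁ * (B j • a₂) * (B i • S a₃)) (A i • A j • s₂) :=
        (sweedler_coassoc a (fun a₁ a₂ a₃ => sweedler k (S a₁) fun s₁ s₂ =>
          ∑ i, ∑ j, E (s₁ * (B j • a₂) * (B i • S a₃)) (A i • A j • s₂))).symm
    _ = sweedler k a fun c a₃ => ∑ i, E (B i • S a₃) (A i • S c) := by
        congr! 3 with c a₃
        simp only [sweedler_sum]
        refine Finset.sum_congr rfl fun i _ => ?_
        have cancel := hY.sweedler_sweedler_antipode_mul hAB c
          fun p q => E (p * (B i • S a₃)) (A i • q)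
        simpa only [sweedler_sum, one_mul] using cancel
    _ = _ := sweedler_sum _ _ _

end IsBraidedHopfAlgebra
end BraidedHopf

section BraidedAntipodeSquare

open Coalgebra HopfAlgebra IsUniversalRMatrix

variable {k U M : Type*} [Field k] [Ring U] [HopfAlgebra k U] [AddCommMonoid M] [Module k M]

/-- The map `q ▷ S⁻²(·)`, where `T` is the inverse of the antipode `S`. If `q` is the inverse of
Drinfeld's element, this is the inverse square of the antipode of the bosonization, restricted to
the braided Hopf algebra. -/
noncomputable def twist {Y : Type*} [AddCommGroup Y] [Module k Y] [Module U Y]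
    [IsScalarTower k U Y] (q : U) (T : Y →ₗ[k] Y) : Y →ₗ[k] Y :=
  (Algebra.lsmul k k Y q : Y →ₗ[k] Y) ∘ₗ T ∘ₗ T

theorem twist_apply {Y : Type*} [AddCommGroup Y] [Module k Y] [Module U Y]
    [IsScalarTower k U Y] (q : U) (T : Y →ₗ[k] Y) (y : Y) : twist q T y = q • T (T y) := rfl

namespace IsBraidedHopfAlgebra

variable {R : (U ⊗[k] U)ˣ} {Y : Type*} [Ring Y] [Algebra k Y] [Coalgebra k Y] [Module U Y]
  [IsScalarTower k U Y] {S : Y →ₗ[k] Y} (hY : IsBraidedHopfAlgebra R S)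
  (hR : IsUniversalRMatrix R) {I : Type*} [Fintype I] {A B : I → U}
  (hAB : (R : U ⊗[k] U) = ∑ i, A i ⊗ₜ[k] B i)

include hY hR hAB

theorem antipode_antipode_mul (a b : Y) :
    S (S (a * b)) = ∑ i, ∑ j, ((B j * A i) • S (S a)) * ((A j * B i) • S (S b)) := by
  rw [hY.antipode_mul hR hAB a b, map_sum]
  refine Finset.sum_congr rfl fun i _ => ?_
  rw [hY.antipode_mul hR hAB]
  simp only [hY.antipode_smul, mul_smul]

theorem sweedler_antipode_antipode (a : Y) (E : Y → Y → M)
    (h₁ : ∀ b, IsLinearMap k fun a => E a b := by fun_prop)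
    (h₂ : ∀ a, IsLinearMap k fun b => E a b := by fun_prop) :
    sweedler k (S (S a)) E = ∑ j, ∑ i, sweedler k a fun a₁ a₂ =>
      E ((B j * A i) • S (S a₁)) ((A j * B i) • S (S a₂)) := by
  rw [hY.sweedler_antipode hR hAB _ E h₁ h₂]
  refine Finset.sum_congr rfl fun j _ => ?_
  rw [hY.sweedler_antipode hR hAB _ _]
  simp only [hY.antipode_smul, mul_smul]

theorem sweedler_mul_left_antipode (y a : Y) (E : Y → Y → M)
    (h₁ : ∀ b, IsLinearMap k fun a => E a b := by fun_prop)
    (h₂ : ∀ a, IsLinearMap k fun b => E a b := by fun_prop) :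
    (sweedler k y fun y₁ y₂ => E y₁ (a * y₂)) = ∑ i, sweedler k (A i • a) fun b₁ b₂ =>
      sweedler k (b₂ * y) fun z₁ z₂ => E (antipode k (B i) • (S b₁ * z₁)) z₂ := by
  calc (sweedler k y fun y₁ y₂ => E y₁ (a * y₂))
      = sweedler k y fun y₁ y₂ => E ((1 : U) • y₁) (((1 : U) • a) * y₂) := by simp only [one_smul]
    _ = ∑ i, ∑ j, sweedler k y fun y₁ y₂ =>
          E ((antipode k (B j) * B i) • y₁) (((A i * A j) • a) * y₂) :=
        (hR.sum_self_mul_op_antipode hAB (fun p q => sweedler k y fun y₁ y₂ =>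
          E (q • y₁) ((p • a) * y₂))).symm
    _ = ∑ j, ∑ i, sweedler k y fun y₁ y₂ =>
          E ((antipode k (B j) * B i) • y₁) (((A i * A j) • a) * y₂) := Finset.sum_comm
    _ = _ := by
        refine Finset.sum_congr rfl fun j _ => ?_
        rw [hY.sweedler_antipode_sweedler_mul hAB (A j • a) y
          (fun p q => E (antipode k (B j) • p) q)]
        simp only [mul_smul]

theorem sum_antipode_left_sweedler_act (x : Y) (E : Y → Y → U → M)
    (h₁ : ∀ b c, IsLinearMap k fun a => E a b c := by fun_prop)
    (h₂ : ∀ a c, IsLinearMap k fun b => E a b c := by fun_prop)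
    (h₃ : ∀ a b, IsLinearMap k fun c => E a b c := by fun_prop) :
    ∑ i, sweedler k (antipode k (A i) • x) (fun a b => E a b (B i)) =
      ∑ i, ∑ j, sweedler k x fun a b =>
        E (antipode k (A j) • a) (antipode k (A i) • b) (B i * B j) := by
  rw [← hR.hexagon_left hAB (fun s t z => sweedler k x fun a b =>
    E (antipode k t • a) (antipode k s • b) z)]
  refine Finset.sum_congr rfl fun i _ => ?_
  rw [hY.sweedler_act _ _ _, _root_.sweedler_antipode _ _]

variable {T : Y →ₗ[k] Y} (hST : ∀ x, S (T x) = x) (hTS : ∀ x, T (S x) = x)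

include hST hTS

omit hR hAB in
theorem inv_smul (h : U) (x : Y) : T (h • x) = h • T x := by
  rw [← hTS (h • T x), hY.antipode_smul, hST]

omit hR hAB hTS in
theorem counit_inv (x : Y) : counit (R := k) (T x) = counit (R := k) x := by
  rw [← hY.counit_antipode, hST]

omit hR hAB hST in
theorem inv_one : T 1 = 1 := by
  rw [← hY.antipode_one, hTS, hY.antipode_one]

theorem twist_antipode_antipode_smul (h : U) (x : Y) :
    twist (drinfeldInv k A B) T (antipode k (antipode k h) • x) =
      h • twist (drinfeldInv k A B) T x := by
  simp only [twist_apply, hY.inv_smul hST hTS]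
  rw [← mul_smul, hR.drinfeldInv_mul_antipode_antipode hAB, mul_smul]

omit hTS in
theorem counit_twist (x : Y) :
    counit (R := k) (twist (drinfeldInv k A B) T x) = counit (R := k) x := by
  rw [twist_apply, hY.counit_smul, hY.counit_inv hST, hY.counit_inv hST,
    hR.counit_drinfeldInv hAB, one_mul]

omit hST in
theorem twist_one : twist (drinfeldInv k A B) T (1 : Y) = 1 := by
  rw [twist_apply, hY.inv_one hTS, hY.inv_one hTS, hY.smul_one, hR.counit_drinfeldInv hAB, one_smul]

omit hR hAB hTS in
theorem antipode_antipode_twist (q : U) (x : Y) : S (S (twist q T x)) = q • x := by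
  rw [twist_apply, hY.antipode_smul, hST, hY.antipode_smul, hST]

theorem twist_mul (a b : Y) :
    twist (drinfeldInv k A B) T (a * b) =
      twist (drinfeldInv k A B) T a * twist (drinfeldInv k A B) T b := by
  have S_injective : Function.Injective S := Function.LeftInverse.injective hTS
  apply S_injective
  apply S_injective
  rw [hY.antipode_antipode_mul hR hAB]
  simp only [hY.antipode_antipode_twist hST]
  rw [hY.act_mul, hR.sweedler_drinfeldInv hAB _, Finset.sum_comm]
  simp only [mul_smul]

theorem sweedler_twist (x : Y) (E : Y → Y → M)
    (h₁ : ∀ b, IsLinearMap k fun a => E a b := by fun_prop)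
    (h₂ : ∀ a, IsLinearMap k fun b => E a b := by fun_prop) :
    sweedler k (twist (drinfeldInv k A B) T x) E = sweedler k x fun a b =>
      E (twist (drinfeldInv k A B) T a) (twist (drinfeldInv k A B) T b) := by
  set q := drinfeldInv k A B with hq
  let F : Y → Y → M := fun y y' => ∑ j, ∑ l, E (T (T ((antipode k (A j) * B l) • y)))
    (T (T ((B j * antipode k (A l)) • y')))
  have hF₁ (y' : Y) : IsLinearMap k fun y => F y y' := by simp only [F]; fun_prop
  have hF₂ (y : Y) : IsLinearMap k fun y' => F y y' := by simp only [F]; fun_prop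
  have undo_monodromy (a b : Y) : ∑ m, ∑ i, F ((B m * A i) • a) ((A m * B i) • b) =
      E (T (T a)) (T (T b)) := by
    have h := hR.sum_monodromyInv_mul_monodromy hAB fun s t => E (T (T (s • a))) (T (T (t • b)))
    simpa only [one_smul, mul_smul, F] using h
  calc sweedler k (twist q T x) E
      = ∑ m, ∑ i, sweedler k (twist q T x) fun a b =>
          F ((B m * A i) • S (S a)) ((A m * B i) • S (S b)) := by
        simp only [← sweedler_sum, undo_monodromy, hTS]
    _ = sweedler k (q • x) F := by
        rw [← hY.sweedler_antipode_antipode hR hAB _ F hF₁ hF₂, hY.antipode_antipode_twist hST]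
    _ = ∑ m, ∑ i, sweedler k x fun a b => F ((B m * A i) • q • a) ((A m * B i) • q • b) := by
        rw [hY.sweedler_act _ _ F hF₁ hF₂, hR.sweedler_drinfeldInv hAB _]
        simp only [mul_smul, hq]
    _ = _ := by simp only [← sweedler_sum, undo_monodromy, hY.inv_smul hST hTS, twist_apply]

theorem sum_sweedler_mul_inv (z : Y) :
    (∑ i, sweedler k z fun z₁ z₂ => (antipode k (A i) • z₂) * (B i • T z₁)) =
      counit (R := k) z • 1 := by
  apply Function.LeftInverse.injective hTS
  rw [S.map_smul, hY.antipode_one, ← hY.sweedler_antipode_right z (f := fun x => x), map_sum]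
  calc ∑ i, S (sweedler k z fun z₁ z₂ => (antipode k (A i) • z₂) * (B i • T z₁))
      = ∑ i, ∑ j, sweedler k z fun z₁ z₂ =>
          ((B j * B i) • z₁) * ((A j * antipode k (A i)) • S z₂) := by
        refine Finset.sum_congr rfl fun i _ => ?_
        rw [apply_sweedler _ _ S.isLinear, ← sweedler_sum]
        congr! 3 with a b
        rw [hY.antipode_mul hR hAB]
        simp only [hY.antipode_smul, hST, mul_smul]
    _ = _ := by
        rw [Finset.sum_comm, hR.sum_self_mul_antipode hAB (fun s t => sweedler k z fun z₁ z₂ =>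
          (t • z₁) * (s • S z₂))]
        simp only [one_smul]

theorem sum_sweedler_inv_mul (z : Y) :
    (∑ i, sweedler k z fun z₁ z₂ => (antipode k (A i) • T z₂) * (B i • z₁)) =
      counit (R := k) z • 1 := by
  apply Function.LeftInverse.injective hTS
  rw [S.map_smul, hY.antipode_one, ← hY.sweedler_antipode_left z (f := fun x => x), map_sum]
  calc ∑ i, S (sweedler k z fun z₁ z₂ => (antipode k (A i) • T z₂) * (B i • z₁))
      = ∑ i, ∑ j, sweedler k z fun z₁ z₂ =>
          ((B j * B i) • S z₁) * ((A j * antipode k (A i)) • z₂) := by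
        refine Finset.sum_congr rfl fun i _ => ?_
        rw [apply_sweedler _ _ S.isLinear, ← sweedler_sum]
        congr! 3 with a b
        rw [hY.antipode_mul hR hAB]
        simp only [hY.antipode_smul, hST, mul_smul]
    _ = _ := by
        rw [Finset.sum_comm, hR.sum_self_mul_antipode hAB (fun s t => sweedler k z fun z₁ z₂ =>
          (t • S z₁) * (s • z₂))]
        simp only [one_smul]

end IsBraidedHopfAlgebra
end BraidedAntipodeSquare

section Trace

variable {k Y M ι : Type*} [CommSemiring k] [AddCommMonoid Y] [Module k Y] [AddCommMonoid M]
  [Module k M] [Fintype ι]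

theorem trace_eq_sum_coord (e : Module.Basis ι k Y) (f : Y →ₗ[k] Y) :
    LinearMap.trace k Y f = ∑ l, e.coord l (f (e l)) := by
  classical
  simp only [LinearMap.trace_eq_matrix_trace k e, Matrix.trace, Matrix.diag_apply,
    LinearMap.toMatrix_apply, Module.Basis.coord_apply]

theorem sum_coord_apply_comm (e : Module.Basis ι k Y) (f g : Y →ₗ[k] Y) :
    ∑ l, e.coord l (f (g (e l))) = ∑ l, e.coord l (g (f (e l))) := by
  simpa only [trace_eq_sum_coord e, Module.End.mul_apply] using LinearMap.trace_mul_comm k f g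

theorem sum_coord_smul_apply (e : Module.Basis ι k Y) (y : Y) {f : Y → M}
    (hf : IsLinearMap k f := by fun_prop) : ∑ l, e.coord l y • f (e l) = f y := by
  conv_rhs => rw [← e.sum_repr y, map_sum_of_isLinearMap _ _ hf]
  simp only [hf.map_smul, Module.Basis.coord_apply]

theorem sum_sweedler_coord_smul [Coalgebra k Y] (e : Module.Basis ι k Y) (x : Y) (E : Y → Y → M)
    (h₁ : ∀ b, IsLinearMap k fun a => E a b := by fun_prop)
    (h₂ : ∀ a, IsLinearMap k fun b => E a b := by fun_prop) :
    ∑ j, E (sweedler k x fun a b => e.coord j b • a) (e j) = sweedler k x E := by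
  have expand (j : ι) := apply_sweedler x (fun a b => e.coord j b • a) (h₁ (e j))
  simp only [expand, ← sweedler_sum, (h₁ _).map_smul]
  congr! 3 with a b
  exact sum_coord_smul_apply e b (h₂ a)

/-- The functional `y ↦ Tr(x ↦ θ(x) y)`, in terms of which the braided trace formulas are
expressed. -/
noncomputable def twistedTrace {Y : Type*} [Semiring Y] [Algebra k Y] (θ : Y →ₗ[k] Y) :
    Y →ₗ[k] k :=
  LinearMap.trace k Y ∘ₗ LinearMap.lcomp k Y θ ∘ₗ (LinearMap.mul k Y).flip

theorem twistedTrace_apply {Y : Type*} [Semiring Y] [Algebra k Y] (θ : Y →ₗ[k] Y) (y : Y) :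
    twistedTrace θ y = LinearMap.trace k Y (LinearMap.mulRight k y ∘ₗ θ) := rfl

theorem twistedTrace_eq_sum {Y : Type*} [Semiring Y] [Algebra k Y] (θ : Y →ₗ[k] Y)
    (e : Module.Basis ι k Y) (y : Y) :
    twistedTrace θ y = ∑ l, e.coord l (θ (e l) * y) :=
  trace_eq_sum_coord e _

end Trace

section TraceIntegral

open Coalgebra HopfAlgebra IsUniversalRMatrix

variable {k U M : Type*} [Field k] [Ring U] [HopfAlgebra k U] [AddCommMonoid M] [Module k M]

namespace IsBraidedHopfAlgebra

variable {R : (U ⊗[k] U)ˣ} {Y : Type*} [Ring Y] [Algebra k Y] [Coalgebra k Y] [Module U Y]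
  [IsScalarTower k U Y] {S : Y →ₗ[k] Y} (hY : IsBraidedHopfAlgebra R S)
  (hR : IsUniversalRMatrix R) {I : Type*} [Fintype I] {A B : I → U}
  (hAB : (R : U ⊗[k] U) = ∑ i, A i ⊗ₜ[k] B i)
  {T : Y →ₗ[k] Y} (hST : ∀ x, S (T x) = x) (hTS : ∀ x, T (S x) = x)

include hY hR hAB hST hTS

omit hTS in
theorem sum_antipode_smul_antipode_twist_mul (a b : Y) :
    ∑ i, antipode k (B i) • (S (A i • twist (drinfeldInv k A B) T b) * a) =
      ∑ i, (antipode k (A i) • T b) * (B i • a) := by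
  set w := twist (drinfeldInv k A B) T b with hw
  have antipode_w : S w = drinfeldInv k A B • T b := by
    rw [hw, twist_apply, hY.antipode_smul, hST]
  have sum_smul_antipode_w (j : I) : ∑ i, antipode k (B i) • (A i * A j) • S w =
      antipode k (antipode k (A j)) • T b := by
    calc ∑ i, antipode k (B i) • (A i * A j) • S w
        = (drinfeld k A B * A j * drinfeldInv k A B) • T b := by
          simp only [antipode_w, drinfeld, Finset.sum_mul, Finset.sum_smul, mul_smul]
      _ = _ := by
          rw [← hR.antipode_antipode_mul_drinfeld hAB, mul_assoc, hR.drinfeld_mul_drinfeldInv hAB,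
            mul_one]
  calc ∑ i, antipode k (B i) • (S (A i • w) * a)
      = ∑ i, sweedler k (B i) fun s t => (antipode k t • S (A i • w)) * (antipode k s • a) := by
        refine Finset.sum_congr rfl fun i _ => ?_
        rw [hY.act_mul, _root_.sweedler_antipode _ _]
    _ = ∑ j, (∑ i, antipode k (B i) • (A i * A j) • S w) * (antipode k (B j) • a) := by
        rw [hR.hexagon_right hAB (fun z s t => (antipode k t • S (z • w)) * (antipode k s • a)),
          Finset.sum_comm]
        simp only [Finset.sum_mul, hY.antipode_smul]
    _ = ∑ j, (antipode k (antipode k (A j)) • T b) * (antipode k (B j) • a) := by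
        simp only [sum_smul_antipode_w]
    _ = _ := hR.sum_antipode_antipode hAB (fun s t => (antipode k s • T b) * (t • a))

theorem sum_sweedler_antipode_twist_mul (z : Y) :
    (∑ i, sweedler k z fun z₁ z₂ =>
      antipode k (B i) • (S (A i • twist (drinfeldInv k A B) T z₂) * z₁)) =
      counit (R := k) z • 1 := by
  simp only [← hY.sum_sweedler_inv_mul hR hAB hST hTS z, ← sweedler_sum,
    hY.sum_antipode_smul_antipode_twist_mul hR hAB hST]

omit hST hTS in
theorem sum_antipode_smul_one (y : Y) (E : Y → Y → M)
    (h₁ : ∀ b, IsLinearMap k fun a => E a b := by fun_prop)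
    (h₂ : ∀ a, IsLinearMap k fun b => E a b := by fun_prop) :
    ∑ i, E (antipode k (B i) • 1) (A i • y) = E 1 y := by
  have move_scalar (i : I) : E (antipode k (B i) • 1) (A i • y) =
      E 1 ((counit (R := k) (B i) • A i) • y) := by
    rw [hY.smul_one, HopfAlgebra.counit_antipode, (h₁ _).map_smul, ← (h₂ _).map_smul, smul_assoc]
  simp only [move_scalar]
  rw [← map_sum_of_isLinearMap _ _ (h₂ 1), ← Finset.sum_smul, hR.counit_right hAB, one_smul]

theorem sum_sweedler_sweedler_act_twist (z : Y) (E : Y → Y → M)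
    (h₁ : ∀ b, IsLinearMap k fun a => E a b := by fun_prop)
    (h₂ : ∀ a, IsLinearMap k fun b => E a b := by fun_prop) :
    (∑ i, sweedler k z fun z₁ z₂ => sweedler k (A i • twist (drinfeldInv k A B) T z₂) fun w₁ w₂ =>
      E (antipode k (B i) • (S w₁ * z₁)) w₂) = E 1 (twist (drinfeldInv k A B) T z) := by
  set θ := twist (drinfeldInv k A B) T with hθ
  calc (∑ i, sweedler k z fun z₁ z₂ => sweedler k (A i • θ z₂) fun w₁ w₂ =>
        E (antipode k (B i) • (S w₁ * z₁)) w₂)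
      = sweedler k z fun z₁ z₂ => ∑ i, sweedler k (A i • θ z₂) fun w₁ w₂ =>
        E (antipode k (B i) • (S w₁ * z₁)) w₂ := (sweedler_sum _ _ _).symm
    _ = sweedler k z fun z₁ z₂ => sweedler k z₂ fun a b => ∑ i, ∑ j,
          E (antipode k (B j) • antipode k (B i) • (S (A i • θ a) * z₁)) (A j • θ b) := by
        congr! 3 with z₁ z₂
        rw [hY.sum_left_sweedler_act hR hAB (θ z₂) (fun a b c => E (antipode k c • (S a * z₁)) b)]
        simp only [sweedler_sum]
        refine Finset.sum_congr rfl fun i _ => Finset.sum_congr rfl fun j _ => ?_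
        rw [hY.sweedler_twist hR hAB hST hTS _ _]
        simp only [antipode_mul_antidistrib, mul_smul, hθ]
    _ = sweedler k z fun c b => sweedler k c fun z₁ a => ∑ i, ∑ j,
          E (antipode k (B j) • antipode k (B i) • (S (A i • θ a) * z₁)) (A j • θ b) :=
        (sweedler_coassoc z (fun z₁ a b => ∑ i, ∑ j,
          E (antipode k (B j) • antipode k (B i) • (S (A i • θ a) * z₁)) (A j • θ b))).symm
    _ = sweedler k z fun c b => counit (R := k) c • E 1 (θ b) := by
        congr! 3 with c b
        have hE : IsLinearMap k fun p => ∑ j, E (antipode k (B j) • p) (A j • θ b) := by fun_prop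
        rw [← hY.sum_antipode_smul_one hR hAB (θ b) E, ← hE.map_smul,
          ← hY.sum_sweedler_antipode_twist_mul hR hAB hST hTS c, ← sweedler_sum,
          apply_sweedler _ _ hE]
        congr! 3 with z₁ a
        exact (map_sum_of_isLinearMap _ _ hE).symm
    _ = _ := sweedler_counit_left z (f := fun b => E 1 (θ b))

theorem sweedler_twistedTrace [FiniteDimensional k Y] (y : Y) :
    (sweedler k y fun y₁ y₂ => twistedTrace (twist (drinfeldInv k A B) T) y₂ • y₁) =
      twistedTrace (twist (drinfeldInv k A B) T) y • (1 : Y) := by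
  set θ := twist (drinfeldInv k A B) T
  let e := Module.finBasis k Y
  simp only [twistedTrace_eq_sum θ e, Finset.sum_smul, sweedler_sum]
  calc ∑ j, (sweedler k y fun y₁ y₂ => e.coord j (θ (e j) * y₂) • y₁)
      = ∑ j, ∑ i, sweedler k (A i • θ (e j)) fun b₁ b₂ => sweedler k (b₂ * y) fun z₁ z₂ =>
          e.coord j z₂ • (antipode k (B i) • (S b₁ * z₁)) :=
        Finset.sum_congr rfl fun j _ => hY.sweedler_mul_left_antipode hR hAB y (θ (e j))
          (fun p q => e.coord j q • p)
    _ = ∑ j, ∑ i, sweedler k (A i • θ (e j)) fun b₁ b₂ => ∑ l, e.coord l (b₂ * y) •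
          (antipode k (B i) • (S b₁ * sweedler k (e l) fun z₁ z₂ => e.coord j z₂ • z₁)) := by
        congr! 6 with j _ i _ b₁ b₂
        rw [sum_coord_smul_apply e (b₂ * y) (f := fun v => antipode k (B i) •
          (S b₁ * sweedler k v fun z₁ z₂ => e.coord j z₂ • z₁)),
          apply_sweedler (f := fun v => antipode k (B i) • (S b₁ * v)) (k := k)]
        simp only [mul_smul_comm, smul_comm (antipode k (B i)) (_ : k)]
    _ = ∑ l, ∑ i, ∑ j, sweedler k (A i • θ (e j)) fun b₁ b₂ => e.coord l (b₂ * y) •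
          (antipode k (B i) • (S b₁ * sweedler k (e l) fun z₁ z₂ => e.coord j z₂ • z₁)) := by
        simp only [sweedler_sum]
        rw [sum_sum_sum_rotate]
        exact Finset.sum_congr rfl fun l _ => Finset.sum_comm
    _ = ∑ l, ∑ i, sweedler k (e l) fun z₁ z₂ => sweedler k (A i • θ z₂) fun b₁ b₂ =>
          e.coord l (b₂ * y) • (antipode k (B i) • (S b₁ * z₁)) := by
        refine Finset.sum_congr rfl fun l _ => Finset.sum_congr rfl fun i _ => ?_
        exact sum_sweedler_coord_smul e (e l) (fun z₁ z₂ => sweedler k (A i • θ z₂) fun b₁ b₂ =>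
          e.coord l (b₂ * y) • (antipode k (B i) • (S b₁ * z₁)))
    _ = _ := Finset.sum_congr rfl fun l _ =>
        hY.sum_sweedler_sweedler_act_twist hR hAB hST hTS (e l)
          (fun p q => e.coord l (q * y) • p)

omit hAB hST hTS hR in
theorem mul_antipode_smul (g : U) (a y : Y) :
    a * (antipode k g • y) = sweedler k g fun s t => antipode k s • ((t • a) * y) := by
  symm
  calc (sweedler k g fun s t => antipode k s • ((t • a) * y))
      = sweedler k g fun c t => sweedler k c fun s s' =>
          ((antipode k s' * t) • a) * (antipode k s • y) := by
        congr! 3 with s t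
        rw [hY.act_mul, _root_.sweedler_antipode _ _]
        simp only [mul_smul]
    _ = sweedler k g fun s c => sweedler k c fun s' t =>
          ((antipode k s' * t) • a) * (antipode k s • y) :=
        sweedler_coassoc g (fun s s' t => ((antipode k s' * t) • a) * (antipode k s • y))
    _ = sweedler k g fun s c => counit (R := k) c • (((1 : U) • a) * (antipode k s • y)) := by
        congr! 3 with s c
        exact _root_.sweedler_antipode_left c (f := fun z => (z • a) * (antipode k s • y))
    _ = _ := by
        rw [sweedler_counit_right g (f := fun t => ((1 : U) • a) * (antipode k t • y)), one_smul]

theorem twistedTrace_smul [FiniteDimensional k Y] (h : U) (y : Y) :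
    twistedTrace (twist (drinfeldInv k A B) T) (h • y) =
      counit (R := k) h • twistedTrace (twist (drinfeldInv k A B) T) y := by
  set θ := twist (drinfeldInv k A B) T with hθ
  let e := Module.finBasis k Y
  have cyclic (s t : U) : ∑ l, e.coord l (s • ((t • θ (e l)) * y)) =
      ∑ l, e.coord l ((t • θ (s • e l)) * y) :=
    sum_coord_apply_comm e (Algebra.lsmul k k Y s)
      (LinearMap.mulRight k y ∘ₗ (Algebra.lsmul k k Y t : Y →ₗ[k] Y) ∘ₗ θ)
  obtain ⟨g, rfl⟩ := hR.exists_antipode_antipode_eq hAB h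
  calc twistedTrace θ (antipode k (antipode k g) • y)
      = sweedler k (antipode k g) fun s t =>
          ∑ l, e.coord l (antipode k s • ((t • θ (e l)) * y)) := by
        simp only [twistedTrace_eq_sum θ e, hY.mul_antipode_smul, sweedler_sum,
          apply_sweedler _ _ (e.coord _).isLinear]
    _ = sweedler k (antipode k g) fun s t => ∑ l, e.coord l ((t • θ (antipode k s • e l)) * y) := by
        simp only [cyclic]
    _ = sweedler k g fun s t =>
          ∑ l, e.coord l ((antipode k s • θ (antipode k (antipode k t) • e l)) * y) :=
        _root_.sweedler_antipode g
          (fun s t => ∑ l, e.coord l ((t • θ (antipode k s • e l)) * y))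
    _ = sweedler k g fun s t => ∑ l, e.coord l (((antipode k s * t) • θ (e l)) * y) := by
        simp only [hθ, hY.twist_antipode_antipode_smul hR hAB hST hTS, mul_smul]
    _ = counit (R := k) g • ∑ l, e.coord l (((1 : U) • θ (e l)) * y) :=
        _root_.sweedler_antipode_left g (f := fun z => ∑ l, e.coord l ((z • θ (e l)) * y))
    _ = _ := by
        simp only [HopfAlgebra.counit_antipode, twistedTrace_eq_sum θ e, one_smul]

theorem sum_smul_twist_antipode_mul (x a : Y) :
    ∑ j, B j • (twist (drinfeldInv k A B) T (antipode k (A j) • S x) * a) =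
      ∑ j, (antipode k (A j) • T x) * (B j • a) := by
  set q := drinfeldInv k A B
  have twist_smul_antipode (u : U) : twist q T (u • S x) = (q * u) • T x := by
    rw [twist_apply, hY.inv_smul hST hTS, hTS, hY.inv_smul hST hTS, mul_smul]
  calc ∑ j, B j • (twist q T (antipode k (A j) • S x) * a)
      = ∑ j, sweedler k (B j) fun s t => (s • twist q T (antipode k (A j) • S x)) * (t • a) := by
        simp only [hY.act_mul]
    _ = ∑ j, ((∑ l, B l * q * antipode k (A l)) • antipode k (A j) • T x) * (B j • a) := by
        rw [hR.hexagon_right hAB (fun z s t => (s • twist q T (antipode k z • S x)) * (t • a))]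
        simp only [antipode_mul_antidistrib, twist_smul_antipode]
        simp only [Finset.sum_smul, Finset.sum_mul, mul_smul]
    _ = _ := by
        rw [hR.sum_mul_drinfeldInv_mul_antipode hAB]
        simp only [one_smul]

omit hST hTS in
theorem sum_antipode_smul_mul_smul_mul (b c d : Y) :
    ∑ i, (antipode k (A i) • b) * (B i • (c * d)) =
      ∑ i, ∑ l, ((antipode k (A l) • antipode k (A i) • b) * (B l • c)) * (B i • d) := by
  rw [hY.sum_right_act_mul hR hAB c d (fun s p => (antipode k s • b) * p)]
  simp only [antipode_mul_antidistrib, mul_smul, mul_assoc]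

theorem sum_sweedler_mul_act_twist (x a : Y) :
    (∑ i, sweedler k (antipode k (A i) • x) fun x₁ x₂ =>
      x₂ * (B i • (twist (drinfeldInv k A B) T (S x₁) * a))) = counit (R := k) x • a := by
  set θ := twist (drinfeldInv k A B) T with hθ
  calc (∑ i, sweedler k (antipode k (A i) • x) fun x₁ x₂ => x₂ * (B i • (θ (S x₁) * a)))
      = ∑ i, ∑ j, sweedler k x fun x₁ x₂ => (antipode k (A i) • x₂) *
          ((B i * B j) • (θ (S (antipode k (A j) • x₁)) * a)) :=
        hY.sum_antipode_left_sweedler_act hR hAB x (fun x₁ x₂ c => x₂ * (c • (θ (S x₁) * a)))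
    _ = ∑ i, ∑ j, sweedler k x fun x₁ x₂ => (antipode k (A i) • x₂) *
          (B i • ((antipode k (A j) • T x₁) * (B j • a))) := by
        simp only [← sweedler_sum, ← Finset.mul_sum, ← Finset.smul_sum, mul_smul, hθ,
          hY.antipode_smul, ← hY.sum_smul_twist_antipode_mul hR hAB hST hTS]
    _ = ∑ j, ∑ i, sweedler k x fun x₁ x₂ => ∑ l, ((antipode k (A l) • antipode k (A i) • x₂) *
          (B l • T (antipode k (A j) • x₁))) * ((B i * B j) • a) := by
        rw [Finset.sum_comm]
        simp only [← sweedler_sum, hY.sum_antipode_smul_mul_smul_mul hR hAB, hY.inv_smul hST hTS,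
          mul_smul]
    _ = ∑ i, sweedler k (antipode k (A i) • x) fun x₁ x₂ =>
          ∑ l, ((antipode k (A l) • x₂) * (B l • T x₁)) * (B i • a) := by
        rw [Finset.sum_comm]
        exact (hY.sum_antipode_left_sweedler_act hR hAB x (fun x₁ x₂ c =>
          ∑ l, ((antipode k (A l) • x₂) * (B l • T x₁)) * (c • a))).symm
    _ = ∑ i, (counit (R := k) (antipode k (A i) • x) • 1) * (B i • a) := by
        refine Finset.sum_congr rfl fun i _ => ?_
        rw [← hY.sum_sweedler_mul_inv hR hAB hST hTS, ← sweedler_sum,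
          apply_sweedler (f := fun z => z * (B i • a))]
        simp only [Finset.sum_mul]
    _ = counit (R := k) x • (∑ i, counit (R := k) (A i) • B i) • a := by
        simp only [hY.counit_smul, HopfAlgebra.counit_antipode, smul_mul_assoc, one_mul,
          Finset.sum_smul, Finset.smul_sum, smul_assoc, smul_smul, mul_comm]
    _ = _ := by rw [hR.counit_left hAB, one_smul]

end IsBraidedHopfAlgebra

section TraceElement

variable {Y ι : Type*} [Ring Y] [Algebra k Y] [Coalgebra k Y] [Fintype ι]

/-- The element `∑ ⟨eˡ, θ((e_l y)₁)⟩ (e_l y)₂`, where `(e_l)` is a basis and `(eˡ)` its dual: the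
analogue of `twistedTrace θ` for the dual algebra. It is a left integral when `θ` is the twist by
the inverse of Drinfeld's element. -/
noncomputable def traceElement (θ : Y →ₗ[k] Y) (e : Module.Basis ι k Y) (y : Y) : Y :=
  ∑ l, sweedler k (e l * y) fun a b => e.coord l (θ a) • b

theorem counit_traceElement (e : Module.Basis ι k Y) (θ : Y →ₗ[k] Y) (y : Y) :
    counit (R := k) (traceElement θ e y) = twistedTrace θ y := by
  have expand (l : ι) : counit (R := k) (sweedler k (e l * y) fun a b => e.coord l (θ a) • b) =
      e.coord l (θ (e l * y)) := by
    rw [apply_sweedler _ _ (LinearMap.isLinear _),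
      ← sweedler_counit_right (k := k) (e l * y) (f := fun a => e.coord l (θ a))]
    simp only [map_smul, smul_eq_mul, mul_comm]
  rw [traceElement, map_sum, twistedTrace_eq_sum θ e]
  simp only [expand]
  exact sum_coord_apply_comm e θ (LinearMap.mulRight k y)

theorem sum_sweedler_apply_mul_coord_smul {M : Type*} [AddCommMonoid M] [Module k M]
    (e : Module.Basis ι k Y) (g : Y →ₗ[k] Y) (y : Y) {f : Y → Y} {h : Y → M}
    (hf : IsLinearMap k f := by fun_prop) (hh : IsLinearMap k h := by fun_prop) :
    (∑ l, sweedler k (g (e l) * y) fun z₁ z₂ => e.coord l (f z₁) • h z₂) =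
      ∑ l, sweedler k (e l * y) fun z₁ z₂ => e.coord l (g (f z₁)) • h z₂ := by
  calc (∑ l, sweedler k (g (e l) * y) fun z₁ z₂ => e.coord l (f z₁) • h z₂)
      = ∑ l, ∑ m, e.coord m (g (e l)) •
          sweedler k (e m * y) fun z₁ z₂ => e.coord l (f z₁) • h z₂ :=
        Finset.sum_congr rfl fun l _ => (sum_coord_smul_apply e (g (e l)) (f := fun v =>
          sweedler k (v * y) fun z₁ z₂ => e.coord l (f z₁) • h z₂)).symm
    _ = ∑ m, sweedler k (e m * y) fun z₁ z₂ =>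
          (∑ l, e.coord l (f z₁) • e.coord m (g (e l))) • h z₂ := by
        rw [Finset.sum_comm]
        simp only [Finset.sum_smul, sweedler_sum, smul_sweedler, smul_smul, smul_eq_mul, mul_comm]
    _ = _ := by
        congr! 5 with m _ z₁ z₂
        exact sum_coord_smul_apply e (f z₁) (f := fun v => e.coord m (g v))

end TraceElement

theorem IsBraidedHopfAlgebra.mul_traceElement {R : (U ⊗[k] U)ˣ} {Y : Type*} [Ring Y] [Algebra k Y]
    [Coalgebra k Y] [Module U Y] [IsScalarTower k U Y] {S : Y →ₗ[k] Y}
    (hY : IsBraidedHopfAlgebra R S) (hR : IsUniversalRMatrix R) {I : Type*} [Fintype I]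
    {A B : I → U} (hAB : (R : U ⊗[k] U) = ∑ i, A i ⊗ₜ[k] B i) {T : Y →ₗ[k] Y}
    (hST : ∀ x, S (T x) = x) (hTS : ∀ x, T (S x) = x) {ι : Type*} [Fintype ι]
    (e : Module.Basis ι k Y) (x y : Y) :
    x * traceElement (twist (drinfeldInv k A B) T) e y =
      counit (R := k) x • traceElement (twist (drinfeldInv k A B) T) e y := by
  set θ := twist (drinfeldInv k A B) T with hθ
  calc x * traceElement θ e y
      = ∑ l, sweedler k (e l * y) fun y₁ y₂ => e.coord l (θ y₁) • (x * y₂) := by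
        rw [traceElement, Finset.mul_sum]
        refine Finset.sum_congr rfl fun l _ => ?_
        rw [apply_sweedler (f := fun v => x * v) (k := k)]
        simp only [mul_smul_comm]
    _ = ∑ l, ∑ i, sweedler k (antipode k (A i) • x) fun b₁ b₂ => sweedler k (b₂ * (e l * y))
          fun z₁ z₂ => e.coord l (B i • (θ (S b₁) * θ z₁)) • z₂ := by
        refine Finset.sum_congr rfl fun l _ => ?_
        rw [hY.sweedler_mul_left_antipode hR hAB (e l * y) x (fun p q => e.coord l (θ p) • q),
          ← hR.sum_antipode_antipode hAB (fun s t => sweedler k (s • x) fun b₁ b₂ =>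
            sweedler k (b₂ * (e l * y)) fun z₁ z₂ =>
              e.coord l (θ (antipode k t • (S b₁ * z₁))) • z₂)]
        simp only [hθ, hY.twist_antipode_antipode_smul hR hAB hST hTS,
          hY.twist_mul hR hAB hST hTS]
    _ = ∑ i, sweedler k (antipode k (A i) • x) fun b₁ b₂ => ∑ l, sweedler k (e l * y)
          fun z₁ z₂ => e.coord l (b₂ * (B i • (θ (S b₁) * θ z₁))) • z₂ := by
        rw [Finset.sum_comm]
        simp only [← sweedler_sum]
        congr! 4 with i _ b₁ b₂
        simpa only [LinearMap.mulLeft_apply, mul_assoc] using sum_sweedler_apply_mul_coord_smul e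
          (LinearMap.mulLeft k b₂) y (f := fun z => B i • (θ (S b₁) * θ z)) (h := fun z => z)
    _ = ∑ l, sweedler k (e l * y) fun z₁ z₂ => e.coord l (∑ i, sweedler k (antipode k (A i) • x)
          fun b₁ b₂ => b₂ * (B i • (θ (S b₁) * θ z₁))) • z₂ := by
        simp only [sweedler_sum, map_sum, Finset.sum_smul]
        rw [Finset.sum_comm]
        refine Finset.sum_congr rfl fun l _ => Finset.sum_congr rfl fun i _ => ?_
        rw [sweedler_comm]
        congr! 3 with z₁ z₂
        rw [apply_sweedler (k := k) (f := fun v => e.coord l v • z₂)]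
    _ = _ := by
        simp only [hθ, hY.sum_sweedler_mul_act_twist hR hAB hST hTS, map_smul, traceElement,
          Finset.smul_sum, smul_sweedler, smul_smul, smul_eq_mul]

end TraceIntegral

section DualPairing

open Coalgebra HopfAlgebra IsUniversalRMatrix

variable {k : Type*} [Field k]

section AntipodeInvSq

variable {V : Type*} [AddCommGroup V] [Module k V] {S T : V →ₗ[k] V}

theorem antipodeInvSq_of_inverse (hST : ∀ x, S (T x) = x) (hTS : ∀ x, T (S x) = x) :
    antipodeInvSq S = T ∘ₗ T := by
  let u : (Module.End k V)ˣ := ⟨S, T, LinearMap.ext hST, LinearMap.ext hTS⟩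
  have inverse_eq : Ring.inverse (S : Module.End k V) = T := Ring.inverse_unit u
  rw [antipodeInvSq, inverse_eq]

theorem antipodeInvSq_of_not_isUnit (h : ¬ IsUnit (S : Module.End k V)) : antipodeInvSq S = 0 := by
  rw [antipodeInvSq, Ring.inverse_non_unit _ h, LinearMap.zero_comp]

end AntipodeInvSq

section DualBases

variable {X D : Type*} [AddCommGroup X] [Module k X] [AddCommGroup D] [Module k D]
  {p : D →ₗ[k] X →ₗ[k] k} {ι : Type*} [DecidableEq ι] {φ : Module.Basis ι k X}
  {ε : Module.Basis ι k D} (hdual : ∀ i j, p (ε i) (φ j) = if i = j then 1 else 0)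

include hdual

theorem pairing_apply_basis_left (i : ι) (x : X) : p (ε i) x = φ.coord i x := by
  have p_eq_coord : p (ε i) = φ.coord i := φ.ext fun j => by
    simp [hdual, Finsupp.single_apply, eq_comm]
  rw [p_eq_coord]

theorem pairing_apply_basis_right (i : ι) (σ : D) : p σ (φ i) = ε.coord i σ := by
  have flip_eq_coord : p.flip (φ i) = ε.coord i := ε.ext fun j => by
    simp [hdual, Finsupp.single_apply]
  rw [← flip_eq_coord, LinearMap.flip_apply]

theorem eq_of_forall_pairing_eq {x y : X} (h : ∀ σ, p σ x = p σ y) : x = y :=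
  φ.ext_elem fun i => by
    simpa only [pairing_apply_basis_left hdual, Module.Basis.coord_apply] using h (ε i)

theorem exists_pairing_eq [Finite ι] (f : D →ₗ[k] k) : ∃ x, ∀ σ, p σ x = f σ := by
  cases nonempty_fintype ι
  refine ⟨∑ j, f (ε j) • φ j, fun σ => ?_⟩
  simp only [map_sum, map_smul, pairing_apply_basis_right hdual, smul_eq_mul, mul_comm (f _)]
  exact sum_coord_smul_apply ε σ f.isLinear

end DualBases

variable {U : Type*} [Ring U] [HopfAlgebra k U]

namespace IsBraidedDualPairing

variable {X D : Type*} [Ring X] [Algebra k X] [Coalgebra k X] [Module U X] [IsScalarTower k U X]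
    [Ring D] [Algebra k D] [Coalgebra k D] [Module U D] [IsScalarTower k U D]
    {p : D →ₗ[k] X →ₗ[k] k} (hp : IsBraidedDualPairing U p)

include hp

theorem apply_mul_left (σ τ : D) (x : X) :
    p (σ * τ) x = sweedler k x fun x₁ x₂ => p τ x₁ * p σ x₂ := by
  simp only [hp.mul_left, comul_eq_sweedler x, sweedler, map_sum, TensorProduct.map_tmul,
    LinearMap.mul'_apply]

theorem apply_mul_right (σ : D) (x y : X) :
    p σ (x * y) = sweedler k σ fun σ₁ σ₂ => p σ₁ y * p σ₂ x := by
  simp only [hp.mul_right, comul_eq_sweedler σ, sweedler, map_sum, TensorProduct.map_tmul,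
    LinearMap.mul'_apply, LinearMap.flip_apply]

theorem sweedler_smul_smul (h : U) (σ : D) (x : X) :
    (sweedler k h fun s t => p (s • σ) (t • x)) = counit (R := k) h • p σ x := by
  rw [smul_eq_mul, ← hp.invariant, comul_eq_sweedler h]
  simp only [sweedler, map_sum, LinearMap.sum_apply, tensorAction_tmul, TensorProduct.lift.tmul]

theorem smul_left (h : U) (σ : D) (x : X) : p (h • σ) x = p σ (antipode k h • x) := by
  calc p (h • σ) x = sweedler k h fun s c => counit (R := k) c • p (s • σ) ((1 : U) • x) := by
        rw [sweedler_counit_right h (f := fun s => p (s • σ) ((1 : U) • x)), one_smul]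
    _ = sweedler k h fun s c => sweedler k c fun t t' => p (s • σ) ((t * antipode k t') • x) := by
        congr! 3 with s c
        exact (_root_.sweedler_antipode_right c (f := fun z => p (s • σ) (z • x))).symm
    _ = sweedler k h fun c t' => sweedler k c fun s t => p (s • σ) ((t * antipode k t') • x) :=
        (sweedler_coassoc h (fun s t t' => p (s • σ) ((t * antipode k t') • x))).symm
    _ = sweedler k h fun c t' => counit (R := k) c • p σ (antipode k t' • x) := by
        simp only [mul_smul, hp.sweedler_smul_smul]
    _ = _ := sweedler_counit_left h (f := fun t => p σ (antipode k t • x))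

theorem antipode_left {R : (U ⊗[k] U)ˣ} {SX : X →ₗ[k] X} (hX : IsBraidedHopfAlgebra R SX)
    {SD : D →ₗ[k] D} (hD : IsBraidedHopfAlgebra R SD) (σ : D) (x : X) :
    p (SD σ) x = p σ (SX x) := by
  -- Both sides are convolution inverses of the pairing.
  refine eq_of_sweedler_mul_eq_counit (f := fun σ x => p σ x) (g := fun σ x => p σ (SX x))
    (h := fun σ x => p (SD σ) x) (fun σ x => ?_) (fun σ x => ?_) (x := σ) (y := x)
  · calc _ = sweedler k σ fun σ₁ σ₂ => p (σ₁ * SD σ₂) x := by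
          simp only [hp.apply_mul_left, mul_comm]
      _ = counit (R := k) σ * counit (R := k) x := by
          rw [hD.sweedler_antipode_right σ (f := fun σ => p σ x), hp.one_left, smul_eq_mul]
  · rw [sweedler_comm]
    simp only [← hp.apply_mul_right]
    rw [hX.sweedler_antipode_right x (f := fun x => p σ x), hp.one_right, smul_eq_mul, mul_comm]

theorem inv_left {R : (U ⊗[k] U)ˣ} {SX TX : X →ₗ[k] X} (hX : IsBraidedHopfAlgebra R SX)
    {SD TD : D →ₗ[k] D} (hD : IsBraidedHopfAlgebra R SD) (hSTX : ∀ x, SX (TX x) = x)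
    (hSTD : ∀ x, SD (TD x) = x) (σ : D) (x : X) : p (TD σ) x = p σ (TX x) := by
  rw [← hSTX x, ← hp.antipode_left hX hD, hSTD, hSTX]

variable {R : (U ⊗[k] U)ˣ} (hR : IsUniversalRMatrix R) {I : Type*} [Fintype I] {A B : I → U}
  (hAB : (R : U ⊗[k] U) = ∑ i, A i ⊗ₜ[k] B i)

include hR hAB

theorem sum_antipode_smul_smul (σ : D) (x : X) :
    ∑ i, p (antipode k (A i) • σ) (B i • x) = p (drinfeldInv k A B • σ) x := by
  rw [← hR.sum_antipode_antipode hAB (fun s t => p (antipode k s • σ) (t • x))]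
  simp only [← hp.smul_left, ← mul_smul, drinfeldInv, Finset.sum_smul, map_sum, LinearMap.sum_apply]

variable {SX : X →ₗ[k] X} (hX : IsBraidedHopfAlgebra R SX)
  {SD : D →ₗ[k] D} (hD : IsBraidedHopfAlgebra R SD)
  {ι : Type*} [Fintype ι] {φ : Module.Basis ι k X} {ε : Module.Basis ι k D}

omit hp [Coalgebra k X] [Coalgebra k D] in
theorem braidingInv_sum_tmul :
    braidingInv R D X (∑ i, φ i ⊗ₜ[k] ε i) =
      ∑ j, ∑ i, (antipode k (A j) • ε i) ⊗ₜ[k] (B j • φ i) := by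
  simp only [braidingInv, LinearMap.comp_apply, hR.inv_eq hAB, map_sum, LinearMap.sum_apply,
    LinearEquiv.coe_coe, TensorProduct.comm_tmul, tensorAction_tmul]
  exact Finset.sum_comm

include hX hD

variable {TX : X →ₗ[k] X} (hSTX : ∀ x, SX (TX x) = x) (hTSX : ∀ x, TX (SX x) = x)
  {TD : D →ₗ[k] D} (hSTD : ∀ x, SD (TD x) = x) (hTSD : ∀ x, TD (SD x) = x)

include hSTX hTSX hSTD hTSD

omit hR hAB in
theorem braidedTrace_one_eq (c : X ⊗[k] D) :
    braidedTrace R p c SD 1 = braidedTraceDual R p c SX 1 := by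
  have mul_one_right (t : D ⊗[k] X) :
      TensorProduct.lift p (TensorProduct.map (antipodeInvSq SD) (LinearMap.mul' k X)
        (TensorProduct.assoc k D X X (t ⊗ₜ 1))) =
      TensorProduct.lift p (LinearMap.lTensor D (antipodeInvSq SX) t) := by
    induction t with
    | zero => simp only [TensorProduct.zero_tmul, map_zero]
    | add t t' ht ht' => simp only [TensorProduct.add_tmul, map_add, ht, ht']
    | tmul σ x =>
      simp only [TensorProduct.assoc_tmul, TensorProduct.map_tmul, LinearMap.mul'_apply, mul_one,
        LinearMap.lTensor_tmul, TensorProduct.lift.tmul, antipodeInvSq_of_inverse hSTX hTSX,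
        antipodeInvSq_of_inverse hSTD hTSD, LinearMap.comp_apply,
        hp.inv_left hX hD hSTX hSTD]
  have mul_one_left (c : X ⊗[k] D) :
      LinearMap.lTensor X (LinearMap.mul' k D) (TensorProduct.assoc k X D D (c ⊗ₜ 1)) = c := by
    induction c with
    | zero => simp only [TensorProduct.zero_tmul, map_zero]
    | add c c' hc hc' => simp only [TensorProduct.add_tmul, map_add, hc, hc']
    | tmul x σ => simp only [TensorProduct.assoc_tmul, LinearMap.lTensor_tmul,
        LinearMap.mul'_apply, mul_one]
  simp only [braidedTrace, braidedTraceDual, LinearMap.comp_apply, TensorProduct.mk_apply,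
    LinearEquiv.coe_coe, mul_one_right, mul_one_left]

variable [DecidableEq ι] (hdual : ∀ i j, p (ε i) (φ j) = if i = j then 1 else 0)

include hdual

omit hTSX in
theorem braidedTrace_apply (ξ : X) :
    braidedTrace R p (∑ i, φ i ⊗ₜ[k] ε i) SD ξ = twistedTrace (twist (drinfeldInv k A B) TX) ξ := by
  set θ := twist (drinfeldInv k A B) TX with hθ
  have pairing_eq_coord (i : ι) (u : U) (x : X) :
      p (TD (TD (antipode k u • ε i))) x = φ.coord i (antipode k (antipode k u) • TX (TX x)) := by
    rw [hp.inv_left hX hD hSTX hSTD, hp.inv_left hX hD hSTX hSTD, hp.smul_left,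
      pairing_apply_basis_left hdual]
  calc braidedTrace R p (∑ i, φ i ⊗ₜ[k] ε i) SD ξ
      = ∑ j, ∑ i, p (TD (TD (antipode k (A j) • ε i))) ((B j • φ i) * ξ) := by
        simp only [braidedTrace, LinearMap.comp_apply, TensorProduct.mk_apply,
          braidingInv_sum_tmul hR hAB, antipodeInvSq_of_inverse hSTD hTSD, LinearEquiv.coe_coe]
        simp only [TensorProduct.sum_tmul, map_sum, TensorProduct.assoc_tmul,
          TensorProduct.map_tmul, LinearMap.comp_apply, LinearMap.mul'_apply,
          TensorProduct.lift.tmul]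
    _ = ∑ j, ∑ i, φ.coord i (B j • antipode k (antipode k (A j)) • TX (TX (φ i * ξ))) := by
        simp only [pairing_eq_coord]
        exact Finset.sum_congr rfl fun j _ => sum_coord_apply_comm φ
          (Algebra.lsmul k k X (antipode k (antipode k (A j))) ∘ₗ TX ∘ₗ TX ∘ₗ
            LinearMap.mulRight k ξ) (Algebra.lsmul k k X (B j))
    _ = ∑ i, φ.coord i (θ (φ i * ξ)) := by
        rw [Finset.sum_comm]
        simp only [hθ, twist_apply, drinfeldInv, Finset.sum_smul, mul_smul, map_sum]
    _ = ∑ i, φ.coord i (θ (φ i) * ξ) := sum_coord_apply_comm φ θ (LinearMap.mulRight k ξ)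
    _ = twistedTrace θ ξ := (twistedTrace_eq_sum θ φ ξ).symm

theorem braidedTraceDual_apply (σ : D) :
    braidedTraceDual R p (∑ i, φ i ⊗ₜ[k] ε i) SX σ =
      twistedTrace (twist (drinfeldInv k A B) TD) σ := by
  set θ := twist (drinfeldInv k A B) TD with hθ
  calc braidedTraceDual R p (∑ i, φ i ⊗ₜ[k] ε i) SX σ
      = ∑ i, ∑ j, p (antipode k (A j) • (ε i * σ)) (TX (TX (B j • φ i))) := by
        simp only [braidedTraceDual, LinearMap.comp_apply, TensorProduct.mk_apply,
          antipodeInvSq_of_inverse hSTX hTSX, map_sum, LinearEquiv.coe_coe,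
          TensorProduct.assoc_tmul, LinearMap.lTensor_tmul, LinearMap.mul'_apply, braidingInv,
          hR.inv_eq hAB, TensorProduct.comm_tmul, LinearMap.sum_apply, tensorAction_tmul,
          TensorProduct.lift.tmul]
    _ = ∑ i, ε.coord i (θ (ε i * σ)) := by
        refine Finset.sum_congr rfl fun i _ => ?_
        simp only [hX.inv_smul hSTX hTSX]
        rw [hp.sum_antipode_smul_smul hR hAB, ← hp.inv_left hX hD hSTX hSTD,
          ← hp.inv_left hX hD hSTX hSTD, hD.inv_smul hSTD hTSD, hD.inv_smul hSTD hTSD,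
          pairing_apply_basis_right hdual, hθ, twist_apply]
    _ = ∑ i, ε.coord i (θ (ε i) * σ) := sum_coord_apply_comm ε θ (LinearMap.mulRight k σ)
    _ = twistedTrace θ σ := (twistedTrace_eq_sum θ ε σ).symm

omit hTSX in
theorem braidedLoop_apply (σ : D) (ξ : X) :
    braidedLoop R p (∑ i, φ i ⊗ₜ[k] ε i) SD σ ξ =
      p σ (traceElement (twist (drinfeldInv k A B) TX) φ ξ) := by
  set θ := twist (drinfeldInv k A B) TX with hθ
  have pairing_eq_sweedler (i : ι) (u : U) (y : X) :
      p (σ * TD (TD (antipode k u • ε i))) y = sweedler k y fun y₁ y₂ =>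
        φ.coord i (antipode k (antipode k u) • TX (TX y₁)) • p σ y₂ := by
    rw [hp.apply_mul_left]
    congr! 3 with y₁ y₂
    rw [hp.inv_left hX hD hSTX hSTD, hp.inv_left hX hD hSTX hSTD, hp.smul_left,
      pairing_apply_basis_left hdual, smul_eq_mul]
  calc braidedLoop R p (∑ i, φ i ⊗ₜ[k] ε i) SD σ ξ
      = ∑ j, ∑ i, p (σ * TD (TD (antipode k (A j) • ε i))) ((B j • φ i) * ξ) := by
        simp only [braidedLoop, braidingInv_sum_tmul hR hAB, antipodeInvSq_of_inverse hSTD hTSD,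
          map_sum, TensorProduct.map_tmul, LinearMap.comp_apply, LinearMap.mulLeft_apply,
          LinearMap.mulRight_apply, TensorProduct.lift.tmul]
    _ = ∑ j, ∑ i, sweedler k (φ i * ξ) fun y₁ y₂ =>
          φ.coord i (B j • antipode k (antipode k (A j)) • TX (TX y₁)) • p σ y₂ := by
        simp only [pairing_eq_sweedler]
        exact Finset.sum_congr rfl fun j _ => sum_sweedler_apply_mul_coord_smul φ
          (Algebra.lsmul k k X (B j)) ξ
          (f := fun z => antipode k (antipode k (A j)) • TX (TX z)) (h := fun z => p σ z)
    _ = ∑ i, sweedler k (φ i * ξ) fun y₁ y₂ => φ.coord i (θ y₁) • p σ y₂ := by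
        rw [Finset.sum_comm]
        simp only [← sweedler_sum, ← Finset.sum_smul]
        simp only [hθ, twist_apply, drinfeldInv, Finset.sum_smul, mul_smul, map_sum]
    _ = p σ (traceElement θ φ ξ) := by
        simp only [traceElement, map_sum, apply_sweedler _ _ (p σ).isLinear, map_smul]

theorem exists_left_integral_pairing_eq :
    ∃ P : X, (∀ σ, p σ P = braidedTraceDual R p (∑ i, φ i ⊗ₜ[k] ε i) SX σ) ∧
      ∀ y, P * y = counit (R := k) y • P := by
  obtain ⟨P, hP⟩ := exists_pairing_eq hdual (braidedTraceDual R p (∑ i, φ i ⊗ₜ[k] ε i) SX)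
  refine ⟨P, hP, fun y => eq_of_forall_pairing_eq hdual fun σ => ?_⟩
  have : FiniteDimensional k D := .of_basis ε
  have integral := hD.sweedler_twistedTrace hR hAB hSTD hTSD σ
  simp only [← hp.braidedTraceDual_apply hR hAB hX hD hSTX hTSX hSTD hTSD hdual, ← hP] at integral
  calc p σ (P * y) = p (sweedler k σ fun σ₁ σ₂ => p σ₂ P • σ₁) y := by
        rw [hp.apply_mul_right, apply_sweedler _ _ (f := fun σ => p σ y)]
        simp only [map_smul, LinearMap.smul_apply, smul_eq_mul, mul_comm]
    _ = p σ (counit (R := k) y • P) := by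
        simp only [integral, map_smul, LinearMap.smul_apply, hp.one_left, smul_eq_mul, mul_comm]

theorem braidedTraceDual_mul_braidedTrace (σ : D) (ξ : X) :
    braidedTraceDual R p (∑ i, φ i ⊗ₜ[k] ε i) SX σ * braidedTrace R p (∑ i, φ i ⊗ₜ[k] ε i) SD ξ =
      braidedTrace R p (∑ i, φ i ⊗ₜ[k] ε i) SD 1 *
        braidedLoop R p (∑ i, φ i ⊗ₜ[k] ε i) SD σ ξ := by
  obtain ⟨P, hP, P_mul⟩ :=
    hp.exists_left_integral_pairing_eq hR hAB hX hD hSTX hTSX hSTD hTSD hdual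
  set Λ := traceElement (twist (drinfeldInv k A B) TX) φ ξ with hΛ
  -- The product of the two elements is evaluated from either side.
  have integral_eq : counit (R := k) Λ • P = counit (R := k) P • Λ := by
    rw [← P_mul, hX.mul_traceElement hR hAB hSTX hTSX φ P ξ]
  rw [hp.braidedTrace_one_eq hX hD hSTX hTSX hSTD hTSD,
    hp.braidedLoop_apply hR hAB hX hD hSTX hSTD hTSD hdual,
    hp.braidedTrace_apply hR hAB hX hD hSTX hSTD hTSD hdual, ← counit_traceElement φ, ← hP, ← hP,
    hp.one_left, ← hΛ]
  simpa only [map_smul, smul_eq_mul, mul_comm] using congrArg (p σ) integral_eq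

theorem isInvariantIntegral_braidedTrace :
    IsInvariantIntegral (braidedTrace R p (∑ i, φ i ⊗ₜ[k] ε i) SD) := by
  have : FiniteDimensional k X := .of_basis φ
  intro ξ
  simp only [hp.braidedTrace_apply hR hAB hX hD hSTX hSTD hTSD hdual,
    ← hX.sweedler_twistedTrace hR hAB hSTX hTSX ξ, comul_eq_sweedler ξ, sweedler, map_sum,
    LinearMap.lTensor_tmul, TensorProduct.rid_tmul]

end IsBraidedDualPairing

end DualPairing

section MinimalTensor

variable {k V W M : Type*} [Field k] [AddCommGroup V] [Module k V] [AddCommGroup W] [Module k W]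
  [AddCommMonoid M] [Module k M]

theorem exists_lt_sum_tmul_eq_of_not_linearIndependent {n : ℕ} {A : Fin n → V}
    (B : Fin n → W) (h : ¬ LinearIndependent k A) :
    ∃ (m : ℕ) (A' : Fin m → V) (B' : Fin m → W), m < n ∧
      ∑ i, A i ⊗ₜ[k] B i = ∑ i, A' i ⊗ₜ[k] B' i := by
  obtain ⟨g, relation, i, hi⟩ := Fintype.not_linearIndependent_iff.1 h
  obtain ⟨m, rfl⟩ : ∃ m, n = m + 1 := ⟨n - 1, by have := i.2; omega⟩
  refine ⟨m, fun j => A (i.succAbove j), fun j => B (i.succAbove j) -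
    ((g i)⁻¹ * g (i.succAbove j)) • B i, m.lt_succ_self, ?_⟩
  have correction_eq_zero : ∑ j, A j ⊗ₜ[k] (((g i)⁻¹ * g j) • B i) = 0 := by
    calc _ = (∑ j, g j • A j) ⊗ₜ[k] ((g i)⁻¹ • B i) := by
          rw [sum_tmul]
          refine Finset.sum_congr rfl fun j _ => ?_
          rw [smul_tmul, smul_smul, mul_comm]
      _ = 0 := by rw [relation, zero_tmul]
  calc ∑ j, A j ⊗ₜ[k] B j = ∑ j, A j ⊗ₜ[k] (B j - ((g i)⁻¹ * g j) • B i) := by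
        simp only [tmul_sub, Finset.sum_sub_distrib, correction_eq_zero, sub_zero]
    _ = _ := by
        rw [Fin.sum_univ_succAbove _ i, inv_mul_cancel₀ hi, one_smul, sub_self, tmul_zero, zero_add]

theorem exists_linearIndependent_eq_sum_tmul (x : V ⊗[k] W) :
    ∃ (n : ℕ) (A : Fin n → V) (B : Fin n → W), x = ∑ i, A i ⊗ₜ[k] B i ∧
      LinearIndependent k A ∧ LinearIndependent k B := by
  classical
  have exists_expansion := TensorProduct.exists_sum_tmul_eq x
  obtain ⟨A, B, hAB⟩ := Nat.find_spec exists_expansion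
  refine ⟨Nat.find exists_expansion, A, B, hAB, ?_, ?_⟩
  · by_contra h
    obtain ⟨m, A', B', hm, h'⟩ := exists_lt_sum_tmul_eq_of_not_linearIndependent B h
    exact Nat.find_min exists_expansion hm ⟨A', B', hAB.trans h'⟩
  · by_contra h
    obtain ⟨m, B', A', hm, h'⟩ := exists_lt_sum_tmul_eq_of_not_linearIndependent A h
    refine Nat.find_min exists_expansion hm ⟨A', B', hAB.trans ?_⟩
    simpa only [map_sum, TensorProduct.comm_tmul] using
      congrArg (TensorProduct.comm k W V) h'

theorem exists_forall_sum_apply_smul_eq {I : Type*} [Fintype I] {v : I → V}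
    (hv : LinearIndependent k v) (i : I) :
    ∃ f : V →ₗ[k] k, ∀ w : I → M, ∑ j, f (v j) • w j = w i := by
  classical
  obtain ⟨f, hf⟩ := LinearMap.exists_extend ((Finsupp.lapply i : (I →₀ k) →ₗ[k] k) ∘ₗ hv.repr)
  have f_apply (j : I) : f (v j) = (Finsupp.single j (1 : k)) i := by
    rw [← hv.repr_eq_single j ⟨v j, Submodule.subset_span ⟨j, rfl⟩⟩ rfl]
    exact LinearMap.congr_fun hf ⟨v j, Submodule.subset_span ⟨j, rfl⟩⟩
  exact ⟨f, fun w => by simp [f_apply, Finsupp.single_apply]⟩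

theorem map_mem_of_le_map {W : Submodule k V} [FiniteDimensional k W] {f : V →ₗ[k] V}
    (h : W ≤ W.map f) {x : V} (hx : x ∈ W) : f x ∈ W := by
  have eq_map : W = W.map f := Submodule.eq_of_le_of_finrank_le h (Submodule.finrank_map_le f W)
  rw [eq_map]
  exact Submodule.mem_map_of_mem hx

end MinimalTensor

section GroupLikeFiniteOrder

theorem exists_ne_eq_of_isGroupLikeElem {k C : Type*} [Field k] [AddCommGroup C] [Module k C]
    [Coalgebra k C] {W : Submodule k C} [FiniteDimensional k W] {f : ℕ → C}
    (hf : ∀ n, IsGroupLikeElem k (f n)) (hW : ∀ n, f n ∈ W) : ∃ m n, m < n ∧ f m = f n := by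
  by_contra! h
  have injective : Function.Injective f := fun m n hmn =>
    by_contra fun hne => (Nat.lt_or_gt_of_ne hne).elim (h m n · hmn) (h n m · hmn.symm)
  have linearIndependent : LinearIndependent k f :=
    (linearIndepOn_isGroupLikeElem (R := k) (A := C)).linearIndependent.comp
      (fun n => (⟨f n, hf n⟩ : {a : C | IsGroupLikeElem k a}))
      fun m n hmn => injective (congrArg Subtype.val hmn)
  have linearIndependent_in_W : LinearIndependent k fun n => (⟨f n, hW n⟩ : W) :=
    .of_comp W.subtype linearIndependent
  exact Set.infinite_univ (Set.finite_univ_iff.2 linearIndependent_in_W.finite)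

theorem exists_pow_eq_one_of_isGroupLikeElem {k U : Type*} [Field k] [Ring U] [HopfAlgebra k U]
    {W : Submodule k U} [FiniteDimensional k W] (hW : W * W ≤ W) {w : U}
    (hw : IsGroupLikeElem k w) (hwW : w ∈ W) : ∃ n, 0 < n ∧ w ^ n = 1 := by
  have pow_mem (n : ℕ) : w ^ (n + 1) ∈ W := by
    induction n with
    | zero => simpa using hwW
    | succ n ih => rw [pow_succ]; exact hW (Submodule.mul_mem_mul ih hwW)
  obtain ⟨a, b, hab, h⟩ := exists_ne_eq_of_isGroupLikeElem (fun n => hw.pow (n := n + 1)) pow_mem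
  refine ⟨b - a, by omega, (hw.isUnit.pow (a + 1)).mul_left_cancel ?_⟩
  rw [← pow_add, mul_one, show a + 1 + (b - a) = b + 1 by omega, ← h]

end GroupLikeFiniteOrder

section RMatrixGroupLike

open Coalgebra HopfAlgebra

theorem sweedler_mem {k C M : Type*} [CommSemiring k] [AddCommMonoid C] [Module k C]
    [Coalgebra k C] [AddCommMonoid M] [Module k M] {W : Submodule k M} (x : C) {E : C → C → M}
    (h : ∀ a b, E a b ∈ W) : sweedler k x E ∈ W :=
  Submodule.sum_mem _ fun _ _ => h _ _

variable {k U M : Type*} [Field k] [Ring U] [HopfAlgebra k U] [AddCommMonoid M] [Module k M]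

namespace IsUniversalRMatrix

variable {R : (U ⊗[k] U)ˣ} (hR : IsUniversalRMatrix R) {I : Type*} [Fintype I] {A B : I → U}
  (hAB : (R : U ⊗[k] U) = ∑ i, A i ⊗ₜ[k] B i)

/-- The group-like element `S(u)⁻¹ u`, where `u` is Drinfeld's element. It measures how far
`u` is from being fixed by the antipode. -/
noncomputable def drinfeldGroupLike (k : Type*) {U I : Type*} [Field k] [Ring U] [HopfAlgebra k U]
    [Fintype I] (A B : I → U) : U :=
  antipode k (drinfeldInv k A B) * drinfeld k A B

include hR hAB

theorem comul_drinfeldInv : comul (R := k) (drinfeldInv k A B) =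
    TensorProduct.comm k U U (R : U ⊗[k] U) * (R : U ⊗[k] U) *
      (drinfeldInv k A B ⊗ₜ[k] drinfeldInv k A B) := by
  rw [comul_eq_sweedler, sweedler_drinfeldInv hR hAB _, hAB]
  simp only [map_sum, TensorProduct.comm_tmul, Finset.sum_mul_sum]
  simp only [Finset.sum_mul, Algebra.TensorProduct.tmul_mul_tmul]

theorem drinfeldInv_tmul_mul_comm :
    (drinfeldInv k A B ⊗ₜ[k] drinfeldInv k A B) * (R : U ⊗[k] U) =
    (R : U ⊗[k] U) * (drinfeldInv k A B ⊗ₜ[k] drinfeldInv k A B) := by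
  set q := drinfeldInv k A B with hq
  rw [hAB, Finset.mul_sum, Finset.sum_mul]
  simp only [Algebra.TensorProduct.tmul_mul_tmul]
  rw [← sum_antipode_antipode hR hAB fun s t => (q * s) ⊗ₜ[k] (q * t),
    ← sum_antipode_antipode hR hAB fun s t =>
      (q * antipode k s) ⊗ₜ[k] (q * antipode k t)]
  simp only [hq, drinfeldInv_mul_antipode_antipode hR hAB]

theorem comul_drinfeldInv_eq_tmul_mul : comul (R := k) (drinfeldInv k A B) =
    (drinfeldInv k A B ⊗ₜ[k] drinfeldInv k A B) *
      (TensorProduct.comm k U U (R : U ⊗[k] U) * (R : U ⊗[k] U)) := by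
  have comm_op : (drinfeldInv k A B ⊗ₜ[k] drinfeldInv k A B) * TensorProduct.comm k U U R =
      TensorProduct.comm k U U R * (drinfeldInv k A B ⊗ₜ[k] drinfeldInv k A B) := by
    have h := congrArg (Algebra.TensorProduct.comm k U U) (drinfeldInv_tmul_mul_comm hR hAB)
    rwa [map_mul, map_mul, Algebra.TensorProduct.comm_tmul] at h
  rw [comul_drinfeldInv hR hAB, mul_assoc, ← drinfeldInv_tmul_mul_comm hR hAB, ← mul_assoc,
    ← comm_op, mul_assoc]

theorem comul_antipode_drinfeldInv : comul (R := k) (antipode k (drinfeldInv k A B)) =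
    (antipode k (drinfeldInv k A B) ⊗ₜ[k] antipode k (drinfeldInv k A B)) *
      (TensorProduct.comm k U U (R : U ⊗[k] U) * (R : U ⊗[k] U)) := by
  have op_eq : TensorProduct.comm k U U R = ∑ i, antipode k (B i) ⊗ₜ[k] antipode k (A i) := by
    rw [sum_antipode_antipode hR hAB (fun a b => b ⊗ₜ[k] a), hAB]
    simp only [map_sum, TensorProduct.comm_tmul]
  rw [op_eq, hAB, ← antipode_tmul_antipode hR hAB, comul_antipode,
    sweedler_drinfeldInv hR hAB fun a b => antipode k b ⊗ₜ[k] antipode k a,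
    Finset.sum_comm]
  simp only [Finset.sum_mul_sum]
  simp only [Finset.mul_sum, antipode_mul_antidistrib, Algebra.TensorProduct.tmul_mul_tmul]

theorem drinfeldGroupLike_mul_drinfeldInv :
    drinfeldGroupLike k A B * drinfeldInv k A B = antipode k (drinfeldInv k A B) := by
  rw [drinfeldGroupLike, mul_assoc, drinfeld_mul_drinfeldInv hR hAB, mul_one]

theorem isGroupLikeElem_drinfeldGroupLike : IsGroupLikeElem k (drinfeldGroupLike k A B) where
  counit_eq_one := by
    have h := congrArg (counit (R := k)) (drinfeldGroupLike_mul_drinfeldInv hR hAB)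
    rwa [Bialgebra.counit_mul, HopfAlgebra.counit_antipode, counit_drinfeldInv hR hAB,
      mul_one] at h
  comul_eq_tmul_self := by
    set w := drinfeldGroupLike k A B
    have comul_inv : comul (R := k) (drinfeldInv k A B) * comul (R := k) (drinfeld k A B) = 1 := by
      rw [← Bialgebra.comul_mul, drinfeldInv_mul_drinfeld hR hAB, Bialgebra.comul_one]
    have mul_comul_eq : (w ⊗ₜ[k] w) * comul (R := k) (drinfeldInv k A B) =
        comul (R := k) w * comul (R := k) (drinfeldInv k A B) := by
      rw [← Bialgebra.comul_mul, drinfeldGroupLike_mul_drinfeldInv hR hAB,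
        comul_antipode_drinfeldInv hR hAB, comul_drinfeldInv_eq_tmul_mul hR hAB, ← mul_assoc,
        Algebra.TensorProduct.tmul_mul_tmul, drinfeldGroupLike_mul_drinfeldInv hR hAB]
    simpa only [mul_assoc, comul_inv, mul_one] using
      (congrArg (· * comul (R := k) (drinfeld k A B)) mul_comul_eq).symm

theorem antipode_injective : Function.Injective (antipode k : U →ₗ[k] U) := by
  rw [injective_iff_map_eq_zero]
  intro x hx
  have h := antipode_antipode_mul_drinfeld hR hAB x
  rw [hx, map_zero, zero_mul] at h
  rw [← one_mul x, ← drinfeldInv_mul_drinfeld hR hAB, mul_assoc, ← h, mul_zero]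

section LinearIndependentLegs

variable (hA : LinearIndependent k A) (hB : LinearIndependent k B)

-- The inclusions below are read off identities between tensors: applying a functional dual to
-- one leg isolates a single term on one side and lands in the span of the other leg on the other.

include hA in
theorem span_right_mul_le :
    Submodule.span k (Set.range B) * Submodule.span k (Set.range B) ≤
      Submodule.span k (Set.range B) := by
  rw [Submodule.span_mul_span, Submodule.span_le]
  rintro _ ⟨_, ⟨i, rfl⟩, _, ⟨j, rfl⟩, rfl⟩
  obtain ⟨f, hf⟩ := exists_forall_sum_apply_smul_eq (M := U) hA i
  obtain ⟨g, hg⟩ := exists_forall_sum_apply_smul_eq (M := U) hA j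
  have mul_eq : (∑ l, sweedler k (A l) fun s t => f s • g t • B l) = B i * B j := by
    rw [hexagon_left hR hAB fun s t z => f s • g t • z]
    simp only [← Finset.smul_sum, hg, hf]
  change B i * B j ∈ _
  rw [← mul_eq]
  exact Submodule.sum_mem _ fun l _ => sweedler_mem _ fun s t => Submodule.smul_mem _ _
    (Submodule.smul_mem _ _ (Submodule.subset_span ⟨l, rfl⟩))

include hB in
theorem span_left_mul_le :
    Submodule.span k (Set.range A) * Submodule.span k (Set.range A) ≤
      Submodule.span k (Set.range A) := by
  rw [Submodule.span_mul_span, Submodule.span_le]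
  rintro _ ⟨_, ⟨i, rfl⟩, _, ⟨j, rfl⟩, rfl⟩
  obtain ⟨f, hf⟩ := exists_forall_sum_apply_smul_eq (M := U) hB i
  obtain ⟨g, hg⟩ := exists_forall_sum_apply_smul_eq (M := U) hB j
  have mul_eq : (∑ l, sweedler k (B l) fun s t => f t • g s • A l) = A i * A j := by
    rw [hexagon_right hR hAB fun z s t => f t • g s • z]
    simp only [← Finset.smul_sum, hg, hf]
  change A i * A j ∈ _
  rw [← mul_eq]
  exact Submodule.sum_mem _ fun l _ => sweedler_mem _ fun s t => Submodule.smul_mem _ _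
    (Submodule.smul_mem _ _ (Submodule.subset_span ⟨l, rfl⟩))

include hB in
theorem antipode_left_mem {x : U} (hx : x ∈ Submodule.span k (Set.range A)) :
    antipode k x ∈ Submodule.span k (Set.range A) := by
  have : FiniteDimensional k (Submodule.span k (Set.range A)) :=
    FiniteDimensional.span_of_finite k (Set.finite_range A)
  refine map_mem_of_le_map (f := antipode k) (Submodule.span_le.2 ?_) hx
  rintro _ ⟨i, rfl⟩
  obtain ⟨f, hf⟩ := exists_forall_sum_apply_smul_eq (M := U) hB i
  rw [← hf A, ← sum_antipode_antipode hR hAB fun s t => f t • s]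
  exact Submodule.sum_mem _ fun j _ => Submodule.smul_mem _ _
    (Submodule.mem_map_of_mem (Submodule.subset_span ⟨j, rfl⟩))

include hA in
theorem antipode_right_mem {x : U} (hx : x ∈ Submodule.span k (Set.range B)) :
    antipode k x ∈ Submodule.span k (Set.range B) := by
  have : FiniteDimensional k (Submodule.span k (Set.range B)) :=
    FiniteDimensional.span_of_finite k (Set.finite_range B)
  refine map_mem_of_le_map (f := antipode k) (Submodule.span_le.2 ?_) hx
  rintro _ ⟨i, rfl⟩
  obtain ⟨f, hf⟩ := exists_forall_sum_apply_smul_eq (M := U) hA i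
  rw [← hf B, ← sum_antipode_antipode hR hAB fun s t => f s • t]
  exact Submodule.sum_mem _ fun j _ => Submodule.smul_mem _ _
    (Submodule.mem_map_of_mem (Submodule.subset_span ⟨j, rfl⟩))

-- The Yang–Baxter equation solved for `R₃₂ (S ⊗ id)(R)₁₃`, with `(S ⊗ id) R = R⁻¹`.
theorem sum_sum_antipode_eq_sum_sum_sum_sum (E : U → U → U → M)
    (h₁ : ∀ b c, IsLinearMap k fun a => E a b c := by fun_prop)
    (h₂ : ∀ a c, IsLinearMap k fun b => E a b c := by fun_prop)
    (h₃ : ∀ a b, IsLinearMap k fun c => E a b c := by fun_prop) :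
    ∑ i, ∑ j, E (antipode k (A i)) (B j) (A j * B i) =
      ∑ m, ∑ l, ∑ j, ∑ i, E (antipode k (A i) * antipode k (A j) * A m)
        (B i * B l * B m) (B j * A l) := by
  let place₁₂ (a b : U) : (U ⊗[k] U) ⊗[k] U := (a ⊗ₜ b) ⊗ₜ 1
  let place₁₃ (a b : U) : (U ⊗[k] U) ⊗[k] U := (a ⊗ₜ 1) ⊗ₜ b
  let R₁₂ := ∑ i, place₁₂ (A i) (B i)
  let R₁₃ := ∑ i, place₁₃ (A i) (B i)
  let R₃₂ : (U ⊗[k] U) ⊗[k] U := ∑ i, (1 ⊗ₜ B i) ⊗ₜ A i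
  let Q₁₂ := ∑ i, place₁₂ (antipode k (A i)) (B i)
  let Q₁₃ := ∑ i, place₁₃ (antipode k (A i)) (B i)
  have yang_baxter_tensor : R₁₃ * R₁₂ * R₃₂ = R₃₂ * R₁₂ * R₁₃ := by
    have h := yang_baxter hR hAB (fun a b c => (a ⊗ₜ[k] b) ⊗ₜ[k] c)
    simp only [R₁₃, R₁₂, R₃₂, place₁₂, place₁₃, Finset.sum_mul, Finset.mul_sum,
      Algebra.TensorProduct.tmul_mul_tmul, one_mul, mul_one]
    exact ((sum_sum_sum_rotate _).trans (Finset.sum_congr rfl fun _ _ => Finset.sum_comm)).trans h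
  have left_inv₁₂ : Q₁₂ * R₁₂ = 1 := by
    simpa [Q₁₂, R₁₂, place₁₂, Finset.sum_mul_sum, Algebra.TensorProduct.one_def] using
      sum_antipode_mul_self hR hAB place₁₂
  have left_inv₁₃ : Q₁₃ * R₁₃ = 1 := by
    simpa [Q₁₃, R₁₃, place₁₃, Finset.sum_mul_sum, Algebra.TensorProduct.one_def] using
      sum_antipode_mul_self hR hAB place₁₃
  have right_inv₁₃ : R₁₃ * Q₁₃ = 1 := by
    simpa [Q₁₃, R₁₃, place₁₃, Finset.sum_mul_sum, Algebra.TensorProduct.one_def] using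
      sum_self_mul_antipode hR hAB place₁₃
  have solved : R₃₂ * Q₁₃ = Q₁₂ * Q₁₃ * R₃₂ * R₁₂ := by
    calc R₃₂ * Q₁₃ = Q₁₂ * (Q₁₃ * R₁₃) * (R₁₂ * R₃₂) * Q₁₃ := by
          rw [left_inv₁₃, mul_one, ← mul_assoc Q₁₂, left_inv₁₂, one_mul]
      _ = Q₁₂ * Q₁₃ * (R₁₃ * R₁₂ * R₃₂) * Q₁₃ := by simp only [mul_assoc]
      _ = Q₁₂ * Q₁₃ * R₃₂ * R₁₂ * (R₁₃ * Q₁₃) := by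
          rw [yang_baxter_tensor]; simp only [mul_assoc]
      _ = _ := by rw [right_inv₁₃, mul_one]
  have h := congrArg (trilinearLift E h₁ h₂ h₃) solved
  simpa only [R₁₃, R₁₂, R₃₂, Q₁₂, Q₁₃, place₁₂, place₁₃, Finset.sum_mul, Finset.mul_sum, map_sum,
    Algebra.TensorProduct.tmul_mul_tmul, trilinearLift_tmul, one_mul, mul_one] using h

include hA hB in
theorem span_left_mul_span_right_le :
    Submodule.span k (Set.range A) * Submodule.span k (Set.range B) ≤
      Submodule.span k (Set.range B) * Submodule.span k (Set.range A) := by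
  rw [Submodule.span_mul_span, Submodule.span_le]
  rintro _ ⟨_, ⟨i, rfl⟩, _, ⟨j, rfl⟩, rfl⟩
  have antipode_linearIndependent : LinearIndependent k fun i => antipode k (A i) :=
    hA.map' (antipode k) (LinearMap.ker_eq_bot.2 (antipode_injective hR hAB))
  obtain ⟨f, hf⟩ := exists_forall_sum_apply_smul_eq (M := U) antipode_linearIndependent j
  obtain ⟨g, hg⟩ := exists_forall_sum_apply_smul_eq (M := U) hB i
  have isolated : ∑ a, ∑ b, f (antipode k (A a)) • g (B b) • (A b * B a) = A i * B j := by
    simp only [← Finset.smul_sum, hg, hf]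
  change A i * B j ∈ _
  rw [← isolated, sum_sum_antipode_eq_sum_sum_sum_sum hR hAB fun a b c => f a • g b • c]
  exact Submodule.sum_mem _ fun _ _ => Submodule.sum_mem _ fun c _ => Submodule.sum_mem _
    fun b _ => Submodule.sum_mem _ fun _ _ => Submodule.smul_mem _ _ (Submodule.smul_mem _ _
      (Submodule.mul_mem_mul (Submodule.subset_span ⟨b, rfl⟩) (Submodule.subset_span ⟨c, rfl⟩)))

include hA hB in
theorem span_mul_span_mul_le :
    Submodule.span k (Set.range B) * Submodule.span k (Set.range A) *
        (Submodule.span k (Set.range B) * Submodule.span k (Set.range A)) ≤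
      Submodule.span k (Set.range B) * Submodule.span k (Set.range A) := by
  set VA := Submodule.span k (Set.range A)
  set VB := Submodule.span k (Set.range B)
  calc VB * VA * (VB * VA) = VB * (VA * VB) * VA := by simp only [mul_assoc]
    _ ≤ VB * (VB * VA) * VA :=
        mul_le_mul' (mul_le_mul' le_rfl (span_left_mul_span_right_le hR hAB hA hB)) le_rfl
    _ = (VB * VB) * (VA * VA) := by simp only [mul_assoc]
    _ ≤ VB * VA :=
        mul_le_mul' (span_right_mul_le hR hAB hA) (span_left_mul_le hR hAB hB)

include hA hB in
theorem drinfeldGroupLike_mem : drinfeldGroupLike k A B ∈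
    Submodule.span k (Set.range B) * Submodule.span k (Set.range A) := by
  have left_mem (i) : A i ∈ Submodule.span k (Set.range A) := Submodule.subset_span ⟨i, rfl⟩
  have right_mem (i) : B i ∈ Submodule.span k (Set.range B) := Submodule.subset_span ⟨i, rfl⟩
  have antipode_left {x} := antipode_left_mem hR hAB hB (x := x)
  have antipode_right {x} := antipode_right_mem hR hAB hA (x := x)
  refine span_mul_span_mul_le hR hAB hA hB (Submodule.mul_mem_mul ?_ ?_)
  · rw [drinfeldInv, map_sum]
    refine Submodule.sum_mem _ fun i _ => ?_
    rw [antipode_mul_antidistrib]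
    exact span_left_mul_span_right_le hR hAB hA hB (Submodule.mul_mem_mul
      (antipode_left (antipode_left (antipode_left (left_mem i)))) (antipode_right (right_mem i)))
  · exact Submodule.sum_mem _ fun i _ =>
      Submodule.mul_mem_mul (antipode_right (right_mem i)) (left_mem i)

end LinearIndependentLegs

omit hR hAB in
theorem drinfeldGroupLike_congr {J : Type*} [Fintype J] {A' B' : J → U}
    (h : ∑ i, A i ⊗ₜ[k] B i = ∑ j, A' j ⊗ₜ[k] B' j) :
    drinfeldGroupLike k A B = drinfeldGroupLike k A' B' := by
  have drinfeld_eq : drinfeld k A B = drinfeld k A' B' := by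
    have h' := congrArg (bilinearLift fun a b => antipode k b * a) h
    rwa [map_sum, map_sum] at h'
  have drinfeldInv_eq : drinfeldInv k A B = drinfeldInv k A' B' := by
    have h' := congrArg (bilinearLift fun a b => b * antipode k (antipode k a)) h
    rwa [map_sum, map_sum] at h'
  rw [drinfeldGroupLike, drinfeldGroupLike, drinfeld_eq, drinfeldInv_eq]

theorem exists_drinfeldGroupLike_pow_eq_one :
    ∃ n, 0 < n ∧ drinfeldGroupLike k A B ^ n = 1 := by
  obtain ⟨m, A', B', hAB', hA, hB⟩ := exists_linearIndependent_eq_sum_tmul (R : U ⊗[k] U)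
  rw [drinfeldGroupLike_congr (hAB.symm.trans hAB')]
  have finiteDimensional : FiniteDimensional k
      ↥(Submodule.span k (Set.range B') * Submodule.span k (Set.range A')) :=
    Module.Finite.iff_fg.2 (Submodule.FG.mul
      (Submodule.fg_span (Set.finite_range B')) (Submodule.fg_span (Set.finite_range A')))
  exact exists_pow_eq_one_of_isGroupLikeElem (span_mul_span_mul_le hR hAB' hA hB)
    (isGroupLikeElem_drinfeldGroupLike hR hAB') (drinfeldGroupLike_mem hR hAB' hA hB)

end IsUniversalRMatrix
end RMatrixGroupLike

section TraceIntegralUniqueness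

open Coalgebra HopfAlgebra IsUniversalRMatrix

variable {k U M : Type*} [Field k] [Ring U] [HopfAlgebra k U] [AddCommMonoid M] [Module k M]

theorem sweedler_of_isGroupLikeElem {C : Type*} [AddCommMonoid C] [Module k C] [Coalgebra k C]
    {g : C} (hg : IsGroupLikeElem k g) (E : C → C → M)
    (h₁ : ∀ b, IsLinearMap k fun a => E a b := by fun_prop)
    (h₂ : ∀ a, IsLinearMap k fun b => E a b := by fun_prop) : sweedler k g E = E g g := by
  rw [sweedler_eq_bilinearLift g E h₁ h₂, hg.comul_eq_tmul_self, bilinearLift_tmul]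

theorem isGroupLikeElem_of_sweedler_apply_smul_eq {C : Type*} [AddCommMonoid C] [Module k C]
    [Coalgebra k C] {t : C →ₗ[k] k} {g Λ : C}
    (h : ∀ x, (sweedler k x fun a b => t a • b) = t x • g) (htΛ : t Λ = 1) :
    IsGroupLikeElem k g := by
  have g_eq : g = sweedler k Λ fun a b => t a • b := by rw [h, htΛ, one_smul]
  refine ⟨?_, ?_⟩
  · rw [g_eq, apply_sweedler _ _ (LinearMap.isLinear _)]
    simp only [map_smul, smul_eq_mul, mul_comm (t _)]
    exact (sweedler_counit_right Λ (f := fun a => t a)).trans htΛ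
  · calc comul (R := k) g
        = sweedler k Λ fun a c => sweedler k c fun b d => t a • b ⊗ₜ[k] d := by
          rw [g_eq, apply_sweedler _ _ (LinearMap.isLinear _)]
          congr! 3 with a c
          rw [map_smul, comul_eq_sweedler, smul_sweedler]
      _ = sweedler k Λ fun c d => sweedler k c fun a b => t a • b ⊗ₜ[k] d :=
          (sweedler_coassoc Λ fun a b d => t a • b ⊗ₜ[k] d).symm
      _ = sweedler k Λ fun c d => g ⊗ₜ[k] (t c • d) := by
          congr! 3 with c d
          rw [← smul_tmul, ← h, apply_sweedler (f := fun v => v ⊗ₜ[k] d)]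
          simp only [smul_tmul']
      _ = g ⊗ₜ[k] g := by
          rw [← apply_sweedler (f := fun v => g ⊗ₜ[k] v), ← g_eq]

theorem IsUniversalRMatrix.antipode_antipode_drinfeld {R : (U ⊗[k] U)ˣ}
    (hR : IsUniversalRMatrix R) {I : Type*} [Fintype I] {A B : I → U}
    (hAB : (R : U ⊗[k] U) = ∑ i, A i ⊗ₜ[k] B i) :
    antipode k (antipode k (drinfeld k A B)) = drinfeld k A B := by
  have h := congrArg (· * drinfeldInv k A B)
    (hR.antipode_antipode_mul_drinfeld hAB (drinfeld k A B))
  simpa only [mul_assoc, hR.drinfeld_mul_drinfeldInv hAB, mul_one] using h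

namespace IsBraidedHopfAlgebra

variable {R : (U ⊗[k] U)ˣ} {Y : Type*} [Ring Y] [Algebra k Y] [Coalgebra k Y] [Module U Y]
  [IsScalarTower k U Y] {S : Y →ₗ[k] Y} (hY : IsBraidedHopfAlgebra R S)
  (hR : IsUniversalRMatrix R) {I : Type*} [Fintype I] {A B : I → U}
  (hAB : (R : U ⊗[k] U) = ∑ i, A i ⊗ₜ[k] B i)

section InvariantGroupLike

include hY

theorem smul_mul_of_invariant {g : Y} (hg : ∀ h : U, h • g = counit (R := k) h • g) (h : U)
    (x : Y) : h • (x * g) = (h • x) * g := by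
  rw [hY.act_mul]
  simp only [hg, mul_smul_comm]
  exact sweedler_counit_right h (f := fun s => (s • x) * g)

include hR hAB

theorem sweedler_mul_isGroupLikeElem {g : Y} (hg : ∀ h : U, h • g = counit (R := k) h • g)
    (hg' : IsGroupLikeElem k g) (x : Y) (E : Y → Y → M)
    (h₁ : ∀ b, IsLinearMap k fun a => E a b := by fun_prop)
    (h₂ : ∀ a, IsLinearMap k fun b => E a b := by fun_prop) :
    sweedler k (x * g) E = sweedler k x fun a b => E (a * g) (b * g) := by
  rw [hY.sweedler_mul hAB x g E h₁ h₂]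
  simp only [fun i a b => sweedler_of_isGroupLikeElem hg' fun c d =>
    E (a * (B i • c)) ((A i • b) * d), hg, mul_smul_comm]
  rw [← sweedler_sum]
  congr! 3 with a b
  simp only [fun i => (h₁ ((A i • b) * g)).map_smul]
  conv_rhs => rw [← one_smul U b, ← hR.counit_right hAB, Finset.sum_smul, Finset.sum_mul]
  simp only [smul_assoc, smul_mul_assoc]
  exact ((map_sum_of_isLinearMap _ _ (h₂ (a * g))).trans
    (Finset.sum_congr rfl fun i _ => (h₂ _).map_smul _ _)).symm

theorem exists_pow_eq_one_of_isGroupLikeElem [FiniteDimensional k Y] {g g' : Y}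
    (hg : ∀ h : U, h • g = counit (R := k) h • g) (hg' : IsGroupLikeElem k g)
    (left_inv : g' * g = 1) : ∃ n, 0 < n ∧ g ^ n = 1 := by
  have isGroupLikeElem_pow (n : ℕ) : IsGroupLikeElem k (g ^ n) := by
    induction n with
    | zero => exact ⟨by simp [hY.counit_one], by simp [hY.comul_one]⟩
    | succ n ih =>
      refine ⟨by rw [pow_succ, hY.counit_mul, ih.counit_eq_one, hg'.counit_eq_one, one_mul], ?_⟩
      rw [pow_succ, comul_eq_sweedler, hY.sweedler_mul_isGroupLikeElem hR hAB hg hg' _ _,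
        sweedler_of_isGroupLikeElem ih _]
  obtain ⟨a, b, hab, h⟩ :=
    exists_ne_eq_of_isGroupLikeElem (W := ⊤) isGroupLikeElem_pow fun _ => trivial
  refine ⟨b - a, by omega, ?_⟩
  have left_inv_pow (n : ℕ) : g' ^ n * g ^ n = 1 := by
    induction n with
    | zero => simp
    | succ n ih => rw [pow_succ, pow_succ', mul_assoc, ← mul_assoc g', left_inv, one_mul, ih]
  calc g ^ (b - a) = g' ^ a * (g ^ a * g ^ (b - a)) := by rw [← mul_assoc, left_inv_pow, one_mul]
    _ = 1 := by rw [← pow_add, show a + (b - a) = b by omega, ← h, left_inv_pow]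

end InvariantGroupLike

variable {T : Y →ₗ[k] Y} (hST : ∀ x, S (T x) = x) (hTS : ∀ x, T (S x) = x)
  [FiniteDimensional k Y]

include hY hR hAB hST hTS

theorem twistedTrace_mul_comm (x y : Y) :
    twistedTrace (twist (drinfeldInv k A B) T) (x * y) =
      twistedTrace (twist (drinfeldInv k A B) T) (twist (drinfeldInv k A B) T y * x) := by
  set θ := twist (drinfeldInv k A B) T with hθ
  calc twistedTrace θ (x * y)
      = LinearMap.trace k Y (LinearMap.mulRight k y ∘ₗ (LinearMap.mulRight k x ∘ₗ θ)) := by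
        rw [twistedTrace_apply]
        congr 1
        ext a
        simp [mul_assoc]
    _ = LinearMap.trace k Y ((LinearMap.mulRight k x ∘ₗ θ) ∘ₗ LinearMap.mulRight k y) :=
        LinearMap.trace_comp_comm' _ _
    _ = _ := by
        rw [twistedTrace_apply]
        congr 1
        ext a
        simp [hθ, hY.twist_mul hR hAB hST hTS, mul_assoc]

theorem twistedTrace_smul_mul (h : U) (x y : Y) :
    twistedTrace (twist (drinfeldInv k A B) T) ((h • x) * y) =
      twistedTrace (twist (drinfeldInv k A B) T) (x * (antipode k h • y)) := by
  rw [hY.mul_antipode_smul, apply_sweedler _ _ (LinearMap.isLinear _)]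
  simp only [hY.twistedTrace_smul hR hAB hST hTS, HopfAlgebra.counit_antipode]
  exact (sweedler_counit_left h (f := fun t =>
    twistedTrace (twist (drinfeldInv k A B) T) ((t • x) * y))).symm

theorem sweedler_twistedTrace_mul (a y : Y) :
    (sweedler k a fun a₁ a₂ => twistedTrace (twist (drinfeldInv k A B) T) (a₂ * y) • S a₁) =
      ∑ i, sweedler k y fun y₁ y₂ =>
        twistedTrace (twist (drinfeldInv k A B) T) ((A i • a) * y₂) • (B i • y₁) := by
  set t := twistedTrace (twist (drinfeldInv k A B) T)
  rw [← hY.sweedler_antipode_sweedler_mul hAB a y (fun p q => t q • p)]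
  congr! 3 with a₁ a₂
  have h := hY.sweedler_twistedTrace hR hAB hST hTS (a₂ * y)
  rw [← mul_one (S a₁), ← mul_smul_comm, ← h,
    apply_sweedler (f := fun v => S a₁ * v)]
  simp only [mul_smul_comm, mul_one]
  rfl

theorem sweedler_tmul_sweedler_twistedTrace_smul (x : Y) :
    (sweedler k x fun a b => a ⊗ₜ[k] sweedler k b fun c d =>
      twistedTrace (twist (drinfeldInv k A B) T) c • d) =
      1 ⊗ₜ sweedler k x fun c d => twistedTrace (twist (drinfeldInv k A B) T) c • d := by
  set t := twistedTrace (twist (drinfeldInv k A B) T) with ht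
  calc _ = sweedler k x fun a c => sweedler k c fun b d => a ⊗ₜ[k] (t b • d) := by
        congr! 3 with a c
        exact apply_sweedler _ _
    _ = sweedler k x fun c d => sweedler k c fun a b => a ⊗ₜ[k] (t b • d) :=
        (sweedler_coassoc x fun a b d => a ⊗ₜ[k] (t b • d)).symm
    _ = sweedler k x fun c d => 1 ⊗ₜ[k] (t c • d) := by
        congr! 3 with c d
        rw [← smul_tmul, ← hY.sweedler_twistedTrace hR hAB hST hTS c,
          apply_sweedler (f := fun v => v ⊗ₜ[k] d)]
        simp only [smul_tmul, ht]
    _ = _ := (apply_sweedler (f := fun v => 1 ⊗ₜ[k] v) _ _).symm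

theorem sweedler_twistedTrace_act (h : U) (x : Y) :
    (sweedler k (h • x) fun a b => twistedTrace (twist (drinfeldInv k A B) T) a • b) =
      h • sweedler k x fun a b => twistedTrace (twist (drinfeldInv k A B) T) a • b := by
  set t := twistedTrace (twist (drinfeldInv k A B) T) with ht
  set y := sweedler k x fun a b => t a • b with hy
  have pull_out (s s' : U) : (sweedler k x fun a b => counit (R := k) s • t a • s' • b) =
      counit (R := k) s • (s' • y) := by
    rw [hy, apply_sweedler (f := fun v => counit (R := k) s • (s' • v))]
    simp only [smul_comm s' (t _)]
  rw [hY.sweedler_act h x _]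
  simp only [ht, hY.twistedTrace_smul hR hAB hST hTS, smul_assoc]
  simp only [← ht, pull_out]
  exact sweedler_counit_left h (f := fun s => s • y)

variable {Λ : Y} (hΛ : ∀ x, x * Λ = counit (R := k) x • Λ)
  (htΛ : twistedTrace (twist (drinfeldInv k A B) T) Λ = 1)

omit hΛ htΛ in
theorem exists_integral (h : twistedTrace (twist (drinfeldInv k A B) T) ≠ 0) :
    ∃ Λ : Y, (∀ x, x * Λ = counit (R := k) x • Λ) ∧
      twistedTrace (twist (drinfeldInv k A B) T) Λ = 1 := by
  set θ := twist (drinfeldInv k A B) T with hθ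
  obtain ⟨y, hy⟩ := DFunLike.ne_iff.1 h
  set P := traceElement θ (Module.finBasis k Y) y
  have mul_P (x : Y) : x * P = counit (R := k) x • P := hY.mul_traceElement hR hAB hST hTS _ x y
  have counit_P : counit (R := k) P = twistedTrace θ y := counit_traceElement _ _ _
  have twistedTrace_P : twistedTrace θ P = twistedTrace θ y := by
    rw [twistedTrace_eq_sum θ (Module.finBasis k Y), ← counit_P]
    simp only [mul_P, hθ, hY.counit_twist hR hAB hST, map_smul, smul_eq_mul]
    rw [← sum_coord_smul_apply (Module.finBasis k Y) P (LinearMap.isLinear (counit (R := k)))]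
    simp only [smul_eq_mul, mul_comm]
  refine ⟨(twistedTrace θ y)⁻¹ • P, fun x => ?_, ?_⟩
  · rw [mul_smul_comm, mul_P, smul_comm]
  · rw [map_smul, twistedTrace_P, smul_eq_mul, inv_mul_cancel₀ hy]

include hΛ htΛ

theorem antipode_eq_sum (a : Y) : S a = ∑ i, sweedler k Λ fun y₁ y₂ =>
    twistedTrace (twist (drinfeldInv k A B) T) ((A i • a) * y₂) • (B i • y₁) := by
  rw [← hY.sweedler_twistedTrace_mul hR hAB hST hTS]
  simp only [hΛ, map_smul, htΛ, smul_eq_mul, mul_one]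
  exact (sweedler_counit_right a (f := fun a => S a)).symm

theorem eq_zero_of_twistedTrace_mul_eq_zero {a : Y}
    (ha : ∀ x, twistedTrace (twist (drinfeldInv k A B) T) (a * x) = 0) : a = 0 := by
  have h := hY.antipode_eq_sum hR hAB hST hTS hΛ htΛ a
  simp only [hY.twistedTrace_smul_mul hR hAB hST hTS, ha, zero_smul] at h
  rw [← hTS a, h]
  simp [sweedler]

theorem eq_twistedTrace_smul_of_invariant {f : Y →ₗ[k] M}
    (hf : ∀ x, (sweedler k x fun a b => a ⊗ₜ[k] f b) = 1 ⊗ₜ f x) (a : Y) :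
    f a = twistedTrace (twist (drinfeldInv k A B) T) a • f (T Λ) := by
  set t := twistedTrace (twist (drinfeldInv k A B) T) with ht
  set y := T Λ
  have hSy : Λ = S y := (hST Λ).symm
  calc f a = ∑ i, sweedler k (S y) fun y₁ y₂ => t ((A i • a) * y₂) • f (B i • T y₁) := by
        conv_lhs => rw [← hTS a, hY.antipode_eq_sum hR hAB hST hTS hΛ htΛ a, hSy]
        simp only [map_sum]
        refine Finset.sum_congr rfl fun i _ => ?_
        rw [apply_sweedler _ _ T.isLinear, apply_sweedler _ _ f.isLinear]
        simp only [map_smul, hY.inv_smul hST hTS, ht]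
    _ = sweedler k y fun y₁ y₂ => ∑ i, ∑ j,
          t ((A i • a) * (A j • S y₁)) • f ((B i * B j) • y₂) := by
        simp only [sweedler_sum]
        refine Finset.sum_congr rfl fun i _ => ?_
        rw [hY.sweedler_antipode hR hAB _ _]
        simp only [hY.inv_smul hST hTS, hTS, mul_smul]
    _ = sweedler k y fun y₁ y₂ => t (a * S y₁) • f y₂ := by
        congr! 3 with y₁ y₂
        rw [← hY.sum_left_act_mul hR hAB a (S y₁) (fun p c => t p • f (c • y₂))]
        have move_scalar (i : I) : t (A i • (a * S y₁)) • f (B i • y₂) =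
            t (a * S y₁) • f ((counit (R := k) (A i) • B i) • y₂) := by
          rw [ht, hY.twistedTrace_smul hR hAB hST hTS, smul_assoc (_ : k) (B i), f.map_smul,
            smul_smul, smul_eq_mul, mul_comm]
        simp only [move_scalar]
        rw [← Finset.smul_sum, ← map_sum, ← Finset.sum_smul, hR.counit_left hAB, one_smul]
    _ = _ := by
        have h := congrArg (bilinearLift fun p v => t (a * S p) • v) (hf y)
        rw [bilinearLift_tmul, hY.antipode_one, mul_one,
          apply_sweedler _ _ (LinearMap.isLinear _)] at h
        simpa only [bilinearLift_tmul] using h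

omit [FiniteDimensional k Y] hTS hΛ htΛ in
theorem twist_injective : Function.Injective (twist (drinfeldInv k A B) T : Y →ₗ[k] Y) := by
  rw [injective_iff_map_eq_zero]
  intro a ha
  have h := congrArg (fun v => drinfeld k A B • S (S v)) ha
  simpa only [hY.antipode_antipode_twist hST, ← mul_smul, hR.drinfeld_mul_drinfeldInv hAB,
    one_smul, map_zero, smul_zero] using h

theorem eq_zero_of_twistedTrace_mul_self_eq_zero {a : Y}
    (ha : ∀ x, twistedTrace (twist (drinfeldInv k A B) T) (x * a) = 0) : a = 0 := by
  apply hY.twist_injective hR hAB hST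
  rw [map_zero]
  refine hY.eq_zero_of_twistedTrace_mul_eq_zero hR hAB hST hTS hΛ htΛ fun x => ?_
  rw [← hY.twistedTrace_mul_comm hR hAB hST hTS, ha]

theorem exists_isGroupLikeElem :
    ∃ g : Y, IsGroupLikeElem k g ∧ (∀ h : U, h • g = counit (R := k) h • g) ∧
      ∀ x, (sweedler k x fun a b => twistedTrace (twist (drinfeldInv k A B) T) a • b) =
        twistedTrace (twist (drinfeldInv k A B) T) x • g := by
  set t := twistedTrace (twist (drinfeldInv k A B) T) with ht
  let f : Y →ₗ[k] Y := IsLinearMap.mk' (fun x => sweedler k x fun a b => t a • b) (by fun_prop)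
  have f_eq (a : Y) : f a = t a • f (T Λ) :=
    hY.eq_twistedTrace_smul_of_invariant hR hAB hST hTS hΛ htΛ
      (hY.sweedler_tmul_sweedler_twistedTrace_smul hR hAB hST hTS) a
  have g_eq : f (T Λ) = f Λ := by rw [f_eq Λ, htΛ, one_smul]
  refine ⟨f (T Λ), isGroupLikeElem_of_sweedler_apply_smul_eq f_eq htΛ, fun h => ?_, f_eq⟩
  calc h • f (T Λ) = f (h • Λ) := by
        rw [g_eq]
        exact (hY.sweedler_twistedTrace_act hR hAB hST hTS h Λ).symm
    _ = counit (R := k) h • f (T Λ) := by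
        rw [f_eq, ht, hY.twistedTrace_smul hR hAB hST hTS, ← ht, htΛ, smul_assoc, one_smul]

end IsBraidedHopfAlgebra
end TraceIntegralUniqueness

section TwistFiniteOrder

open Coalgebra HopfAlgebra IsUniversalRMatrix

variable {k U : Type*} [Field k] [Ring U] [HopfAlgebra k U]

namespace IsBraidedHopfAlgebra

variable {R : (U ⊗[k] U)ˣ} {Y : Type*} [Ring Y] [Algebra k Y] [Coalgebra k Y] [Module U Y]
  [IsScalarTower k U Y] {S : Y →ₗ[k] Y} (hY : IsBraidedHopfAlgebra R S)
  (hR : IsUniversalRMatrix R) {I : Type*} [Fintype I] {A B : I → U}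
  (hAB : (R : U ⊗[k] U) = ∑ i, A i ⊗ₜ[k] B i)
  {T : Y →ₗ[k] Y} (hST : ∀ x, S (T x) = x) (hTS : ∀ x, T (S x) = x)

section GroupLike

include hY

theorem antipode_mul_of_isGroupLikeElem {g : Y} (hg : IsGroupLikeElem k g) : S g * g = 1 := by
  have h := hY.sweedler_antipode_left g (f := fun x => x)
  rwa [sweedler_of_isGroupLikeElem hg _, hg.counit_eq_one, one_smul] at h

theorem mul_antipode_of_isGroupLikeElem {g : Y} (hg : IsGroupLikeElem k g) : g * S g = 1 := by
  have h := hY.sweedler_antipode_right g (f := fun x => x)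
  rwa [sweedler_of_isGroupLikeElem hg _, hg.counit_eq_one, one_smul] at h

theorem mulLeft_mul_mulRight_antipode_pow_eq_one {g : Y} (hg : IsGroupLikeElem k g) {n : ℕ}
    (hgn : g ^ n = 1) :
    (LinearMap.mulLeft k g * LinearMap.mulRight k (S g) : Module.End k Y) ^ n = 1 := by
  have g_mul_antipode := hY.mul_antipode_of_isGroupLikeElem hg
  have commute_antipode : Commute g (S g) :=
    g_mul_antipode.trans (hY.antipode_mul_of_isGroupLikeElem hg).symm
  have antipode_pow : S g ^ n = 1 := by
    simpa only [g_mul_antipode, one_pow, hgn, one_mul] using (commute_antipode.mul_pow n).symm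
  rw [(LinearMap.commute_mulLeft_right (R := k) g (S g)).mul_pow, LinearMap.pow_mulLeft,
    LinearMap.pow_mulRight, hgn, antipode_pow, LinearMap.mulLeft_one, LinearMap.mulRight_one]
  rfl

include hR hAB

theorem sweedler_apply_mul_smul_of_isGroupLikeElem {t : Y →ₗ[k] k} {g : Y}
    (hg : IsGroupLikeElem k g) (hinv : ∀ h : U, h • g = counit (R := k) h • g)
    (hgt : ∀ x, (sweedler k x fun a b => t a • b) = t x • g) (x : Y) :
    (sweedler k x fun a b => t (a * g) • b) = t (x * g) • 1 := by
  have h := congrArg (· * S g) (hgt (x * g))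
  rw [hY.sweedler_mul_isGroupLikeElem hR hAB hinv hg _ _,
    apply_sweedler (k := k) (f := fun v => v * S g)] at h
  simpa only [smul_mul_assoc, mul_assoc, hY.mul_antipode_of_isGroupLikeElem hg, mul_one] using h

include hST hTS in
theorem sweedler_tmul_comp_inv_of_sweedler_apply_smul_eq {f : Y →ₗ[k] k}
    (hf : ∀ (h : U) x, f (h • x) = counit (R := k) h • f x)
    (hright : ∀ x, (sweedler k x fun a b => f a • b) = f x • 1) (x : Y) :
    (sweedler k x fun a b => a ⊗ₜ[k] (f ∘ₗ T) b) = 1 ⊗ₜ (f ∘ₗ T) x := by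
  obtain ⟨y, rfl⟩ : ∃ y, S y = x := ⟨T x, hST x⟩
  have sum_smul_tmul (a b : Y) : ∑ i, (B i • S b) ⊗ₜ[k] (counit (R := k) (A i) • f a) =
      S (f a • b) ⊗ₜ[k] (1 : k) := by
    simp only [← smul_tmul, ← sum_tmul, ← smul_assoc, ← Finset.sum_smul, hR.counit_left hAB,
      one_smul]
    rw [map_smul, smul_tmul, smul_eq_mul, mul_one]
  rw [hY.sweedler_antipode hR hAB _ _, ← sweedler_sum]
  simp only [LinearMap.comp_apply, hY.inv_smul hST hTS, hTS, hf, sum_smul_tmul]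
  rw [← apply_sweedler (k := k) (f := fun v : Y => S v ⊗ₜ[k] (1 : k)), hright, map_smul,
    hY.antipode_one, smul_tmul, smul_eq_mul, mul_one]

end GroupLike

variable [FiniteDimensional k Y]

include hY hR hAB hST hTS

theorem twistedTrace_antipode_mul (x y : Y) :
    twistedTrace (twist (drinfeldInv k A B) T) (S (x * y)) =
      twistedTrace (twist (drinfeldInv k A B) T) (S y * (drinfeld k A B • S x)) := by
  rw [hY.antipode_mul hR hAB, map_sum]
  simp only [hY.twistedTrace_smul_mul hR hAB hST hTS, drinfeld, Finset.sum_smul, Finset.mul_sum,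
    map_sum, mul_smul]

theorem twistedTrace_antipode_mul_comm (x y : Y) :
    twistedTrace (twist (drinfeldInv k A B) T) (S (x * y)) =
      twistedTrace (twist (drinfeldInv k A B) T) (S (y *
        (drinfeldGroupLike k A B • twist (drinfeldInv k A B) T x))) := by
  set θ := twist (drinfeldInv k A B) T with hθ
  have twist_drinfeld_smul : θ (drinfeld k A B • S x) = drinfeld k A B • S (θ x) := by
    rw [← hR.antipode_antipode_drinfeld hAB, hθ, hY.twist_antipode_antipode_smul hR hAB hST hTS,
      hR.antipode_antipode_drinfeld hAB]
    simp only [twist_apply, hTS, hST, hY.antipode_smul]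
  have antipode_drinfeld_smul : antipode k (drinfeld k A B) • drinfeldGroupLike k A B • θ x =
      drinfeld k A B • θ x := by
    rw [drinfeldGroupLike, ← mul_smul, ← mul_assoc, ← antipode_mul_antidistrib,
      hR.drinfeldInv_mul_drinfeld hAB, HopfAlgebra.antipode_one, one_mul]
  rw [hY.twistedTrace_antipode_mul hR hAB hST hTS, hY.twistedTrace_mul_comm hR hAB hST hTS, ← hθ,
    twist_drinfeld_smul, hY.twistedTrace_antipode_mul hR hAB hST hTS,
    ← hR.antipode_antipode_drinfeld hAB,
    ← hY.twistedTrace_smul_mul hR hAB hST hTS (antipode k (drinfeld k A B)), ← hY.antipode_smul,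
    ← hY.antipode_smul, hR.antipode_antipode_drinfeld hAB, antipode_drinfeld_smul]

variable {Λ : Y} (hΛ : ∀ x, x * Λ = counit (R := k) x • Λ)
  (htΛ : twistedTrace (twist (drinfeldInv k A B) T) Λ = 1)

include hΛ htΛ

theorem exists_twistedTrace_mul_eq_mul_twistedTrace_antipode {g : Y} (hg : IsGroupLikeElem k g)
    (hinv : ∀ h : U, h • g = counit (R := k) h • g)
    (hgt : ∀ x, (sweedler k x fun a b => twistedTrace (twist (drinfeldInv k A B) T) a • b) =
        twistedTrace (twist (drinfeldInv k A B) T) x • g) :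
    ∃ c, ∀ x, twistedTrace (twist (drinfeldInv k A B) T) (x * g) =
      c * twistedTrace (twist (drinfeldInv k A B) T) (S x) := by
  let f : Y →ₗ[k] k := twistedTrace (twist (drinfeldInv k A B) T) ∘ₗ LinearMap.mulRight k g
  have f_smul (h : U) (x : Y) : f (h • x) = counit (R := k) h • f x := by
    simp only [f, LinearMap.comp_apply, LinearMap.mulRight_apply, ← hY.smul_mul_of_invariant hinv,
      hY.twistedTrace_smul hR hAB hST hTS]
  have f_comp_inv_invariant := hY.sweedler_tmul_comp_inv_of_sweedler_apply_smul_eq hR hAB hST hTS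
    f_smul (hY.sweedler_apply_mul_smul_of_isGroupLikeElem hR hAB hg hinv hgt)
  refine ⟨(f ∘ₗ T) (T Λ), fun x => ?_⟩
  have f_eq :=
    hY.eq_twistedTrace_smul_of_invariant hR hAB hST hTS hΛ htΛ f_comp_inv_invariant (S x)
  rw [LinearMap.comp_apply, hTS] at f_eq
  rwa [smul_eq_mul, mul_comm] at f_eq

theorem drinfeldGroupLike_smul_twist_twist_mul {g : Y} (hg : IsGroupLikeElem k g)
    (hinv : ∀ h : U, h • g = counit (R := k) h • g)
    (hgt : ∀ x, (sweedler k x fun a b => twistedTrace (twist (drinfeldInv k A B) T) a • b) =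
        twistedTrace (twist (drinfeldInv k A B) T) x • g) (x : Y) :
    (drinfeldGroupLike k A B • twist (drinfeldInv k A B) T (twist (drinfeldInv k A B) T x)) * g =
      g * x := by
  set θ := twist (drinfeldInv k A B) T with hθ
  set t := twistedTrace θ with ht
  obtain ⟨c, hc⟩ := hY.exists_twistedTrace_mul_eq_mul_twistedTrace_antipode hR hAB hST hTS hΛ htΛ
    hg hinv hgt
  have twistedTrace_mul_mul_comm (x y : Y) :
      t (x * y * g) = t (y * (drinfeldGroupLike k A B • θ x) * g) := by
    rw [ht, hc, hc, hY.twistedTrace_antipode_mul_comm hR hAB hST hTS]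
  refine (sub_eq_zero.1 (hY.eq_zero_of_twistedTrace_mul_self_eq_zero hR hAB hST hTS hΛ htΛ
    fun y => ?_)).symm
  rw [mul_sub, map_sub, sub_eq_zero, ← mul_assoc, ← mul_assoc, ← hθ, ← ht,
    ← twistedTrace_mul_mul_comm, hY.twistedTrace_mul_comm hR hAB hST hTS, mul_assoc]

omit hΛ htΛ in
theorem exists_twist_pow_eq_one (h : twistedTrace (twist (drinfeldInv k A B) T) ≠ 0) :
    ∃ n, 0 < n ∧ (twist (drinfeldInv k A B) T : Module.End k Y) ^ n = 1 := by
  obtain ⟨Λ, hΛ, htΛ⟩ := hY.exists_integral hR hAB hST hTS h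
  obtain ⟨g, hg, hinv, hgt⟩ := hY.exists_isGroupLikeElem hR hAB hST hTS hΛ htΛ
  set θ : Module.End k Y := twist (drinfeldInv k A B) T
  let W : Module.End k Y := Algebra.lsmul k k Y (drinfeldGroupLike k A B)
  have commute_twist_sq : Commute W (θ ^ 2) := by
    refine Commute.pow_right (LinearMap.ext fun x => ?_) 2
    have h := hY.twist_antipode_antipode_smul hR hAB hST hTS (drinfeldGroupLike k A B) x
    rw [(hR.isGroupLikeElem_drinfeldGroupLike hAB).antipode_antipode] at h
    exact h.symm
  have mul_twist_sq : W * θ ^ 2 = LinearMap.mulLeft k g * LinearMap.mulRight k (S g) := by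
    ext x
    change drinfeldGroupLike k A B • θ (θ x) = g * (x * S g)
    rw [← mul_assoc,
      ← hY.drinfeldGroupLike_smul_twist_twist_mul hR hAB hST hTS hΛ htΛ hg hinv hgt x,
      mul_assoc, hY.mul_antipode_of_isGroupLikeElem hg, mul_one]
  obtain ⟨a, ha, hga⟩ := hY.exists_pow_eq_one_of_isGroupLikeElem hR hAB hinv hg
    (hY.antipode_mul_of_isGroupLikeElem hg)
  obtain ⟨b, hb, hwb⟩ := hR.exists_drinfeldGroupLike_pow_eq_one hAB
  have W_pow : W ^ b = 1 := by rw [← map_pow, hwb, map_one]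
  refine ⟨2 * (a * b), by positivity, ?_⟩
  calc θ ^ (2 * (a * b)) = W ^ (a * b) * (θ ^ 2) ^ (a * b) := by
        rw [pow_mul' W, W_pow, one_pow, one_mul, pow_mul]
    _ = ((W * θ ^ 2) ^ a) ^ b := by rw [← commute_twist_sq.mul_pow, pow_mul]
    _ = 1 := by
        rw [mul_twist_sq, hY.mulLeft_mul_mulRight_antipode_pow_eq_one hg hga, one_pow]

end IsBraidedHopfAlgebra
end TwistFiniteOrder

section TwistedTraceForm

variable {k Y Z : Type*} [Field k] [Ring Y] [Algebra k Y] [Ring Z] [Algebra k Z]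

/-- The trace form `(a, b) ↦ twistedTrace θ (a * b)` of an algebra, twisted by an endomorphism `θ`
of the underlying space. -/
noncomputable def twistedTraceForm (θ : Y →ₗ[k] Y) : LinearMap.BilinForm k Y :=
  (LinearMap.mul k Y).compr₂ (twistedTrace θ)

theorem twistedTraceForm_apply (θ : Y →ₗ[k] Y) (a b : Y) :
    twistedTraceForm θ a b = twistedTrace θ (a * b) := rfl

theorem twistedTrace_autCongr (e : Y ≃ₐ[k] Z) (σ : Y ≃ₐ[k] Y) (y : Y) :
    twistedTrace (e.autCongr σ).toLinearMap (e y) = twistedTrace σ.toLinearMap y := by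
  rw [twistedTrace_apply, twistedTrace_apply, ← LinearMap.trace_conj' _ e.toLinearEquiv]
  congr 1
  ext z
  simp [LinearEquiv.conj_apply]

theorem separatingLeft_twistedTraceForm_autCongr (e : Y ≃ₐ[k] Z) {σ : Y ≃ₐ[k] Y}
    (h : (twistedTraceForm σ.toLinearMap).SeparatingLeft) :
    (twistedTraceForm (e.autCongr σ).toLinearMap).SeparatingLeft := fun a ha =>
  (EmbeddingLike.map_eq_zero_iff (f := e.symm)).1 <| h _ fun x => by
    rw [twistedTraceForm_apply, ← twistedTrace_autCongr e, map_mul, e.apply_symm_apply,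
      ← twistedTraceForm_apply, ha]

theorem twistedTrace_baseChange [FiniteDimensional k Y] (K : Type*) [Field K] [Algebra k K]
    (θ : Y →ₗ[k] Y) (y : Y) :
    twistedTrace (θ.baseChange K) ((1 : K) ⊗ₜ[k] y) = algebraMap k K (twistedTrace θ y) := by
  rw [twistedTrace_apply, twistedTrace_apply, ← LinearMap.trace_baseChange]
  congr 1
  ext z
  simp

theorem twistedTraceForm_baseChange [FiniteDimensional k Y] (K : Type*) [Field K] [Algebra k K]
    (θ : Y →ₗ[k] Y) :
    twistedTraceForm (θ.baseChange K) = (twistedTraceForm θ).baseChange K := by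
  ext a b
  simp [twistedTraceForm_apply, twistedTrace_baseChange, Algebra.algebraMap_eq_smul_one]

theorem separatingLeft_baseChange {V : Type*} [AddCommGroup V] [Module k V] [FiniteDimensional k V]
    (K : Type*) [Field K] [Algebra k K] {B : LinearMap.BilinForm k V} (hB : B.SeparatingLeft) :
    (B.baseChange K).SeparatingLeft := by
  let b := Module.finBasis k V
  have hmatrix : LinearMap.toMatrix₂ (b.baseChange K) (b.baseChange K) (B.baseChange K) =
      (algebraMap k K).mapMatrix (LinearMap.toMatrix₂ b b B) := by
    ext i j
    simp [LinearMap.toMatrix₂_apply, Algebra.algebraMap_eq_smul_one]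
  rw [LinearMap.separatingLeft_iff_det_ne_zero b] at hB
  rwa [LinearMap.separatingLeft_iff_det_ne_zero (b.baseChange K), hmatrix, ← RingHom.map_det,
    map_ne_zero]

theorem eq_zero_of_isNilpotent_mulRight_comp {θ : Y →ₗ[k] Y}
    (h : (twistedTraceForm θ).SeparatingLeft) {a : Y}
    (ha : ∀ x, IsNilpotent (LinearMap.mulRight k (a * x) ∘ₗ θ : Module.End k Y)) : a = 0 :=
  h a fun x => (LinearMap.isNilpotent_trace_of_isNilpotent (ha x)).eq_zero

theorem map_mem_jacobson_pow {A : Type*} [Ring A] (σ : A ≃+* A) (n : ℕ) {a : A}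
    (ha : a ∈ Ring.jacobson A ^ n) : σ a ∈ Ring.jacobson A ^ n := by
  have : RingHomSurjective (σ : A →+* A) := ⟨σ.surjective⟩
  induction n generalizing a with
  | zero => rw [Submodule.pow_zero, Ideal.one_eq_top]; trivial
  | succ n ih =>
    rw [Submodule.pow_succ] at ha ⊢
    induction ha using Submodule.smul_induction_on' with
    | smul b hb c hc =>
      rw [smul_eq_mul, map_mul]
      exact Ideal.mul_mem_mul (ih hb) (Ring.le_comap_jacobson (σ : A →+* A) hc)
    | add b _ c _ hb hc => exact map_add σ b c ▸ add_mem hb hc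

theorem isSemisimpleRing_of_separatingLeft_twistedTraceForm [FiniteDimensional k Y] (σ : Y ≃ₐ[k] Y)
    (h : (twistedTraceForm σ.toLinearMap).SeparatingLeft) : IsSemisimpleRing Y := by
  have : IsArtinianRing Y := IsArtinianRing.of_finite k Y
  rw [IsArtinianRing.isSemisimpleRing_iff_jacobson, eq_bot_iff]
  intro a ha
  obtain ⟨n, hn⟩ := IsSemiprimaryRing.isNilpotent (R := Y)
  refine (Submodule.mem_bot Y).2 (eq_zero_of_isNilpotent_mulRight_comp h fun x => ⟨n, ?_⟩)
  have hpow (m : ℕ) (y : Y) :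
      ((LinearMap.mulRight k (a * x) ∘ₗ σ.toLinearMap : Module.End k Y) ^ m) y ∈
        Ring.jacobson Y ^ m := by
    induction m with
    | zero => rw [Submodule.pow_zero, Ideal.one_eq_top]; trivial
    | succ m ih =>
      rw [_root_.pow_succ', Submodule.pow_succ]
      exact Ideal.mul_mem_mul (map_mem_jacobson_pow σ.toRingEquiv m ih)
        (Ideal.mul_mem_right _ _ ha)
  ext y
  exact (Submodule.mem_bot Y).1 (hn.le (hpow n y))

theorem eq_zero_of_map_mul_self_eq_zero (σ : Y ≃ₐ[k] Y)
    (h : (twistedTraceForm σ.toLinearMap).SeparatingLeft) {e : Y} (he : ∀ x, Commute e x)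
    (hσe : σ e * e = 0) : e = 0 := by
  refine eq_zero_of_isNilpotent_mulRight_comp h fun x => ⟨2, LinearMap.ext fun y => ?_⟩
  calc ((LinearMap.mulRight k (e * x) ∘ₗ σ.toLinearMap : Module.End k Y) ^ 2) y
      = σ (σ y * (e * x)) * (e * x) := by rw [sq]; rfl
    _ = σ (σ y) * (σ e * (σ x * e)) * x := by simp only [map_mul, mul_assoc]
    _ = σ (σ y) * (σ e * e * σ x) * x := by rw [← (he (σ x)).eq, mul_assoc (σ e)]
    _ = 0 := by rw [hσe, zero_mul, mul_zero, zero_mul]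

end TwistedTraceForm

section RootsOfUnity

open Polynomial

variable {K : Type*} [Field K] {N : ℕ} [NeZero N] {ζ : K}

theorem pow_pred_eq_inv_of_pow_eq_one (hζ : ζ ^ N = 1) : ζ ^ (N - 1) = ζ⁻¹ :=
  eq_inv_of_mul_eq_one_left <| by rw [← pow_succ, Nat.sub_add_cancel (NeZero.one_le), hζ]

theorem aeval_eq_zero_iff_cyclotomic_dvd [CharZero K] (hζ : IsPrimitiveRoot ζ N) (F : ℤ[X]) :
    aeval ζ F = 0 ↔ cyclotomic N ℤ ∣ F := by
  rw [cyclotomic_eq_minpoly hζ (NeZero.pos N)]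
  exact minpoly.isIntegrallyClosed_dvd_iff (hζ.isIntegral (NeZero.pos N)) F

theorem aeval_inv_eq_conj_aeval {z : ℂ} (hz : ‖z‖ = 1) (F : ℤ[X]) :
    aeval z⁻¹ F = (starRingEnd ℂ) (aeval z F) := by
  rw [Complex.inv_eq_conj hz]
  exact aeval_algHom_apply ((starRingEnd ℂ).toIntAlgHom) z F

theorem aeval_sum_mul_comp_X_pow_pred (hζ : ζ ^ N = 1) {ι : Type*} [Fintype ι] (P : ι → ℤ[X]) :
    aeval ζ (∑ i, P i * (P i).comp (X ^ (N - 1))) = ∑ i, aeval ζ (P i) * aeval ζ⁻¹ (P i) := by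
  simp [map_sum, aeval_comp, pow_pred_eq_inv_of_pow_eq_one hζ]

-- A relation between roots of unity can be tested in `ℂ`, where inversion is conjugation.
theorem aeval_eq_zero_of_sum_mul_aeval_inv_eq_zero [CharZero K] (hζ : IsPrimitiveRoot ζ N)
    {ι : Type*} [Fintype ι] (P : ι → ℤ[X]) (h : ∑ i, aeval ζ (P i) * aeval ζ⁻¹ (P i) = 0) (i : ι) :
    aeval ζ (P i) = 0 := by
  have hω := Complex.isPrimitiveRoot_exp N (NeZero.ne N)
  have hnorm := hω.norm'_eq_one (NeZero.ne N)
  rw [← aeval_sum_mul_comp_X_pow_pred hζ.pow_eq_one, aeval_eq_zero_iff_cyclotomic_dvd hζ,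
    ← aeval_eq_zero_iff_cyclotomic_dvd hω, aeval_sum_mul_comp_X_pow_pred hω.pow_eq_one] at h
  have hnormSq :
      ∑ i, Complex.normSq (aeval (Complex.exp (2 * Real.pi * Complex.I / N)) (P i)) = 0 :=
    Complex.ofReal_injective <| by
      simpa [aeval_inv_eq_conj_aeval hnorm, Complex.mul_conj] using h
  rw [Finset.sum_eq_zero_iff_of_nonneg fun i _ => Complex.normSq_nonneg _] at hnormSq
  rw [aeval_eq_zero_iff_cyclotomic_dvd hζ, ← aeval_eq_zero_iff_cyclotomic_dvd hω]
  exact Complex.normSq_eq_zero.1 (hnormSq i (Finset.mem_univ i))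

end RootsOfUnity

section Eigenbasis

open Polynomial

variable {K V : Type*} [Field K] [CharZero K] [IsAlgClosed K] [AddCommGroup V] [Module K V]
  [FiniteDimensional K V] {N : ℕ} [NeZero N]

theorem exists_eigenbasis_of_pow_eq_one {f : Module.End K V} (hf : f ^ N = 1) :
    ∃ (b : Module.Basis (Fin (Module.finrank K V)) K V) (ν : Fin (Module.finrank K V) → K),
      ∀ i, f (b i) = ν i • b i := by
  classical
  have hsemisimple : f.IsSemisimple :=
    Module.End.isSemisimple_of_squarefree_aeval_eq_zero (p := X ^ N - 1)
      (X_pow_sub_one_separable_iff.2 (NeZero.ne (N : K))).squarefree (by simp [hf])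
  have hinternal := DirectSum.isInternal_submodule_of_iSupIndep_of_iSup_eq_top
    f.eigenspaces_iSupIndep hsemisimple.iSup_eigenspace_eq_top
  let b := hinternal.collectedBasis fun μ => Module.finBasis K (f.eigenspace μ)
  let e := b.indexEquiv (Module.finBasis K V)
  refine ⟨b.reindex e, fun i => (e.symm i).1, fun i => ?_⟩
  rw [b.reindex_apply]
  exact Module.End.mem_eigenspace_iff.1 (hinternal.collectedBasis_mem _ (e.symm i))

theorem exists_trace_eq_aeval_of_pow_eq_one {ζ : K} (hζ : IsPrimitiveRoot ζ N)
    {f g : Module.End K V} (hf : f ^ N = 1) (hgf : g * f = 1) :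
    ∃ P : ℤ[X], LinearMap.trace K V f = aeval ζ P ∧ LinearMap.trace K V g = aeval ζ⁻¹ P := by
  obtain ⟨b, ν, hν⟩ := exists_eigenbasis_of_pow_eq_one hf
  have hνN (i) : ν i ^ N = 1 := by
    have heigen : f.HasEigenvector (ν i) (b i) :=
      ⟨Module.End.mem_eigenspace_iff.2 (hν i), b.ne_zero i⟩
    have hpow := heigen.pow_apply N
    rw [hf, Module.End.one_apply] at hpow
    exact smul_left_injective K (b.ne_zero i) (by simpa using hpow.symm)
  have hg (i) : g (b i) = (ν i)⁻¹ • b i := by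
    have hν0 : ν i ≠ 0 := fun h0 => by simpa [h0, NeZero.ne N] using hνN i
    rw [eq_inv_smul_iff₀ hν0, ← map_smul, ← hν, ← Module.End.mul_apply, hgf, Module.End.one_apply]
  choose j _ hj using fun i => hζ.eq_pow_of_pow_eq_one (hνN i)
  refine ⟨∑ i, X ^ j i, ?_, ?_⟩
  · rw [trace_eq_sum_coord b]
    simp [hν, map_sum, hj]
  · rw [trace_eq_sum_coord b]
    simp [hg, map_sum, ← hj]

end Eigenbasis

section MatrixAlgebra

variable {K n : Type*} [Field K] [Fintype n] [DecidableEq n]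

/-- Skolem–Noether for matrix algebras. -/
theorem exists_eq_conj_of_algEquiv_matrix (f : Matrix n n K ≃ₐ[K] Matrix n n K) :
    ∃ u v : Matrix n n K, u * v = 1 ∧ ∀ m, f m = u * m * v := by
  obtain ⟨T, hT⟩ := (Matrix.toLinAlgEquiv'.autCongr f).eq_linearEquivConjAlgEquiv
  refine ⟨LinearMap.toMatrix' T.toLinearMap, LinearMap.toMatrix' T.symm.toLinearMap, ?_, ?_⟩
  · rw [← LinearMap.toMatrix'_comp]; simp
  · intro m
    have h := DFunLike.congr_fun hT (Matrix.toLinAlgEquiv' m)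
    simp only [AlgEquiv.autCongr_apply, AlgEquiv.trans_apply, AlgEquiv.symm_apply_apply,
      LinearEquiv.conjAlgEquiv_apply] at h
    apply Matrix.toLinAlgEquiv'.injective
    rw [map_mul, map_mul, h]
    refine LinearMap.ext fun x => ?_
    simp [Matrix.toLinAlgEquiv'_apply, -Matrix.mulVec_mulVec, LinearMap.toMatrix'_mulVec]

theorem exists_eq_smul_one_of_forall_commute {a : Matrix n n K} (h : ∀ m, Commute a m) :
    ∃ c : K, a = c • 1 := by
  obtain ⟨c, rfl⟩ := Matrix.mem_range_scalar_of_commute_single fun i j _ => (h _).symm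
  exact ⟨c, by rw [Matrix.scalar_apply, Matrix.smul_one_eq_diagonal]⟩

theorem trace_mulRight_comp_mulLeft_matrix (u w : Matrix n n K) :
    LinearMap.trace K (Matrix n n K) (LinearMap.mulRight K w ∘ₗ LinearMap.mulLeft K u) =
      u.trace * w.trace := by
  have hrepr (m : Matrix n n K) (i j : n) : (Matrix.stdBasis K n n).repr m (i, j) = m i j := by
    simp [Matrix.stdBasis]
  rw [trace_eq_sum_coord (Matrix.stdBasis K n n), Fintype.sum_prod_type, Matrix.trace,
    Matrix.trace, Finset.sum_mul_sum]
  refine Finset.sum_congr rfl fun i _ => Finset.sum_congr rfl fun j _ => ?_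
  rw [Module.Basis.coord_apply, Matrix.stdBasis_eq_single, hrepr]
  simp [Matrix.mul_apply, Matrix.single_apply, Finset.sum_ite_eq, ite_and]

end MatrixAlgebra

section MatrixProduct

variable {K ι : Type*} [Field K] [Fintype ι] [DecidableEq ι] {d : ι → Type*} [∀ i, Fintype (d i)]
  [∀ i, DecidableEq (d i)]

theorem trace_eq_sum_trace_of_apply_single {M : ι → Type*} [∀ i, AddCommGroup (M i)]
    [∀ i, Module K (M i)] [∀ i, FiniteDimensional K (M i)] (f : (Π i, M i) →ₗ[K] Π i, M i)
    (g : ∀ i, M i →ₗ[K] M i) (h : ∀ i m, f (Pi.single i m) i = g i m) :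
    LinearMap.trace K _ f = ∑ i, LinearMap.trace K _ (g i) := by
  let b := fun i => Module.finBasis K (M i)
  rw [trace_eq_sum_coord (Pi.basis b), Fintype.sum_sigma]
  refine Finset.sum_congr rfl fun i _ => ?_
  rw [trace_eq_sum_coord (b i)]
  refine Finset.sum_congr rfl fun j _ => ?_
  rw [Module.Basis.coord_apply, Pi.basis_repr, Pi.basis_apply, h, Module.Basis.coord_apply]

omit [Fintype ι] in
theorem commute_single_one (i : ι) (x : Π i, Matrix (d i) (d i) K) :
    Commute (Pi.single i 1) x := by
  ext1 l
  obtain rfl | hl := eq_or_ne l i <;> simp [*]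

variable (τ : (Π i, Matrix (d i) (d i) K) ≃ₐ[K] Π i, Matrix (d i) (d i) K)

omit [Fintype ι] in
theorem apply_single_one_apply_self_eq_zero_or_one (i : ι) :
    τ (Pi.single i 1) i = 0 ∨ τ (Pi.single i 1) i = 1 := by
  obtain ⟨c, hc⟩ := exists_eq_smul_one_of_forall_commute (a := τ (Pi.single i 1) i) fun m => by
    have hcomm := ((commute_single_one i (τ.symm (Pi.single i m))).map τ).eq
    exact show _ * _ = _ by simpa using congrFun hcomm i
  have hidem : τ (Pi.single i 1) i * τ (Pi.single i 1) i = τ (Pi.single i 1) i := by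
    rw [← Pi.mul_apply, ← map_mul, ← Pi.single_mul, one_mul]
  rw [hc] at hidem ⊢
  obtain rfl | hc0 := eq_or_ne c 0
  · exact .inl (zero_smul K _)
  · exact .inr (smul_right_injective _ hc0 (by simpa [smul_smul] using hidem))

omit [Fintype ι] in
theorem apply_single_one_of_separatingLeft
    (h : (twistedTraceForm τ.toLinearMap).SeparatingLeft) (i : ι) :
    τ (Pi.single i 1) = Pi.single i 1 := by
  have hself (i : ι) : τ (Pi.single i 1) i = 1 := by
    rcases apply_single_one_apply_self_eq_zero_or_one τ i with h0 | h1
    · have hzero : (Pi.single i 1 : Π i, Matrix (d i) (d i) K) = 0 := by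
        refine eq_zero_of_map_mul_self_eq_zero τ h (commute_single_one i) ?_
        ext1 l
        obtain rfl | hl := eq_or_ne l i <;> simp [*]
      rw [hzero, map_zero]
      simpa using (congrFun hzero i).symm
    · exact h1
  ext1 l
  obtain rfl | hl := eq_or_ne l i
  · rw [hself, Pi.single_eq_same]
  · have horth : (Pi.single i 1 * Pi.single l 1 : Π i, Matrix (d i) (d i) K) = 0 := by
      ext1 j
      obtain rfl | hj := eq_or_ne j i <;> simp [*]
    have hτorth := congrFun (congrArg τ horth) l
    rw [map_mul, Pi.mul_apply, hself, mul_one, map_zero] at hτorth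
    rw [hτorth, Pi.single_eq_of_ne hl, Pi.zero_apply]

omit [Fintype ι] in
theorem apply_single_of_separatingLeft
    (h : (twistedTraceForm τ.toLinearMap).SeparatingLeft) (i : ι) (m : Matrix (d i) (d i) K) :
    τ (Pi.single i m) = Pi.single i (τ (Pi.single i m) i) := by
  ext1 l
  obtain rfl | hl := eq_or_ne l i
  · rw [Pi.single_eq_same]
  · rw [← one_mul m, Pi.single_mul, map_mul, apply_single_one_of_separatingLeft τ h]
    simp [hl]

omit [Fintype ι] [DecidableEq ι] in
theorem exists_eq_conj_of_separatingLeft [Finite ι]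
    (h : (twistedTraceForm τ.toLinearMap).SeparatingLeft) :
    ∃ u v : Π i, Matrix (d i) (d i) K, u * v = 1 ∧ ∀ x, τ x = u * x * v := by
  classical
  cases nonempty_fintype ι
  let f (i : ι) : Matrix (d i) (d i) K →ₐ[K] Matrix (d i) (d i) K :=
    AlgHom.ofLinearMap
      (LinearMap.proj i ∘ₗ τ.toLinearMap ∘ₗ LinearMap.single K (fun i => Matrix (d i) (d i) K) i)
      (by simp [apply_single_one_of_separatingLeft τ h]) (fun a b => by simp [Pi.single_mul])
  have hf (i : ι) (m : Matrix (d i) (d i) K) : τ (Pi.single i m) = Pi.single i (f i m) :=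
    apply_single_of_separatingLeft τ h i m
  have hbij (i : ι) : Function.Bijective (f i) := by
    have hinj : Function.Injective (f i).toLinearMap := fun a b hab =>
      Pi.single_injective i (τ.injective (by rw [hf, hf]; exact congrArg _ hab))
    exact ⟨hinj, LinearMap.injective_iff_surjective.1 hinj⟩
  choose u v huv hconj using
    fun i => exists_eq_conj_of_algEquiv_matrix (AlgEquiv.ofBijective (f i) (hbij i))
  refine ⟨u, v, funext huv, fun x => ?_⟩
  calc τ x = ∑ i, Pi.single i (f i (x i)) := by
        rw [← Finset.sum_congr rfl fun i _ => hf i (x i), ← map_sum, Finset.univ_sum_single]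
    _ = fun i => f i (x i) := Finset.univ_sum_single _
    _ = u * x * v := funext fun i => hconj i (x i)

omit [DecidableEq ι] in
theorem twistedTrace_eq_sum_of_eq_conj {u v : Π i, Matrix (d i) (d i) K}
    (hτ : ∀ x, τ x = u * x * v) (y : Π i, Matrix (d i) (d i) K) :
    twistedTrace τ.toLinearMap y = ∑ i, (u i).trace * (v i * y i).trace := by
  classical
  rw [twistedTrace_apply, trace_eq_sum_trace_of_apply_single _ fun i =>
    LinearMap.mulRight K (v i * y i) ∘ₗ LinearMap.mulLeft K (u i)]
  · simp only [trace_mulRight_comp_mulLeft_matrix]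
  · intro i m
    simp [hτ, mul_assoc]

omit [Fintype ι] [DecidableEq ι] in
theorem exists_pow_eq_smul_one_of_conj_pow_eq_one {N : ℕ} (hτN : τ ^ N = 1)
    {u v : Π i, Matrix (d i) (d i) K} (huv : u * v = 1) (hτ : ∀ x, τ x = u * x * v) (i : ι) :
    ∃ c : K, u i ^ N = c • 1 := by
  classical
  have hvu : v * u = 1 := funext fun i => mul_eq_one_comm.1 (congrFun huv i)
  have hpow (l : ℕ) (x) : (τ ^ l) x = u ^ l * x * v ^ l := by
    induction l with
    | zero => simp
    | succ l ih =>
      rw [pow_succ', AlgEquiv.mul_apply, ih, hτ, pow_succ', pow_succ]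
      simp only [mul_assoc]
  refine exists_eq_smul_one_of_forall_commute fun m => ?_
  have hcomm : u ^ N * Pi.single i m = Pi.single i m * u ^ N := by
    calc u ^ N * Pi.single i m = u ^ N * Pi.single i m * (v ^ N * u ^ N) := by
          rw [← (show Commute v u from hvu.trans huv.symm).mul_pow, hvu, one_pow, mul_one]
      _ = (τ ^ N) (Pi.single i m) * u ^ N := by rw [hpow, ← mul_assoc]
      _ = Pi.single i m * u ^ N := by rw [hτN, AlgEquiv.one_apply]
  exact show _ * _ = _ by simpa using congrFun hcomm i

end MatrixProduct

section FiniteOrder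

open Polynomial

variable {K : Type*} [Field K] [CharZero K] [IsAlgClosed K] {N : ℕ} [NeZero N]

theorem exists_trace_eq_mul_aeval {n : Type*} [Fintype n] [DecidableEq n] [Nonempty n] {ζ : K}
    (hζ : IsPrimitiveRoot ζ N) {u v : Matrix n n K} (huv : u * v = 1) {c : K}
    (hu : u ^ N = c • 1) :
    ∃ (r : K) (P : ℤ[X]), r ≠ 0 ∧ u.trace = r * aeval ζ P ∧ v.trace = r⁻¹ * aeval ζ⁻¹ P := by
  have hvu : v * u = 1 := mul_eq_one_comm.1 huv
  have hc : c ≠ 0 := by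
    rintro rfl
    have hone : u ^ N * v ^ N = 1 := by
      rw [← (show Commute u v from huv.trans hvu.symm).mul_pow, huv, one_pow]
    rw [hu, zero_smul, zero_mul] at hone
    exact zero_ne_one hone
  obtain ⟨r, rfl⟩ := IsAlgClosed.exists_pow_nat_eq c (NeZero.pos N)
  have hr : r ≠ 0 := (pow_ne_zero_iff (NeZero.ne N)).1 hc
  have hpow : Matrix.toLinAlgEquiv' (r⁻¹ • u) ^ N = 1 := by
    rw [← map_pow, _root_.smul_pow, hu, smul_smul, inv_pow, inv_mul_cancel₀ hc, one_smul, map_one]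
  have hinv : Matrix.toLinAlgEquiv' (r • v) * Matrix.toLinAlgEquiv' (r⁻¹ • u) = 1 := by
    rw [← map_mul, smul_mul_smul_comm, hvu, mul_inv_cancel₀ hr, one_smul, map_one]
  obtain ⟨P, hP, hPinv⟩ := exists_trace_eq_aeval_of_pow_eq_one hζ hpow hinv
  change LinearMap.trace K _ (Matrix.toLin' _) = _ at hP hPinv
  rw [Matrix.trace_toLin'_eq, Matrix.trace_smul, smul_eq_mul] at hP hPinv
  refine ⟨r, P, hr, ?_, ?_⟩
  · rw [← hP, mul_inv_cancel_left₀ hr]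
  · rw [← hPinv, inv_mul_cancel_left₀ hr]

theorem twistedTrace_one_ne_zero_of_isAlgClosed {Y : Type*} [Ring Y] [Algebra K Y] [Nontrivial Y]
    [FiniteDimensional K Y] (σ : Y ≃ₐ[K] Y) (hσ : σ ^ N = 1)
    (h : (twistedTraceForm σ.toLinearMap).SeparatingLeft) :
    twistedTrace σ.toLinearMap 1 ≠ 0 := by
  intro hone
  have := isSemisimpleRing_of_separatingLeft_twistedTraceForm σ h
  obtain ⟨s, d, hd, ⟨e⟩⟩ := IsSemisimpleRing.exists_algEquiv_pi_matrix_of_isAlgClosed K Y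
  have hnd := separatingLeft_twistedTraceForm_autCongr e h
  rw [← twistedTrace_autCongr e, map_one] at hone
  obtain ⟨u, v, huv, hτ⟩ := exists_eq_conj_of_separatingLeft _ hnd
  have htr := twistedTrace_eq_sum_of_eq_conj _ hτ
  have hτN : e.autCongr σ ^ N = 1 := by rw [← map_pow, hσ, map_one]
  obtain ⟨ζ, hζ⟩ := HasEnoughRootsOfUnity.exists_primitiveRoot K N
  choose c hc using exists_pow_eq_smul_one_of_conj_pow_eq_one _ hτN huv hτ
  choose r P hr hu hv using fun i =>
    exists_trace_eq_mul_aeval hζ (congrFun huv i : u i * v i = 1) (hc i)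
  have hsum : ∑ i, aeval ζ (P i) * aeval ζ⁻¹ (P i) = 0 := by
    rw [← hone, htr]
    refine Finset.sum_congr rfl fun i _ => ?_
    rw [Pi.one_apply, mul_one, hu, hv, mul_mul_mul_comm, mul_inv_cancel₀ (hr i), one_mul]
  have hP := aeval_eq_zero_of_sum_mul_aeval_inv_eq_zero hζ P hsum
  have hone_eq_zero : (1 : Π i, Matrix (Fin (d i)) (Fin (d i)) K) = 0 := hnd 1 fun x => by
    rw [twistedTraceForm_apply, htr]
    exact Finset.sum_eq_zero fun i _ => by rw [hu, hP, mul_zero, zero_mul]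
  exact one_ne_zero (e.injective (by rw [map_one, map_zero, hone_eq_zero]))

theorem twistedTrace_one_ne_zero {k Y : Type*} [Field k] [CharZero k] [Ring Y] [Algebra k Y]
    [Nontrivial Y] [FiniteDimensional k Y] (σ : Y ≃ₐ[k] Y) (hσ : σ ^ N = 1)
    (h : (twistedTraceForm σ.toLinearMap).SeparatingLeft) :
    twistedTrace σ.toLinearMap 1 ≠ 0 := by
  let K := AlgebraicClosure k
  let σK : K ⊗[k] Y ≃ₐ[K] K ⊗[k] Y := Algebra.TensorProduct.congr AlgEquiv.refl σ
  have hσK : σK.toLinearMap = σ.toLinearMap.baseChange K := by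
    ext y
    rfl
  have hpow (l : ℕ) (a : K) (y : Y) : (σK ^ l) (a ⊗ₜ[k] y) = a ⊗ₜ[k] (σ ^ l) y := by
    induction l generalizing y with
    | zero => rfl
    | succ _ ih => exact ih (σ y)
  have hσKN : σK ^ N = 1 := AlgEquiv.toLinearMap_injective <| by
    ext y
    exact (hpow N 1 y).trans (by rw [hσ]; rfl)
  have hne := twistedTrace_one_ne_zero_of_isAlgClosed σK hσKN <| by
    rw [hσK, twistedTraceForm_baseChange]
    exact separatingLeft_baseChange K h
  rw [hσK, Algebra.TensorProduct.one_def, twistedTrace_baseChange] at hne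
  exact fun hone => hne (by rw [hone, map_zero])

end FiniteOrder

theorem exists_inverse_of_isUnit {k V : Type*} [Semiring k] [AddCommMonoid V] [Module k V]
    {S : V →ₗ[k] V} (h : IsUnit (S : Module.End k V)) :
    ∃ T : V →ₗ[k] V, (∀ x, S (T x) = x) ∧ ∀ x, T (S x) = x := by
  obtain ⟨u, rfl⟩ := h
  exact ⟨(u⁻¹ : (Module.End k V)ˣ), LinearMap.congr_fun u.mul_inv, LinearMap.congr_fun u.inv_mul⟩

theorem IsBraidedHopfAlgebra.twistedTrace_eq_zero_of_one {k U : Type*} [Field k] [CharZero k]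
    [Ring U] [HopfAlgebra k U] {R : (U ⊗[k] U)ˣ} {Y : Type*} [Ring Y] [Algebra k Y] [Coalgebra k Y]
    [Module U Y] [IsScalarTower k U Y] [FiniteDimensional k Y] {S : Y →ₗ[k] Y}
    (hY : IsBraidedHopfAlgebra R S) (hR : IsUniversalRMatrix R)
    {I : Type*} [Fintype I] {A B : I → U}
    (hAB : (R : U ⊗[k] U) = ∑ i, A i ⊗ₜ[k] B i)
    {T : Y →ₗ[k] Y} (hST : ∀ x, S (T x) = x) (hTS : ∀ x, T (S x) = x)
    (h : twistedTrace (twist (IsUniversalRMatrix.drinfeldInv k A B) T) (1 : Y) = 0) :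
    twistedTrace (twist (IsUniversalRMatrix.drinfeldInv k A B) T) = 0 := by
  by_contra hne
  obtain ⟨Λ, hΛ, htΛ⟩ := hY.exists_integral hR hAB hST hTS hne
  obtain ⟨N, hN, hpow⟩ := hY.exists_twist_pow_eq_one hR hAB hST hTS hne
  have : NeZero N := ⟨hN.ne'⟩
  have : Nontrivial Y := nontrivial_of_ne Λ 0 fun h0 => by simp [h0] at htΛ
  let σ : Y ≃ₐ[k] Y := AlgEquiv.ofBijective
    (AlgHom.ofLinearMap (twist (IsUniversalRMatrix.drinfeldInv k A B) T) (hY.twist_one hR hAB hTS)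
      (hY.twist_mul hR hAB hST hTS))
    ((Module.End.isUnit_iff _).1 (.of_pow_eq_one hpow hN.ne'))
  have hσ (l : ℕ) (y : Y) :
      (σ ^ l) y = (twist (IsUniversalRMatrix.drinfeldInv k A B) T ^ l) y := by
    induction l generalizing y with
    | zero => rfl
    | succ _ ih => exact ih (σ y)
  exact twistedTrace_one_ne_zero σ (N := N)
    (AlgEquiv.ext fun y => (hσ N y).trans (LinearMap.congr_fun hpow y))
    (fun a ha => hY.eq_zero_of_twistedTrace_mul_eq_zero hR hAB hST hTS hΛ htΛ ha) h

section Pairing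

variable {k U X D : Type*} [Field k] [Ring U] [HopfAlgebra k U]
  [Ring X] [Algebra k X] [Module U X] [IsScalarTower k U X]
  [Ring D] [Algebra k D] [Module U D] [IsScalarTower k U D]
  {p : D →ₗ[k] X →ₗ[k] k} {R : (U ⊗[k] U)ˣ} {SX : X →ₗ[k] X} {SD : D →ₗ[k] D}

theorem braidedTrace_eq_zero_of_not_isUnit (c : X ⊗[k] D) (h : ¬ IsUnit (SD : Module.End k D)) :
    braidedTrace R p c SD = 0 := by
  ext ξ
  simp [braidedTrace, antipodeInvSq_of_not_isUnit h]

theorem braidedTraceDual_eq_zero_of_not_isUnit (c : X ⊗[k] D)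
    (h : ¬ IsUnit (SX : Module.End k X)) : braidedTraceDual R p c SX = 0 := by
  ext σ
  simp [braidedTraceDual, antipodeInvSq_of_not_isUnit h]

namespace IsBraidedDualPairing

variable [Coalgebra k X] [Coalgebra k D]
  (hp : IsBraidedDualPairing U p) (hX : IsBraidedHopfAlgebra R SX)
  (hD : IsBraidedHopfAlgebra R SD) {ι : Type*} [Fintype ι] [DecidableEq ι]
  {φ : Module.Basis ι k X} {ε : Module.Basis ι k D}
  (hdual : ∀ i j, p (ε i) (φ j) = if i = j then 1 else 0)

include hp hX hD hdual

omit [Fintype ι] in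
theorem isUnit_antipode_iff [Finite ι] :
    IsUnit (SX : Module.End k X) ↔ IsUnit (SD : Module.End k D) := by
  cases nonempty_fintype ι
  have hmatrix : (LinearMap.toMatrix φ φ SX).transpose = LinearMap.toMatrix ε ε SD := by
    ext i j
    rw [Matrix.transpose_apply, LinearMap.toMatrix_apply, LinearMap.toMatrix_apply,
      ← Module.Basis.coord_apply, ← Module.Basis.coord_apply, ← pairing_apply_basis_left hdual,
      ← pairing_apply_basis_right hdual, hp.antipode_left hX hD]
  rw [← MulEquiv.isUnit_map (LinearMap.toMatrixAlgEquiv φ),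
    ← MulEquiv.isUnit_map (LinearMap.toMatrixAlgEquiv ε), ← Matrix.isUnit_transpose]
  exact iff_of_eq (congrArg IsUnit hmatrix)

theorem braidedTrace_eq_zero_of_apply_one_eq_zero [CharZero k] (hR : IsUniversalRMatrix R)
    (hSX : IsUnit (SX : Module.End k X))
    (h : braidedTrace R p (∑ i, φ i ⊗ₜ[k] ε i) SD 1 = 0) :
    braidedTrace R p (∑ i, φ i ⊗ₜ[k] ε i) SD = 0 := by
  have : FiniteDimensional k X := .of_basis φ
  obtain ⟨n, A, B, hAB⟩ := TensorProduct.exists_sum_tmul_eq (R : U ⊗[k] U)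
  obtain ⟨TX, hSTX, hTSX⟩ := exists_inverse_of_isUnit hSX
  obtain ⟨TD, hSTD, hTSD⟩ :=
    exists_inverse_of_isUnit ((hp.isUnit_antipode_iff hX hD hdual).1 hSX)
  have htrace := hp.braidedTrace_apply hR hAB hX hD hSTX hSTD hTSD hdual
  ext ξ
  rw [htrace] at h ⊢
  rw [hX.twistedTrace_eq_zero_of_one hR hAB hSTX hTSX h]

end IsBraidedDualPairing

end Pairing

theorem lemma7 {k U X D ι : Type*} [Field k] [Ring U] [HopfAlgebra k U]
    (R : (U ⊗[k] U)ˣ) (hR : IsUniversalRMatrix R)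
    [Ring X] [Algebra k X] [Coalgebra k X] [Module U X] [IsScalarTower k U X]
    [Ring D] [Algebra k D] [Coalgebra k D] [Module U D] [IsScalarTower k U D]
    (SX : X →ₗ[k] X) (hX : IsBraidedHopfAlgebra R SX)
    (SD : D →ₗ[k] D) (hD : IsBraidedHopfAlgebra R SD)
    (p : D →ₗ[k] X →ₗ[k] k) (hp : IsBraidedDualPairing U p)
    [Fintype ι] [DecidableEq ι] (φ : Module.Basis ι k X) (ε : Module.Basis ι k D)
    (hdual : ∀ i j, p (ε i) (φ j) = if i = j then 1 else 0)
    (c : X ⊗[k] D) (hc : c = ∑ i, φ i ⊗ₜ[k] ε i) :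
    (∀ (σ : D) (ξ : X),
      braidedTraceDual R p c SX σ * braidedTrace R p c SD ξ =
        braidedTrace R p c SD 1 * braidedLoop R p c SD σ ξ) ∧
    (braidedTrace R p c SD 1 ≠ 0 →
      IsInvariantIntegral (braidedTrace R p c SD) ∧
        braidedTrace R p c SD ≠ 0 ∧ braidedTraceDual R p c SX ≠ 0) ∧
    (braidedTrace R p c SD 1 = 0 →
      braidedTrace R p c SD = 0 ∨ braidedTraceDual R p c SX = 0) ∧
    (CharZero k → (braidedTrace R p c SD = 0 ↔ braidedTrace R p c SD 1 = 0)) := by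
  subst hc
  by_cases hSX : IsUnit (SX : Module.End k X)
  · have hSD := (hp.isUnit_antipode_iff hX hD hdual).1 hSX
    obtain ⟨n, A, B, hAB⟩ := TensorProduct.exists_sum_tmul_eq (R : U ⊗[k] U)
    obtain ⟨TX, hSTX, hTSX⟩ := exists_inverse_of_isUnit hSX
    obtain ⟨TD, hSTD, hTSD⟩ := exists_inverse_of_isUnit hSD
    have hmul := hp.braidedTraceDual_mul_braidedTrace hR hAB hX hD hSTX hTSX hSTD hTSD hdual
    have hint := hp.isInvariantIntegral_braidedTrace hR hAB hX hD hSTX hTSX hSTD hTSD hdual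
    have hone := hp.braidedTrace_one_eq hX hD hSTX hTSX hSTD hTSD (∑ i, φ i ⊗ₜ[k] ε i)
    refine ⟨hmul, fun h => ⟨hint, ?_, ?_⟩, fun h => ?_, fun _ => ⟨fun h0 => by rw [h0]; rfl,
      hp.braidedTrace_eq_zero_of_apply_one_eq_zero hX hD hdual hR hSX⟩⟩
    · exact fun h0 => h (by rw [h0]; rfl)
    · exact fun h0 => h (by rw [hone, h0]; rfl)
    · by_contra! hne
      obtain ⟨ξ, hξ⟩ := DFunLike.ne_iff.1 hne.1
      obtain ⟨σ, hσ⟩ := DFunLike.ne_iff.1 hne.2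
      exact mul_ne_zero hσ hξ (by rw [hmul, h, zero_mul])
  · have hSD := mt (hp.isUnit_antipode_iff hX hD hdual).2 hSX
    simp [braidedTrace_eq_zero_of_not_isUnit _ hSD, braidedTraceDual_eq_zero_of_not_isUnit _ hSX]
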